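/- **The suplogarithmic case.** *Branching.* Let $\mathbb U=\{\emptyset\}\cup\bigcup_{k\ge1}\mathbb N^k$ be the set of labels, $\mathbb N=\{1,2,\dots\}$, and let $(N(x))_{x\in\mathbb U}$ be iid random variables with values in $\{0,1,2,\dots\}$. Let $\mathbb T$ be the random tree with root $\emptyset$ in which the children of $x$ are $(x,1),\dots,(x,N(x))$, let $\mathbb T_n$ be its $n$-th generation and $Z_n=\#\mathbb T_n$. Assume $m:=\mathbb E[Z_1]\in(1,\infty)$ and $\mathbb E[Z_1\log^+Z_1]<\infty$, and let $W=\lim_{n\to\infty}m^{-n}Z_n$ (which exists almost surely). *Displacements.* Let $(X_y)_{y\in\mathbb U\setminus\{\emptyset\}}$ be iid copies of a real random variable $X$, independent of $(N(x))_{x\in\mathbb U}$, and let $V(x)=\sum_{y}X_y$, the sum being over the vertices $y\ne\emptyset$ on the path from $\emptyset$ to $x$ (with $x$ included). Assume that $\mathbb P[X>t]=a(t)e^{-L(t)}$ for all $t\in\mathbb R$, where $a(t)\to a$ as $t\to\infty$ for some $a>0$, and $L$ is a $C^2$ function on $\mathbb R$ which is slowly varying at $+\infty$ (that is, $L(ct)/L(t)\to1$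 as $t\to\infty$ for every $c>0$) and satisfies $$\lim_{x\to\infty}\frac{L''(x)}{L'(x)^2}=0,\qquad \lim_{x\to\infty}\frac{L(x)}{xL'(x)\sqrt{\log\log L(x)}}=\infty ,$$ and that $x\mapsto x^{-1/3}L(x)$ is eventually decreasing. Assume also that for some $\varepsilon>0$ one has $\mathbb P[X<-t]\le t^{-\varepsilon}$ for all sufficiently large $t$. Put $$b_n=\inf\{t\ge0:\mathbb P[X>t]\le m^{-n}\},\qquad a_n=\frac1{L'(b_n)} .$$ *Limit.* Let $v=\sum_{l\ge0}m^{-l}\,\mathbb P[Z_l>0]$. On some probability space let $\sum_k\delta_{\ell_k}$ be a Poisson point process on $\mathbb R$ with intensity $e^{-x}\,dx$, let $A_1,A_2,\dots$ be iid with $$\mathbb P[A_k=j]=\frac1v\sum_{l=0}^\infty m^{-l}\,\mathbb P[Z_l=j],\qquad j\in\mathbb N,$$ let $W$ also denote a random variable with the law of the limit $W$ above, and let $(\ell_k)_k$, $(A_k)_k$ and $W$ be independent. Define $$\mathbf V=\sum_kA_k\,\delta_{\ell_k+\log(vW)},$$ with $\mathbf V=0$ on the event $\{W=0\}$. *Claim.*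 As $n\to\infty$, $$\sum_{x\in\mathbb T_n}\delta_{(V(x)-b_n)/a_n}\ \Longrightarrow\ \mathbf V$$ weakly (in distribution) in $\mathbb M((-\infty,\infty])$, the space of measures on $(-\infty,\infty]$ that are finite on compact subsets, with the vague topology, i.e. the coarsest topology for which $\nu\mapsto\int f\,d\nu$ is continuous for every non-negative continuous $f$ with compact support in $(-\infty,\infty]$. -/

import Mathlib

open MeasureTheory ProbabilityTheory Filter Topology
open scoped ENNReal NNReal CompactlySupported

noncomputable section

namespace BRW

/-! ### The space `M((-∞, ∞])` of Radon measures with the vague topology -/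

/-- The half-compactified line `(-∞, ∞]`, with the topology and Borel sets induced by `EReal`. -/
abbrev RBar : Type := {x : EReal // x ≠ ⊥}

/-- The inclusion of the real line in `(-∞, ∞]`. -/
def toRBar (x : ℝ) : RBar := ⟨(x : EReal), EReal.coe_ne_bot x⟩

/-- Measures on `(-∞, ∞]` which give finite mass to every compact subset. -/
def RadonM : Type := {ν : Measure RBar // IsFiniteMeasureOnCompacts ν}

/-- The vague topology: the coarsest one for which all the maps `ν ↦ ∫ f dν`, with `f ≥ 0`
continuous of compact support in `(-∞, ∞]`, are continuous. -/
instance : TopologicalSpace RadonM :=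
  ⨅ f : C_c(RBar, ℝ≥0),
    TopologicalSpace.induced (fun ν : RadonM => ∫ x, (f x : ℝ) ∂ν.1) inferInstance

/-- The Borel sets of the vague topology. -/
instance : MeasurableSpace RadonM := borel RadonM

instance : BorelSpace RadonM := ⟨rfl⟩

open Classical in
/-- View a measure as an element of `M((-∞, ∞])`. The null measure is used for a measure which is
not locally finite; for the point processes below this happens with probability zero. -/
def toRadonM (ν : Measure RBar) : RadonM :=
  if h : IsFiniteMeasureOnCompacts ν then ⟨ν, h⟩ else ⟨0, inferInstance⟩

/-! ### The branching random walk -/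

/-- Labels of potential particles. A label lists the birth ranks along the ancestral line with the
youngest generation first: `[]` is the root, `i :: x` is the child number `i` of `x`
(children are numbered `0, 1, 2, …`), and the generation of `x` is `x.length`. -/
abbrev Label : Type := List ℕ

/-- Labels of all the particles except the root; they carry the displacements. -/
abbrev NonRoot : Type := {y : Label // y ≠ []}

section Model

variable {Ω : Type*}

/-- `x` belongs to the random tree: each ancestor's birth rank is admissible for its parent. -/
def InTree (N : Label → Ω → ℕ) (ω : Ω) : Label → Prop
  | [] => True
  | i :: x => InTree N ω x ∧ i < N x ω

/-- The set of the particles alive in generation `n`. -/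
def generation (N : Label → Ω → ℕ) (n : ℕ) (ω : Ω) : Set Label :=
  {x | x.length = n ∧ InTree N ω x}

/-- The Galton–Watson process `Z_n`. -/
def gwSize (N : Label → Ω → ℕ) (n : ℕ) (ω : Ω) : ℕ := (generation N n ω).ncard

/-- The limit `W` of `Z_n / m ^ n`. -/
def gwLimit (N : Label → Ω → ℕ) (m : ℝ) (ω : Ω) : ℝ :=
  limUnder atTop (fun n : ℕ => (gwSize N n ω : ℝ) / m ^ n)

/-- The position of a particle: the sum of the displacements along its ancestral line. -/
def position (X : NonRoot → Ω → ℝ) (ω : Ω) : Label → ℝ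
  | [] => 0
  | i :: x => position X ω x + X ⟨i :: x, List.cons_ne_nil i x⟩ ω

/-- The point process `∑_{|x| = n} δ_{(V(x) - b) / a}` on `(-∞, ∞]`. -/
def rescaledProcess (N : Label → Ω → ℕ) (X : NonRoot → Ω → ℝ) (a b : ℝ) (n : ℕ) (ω : Ω) :
    Measure RBar :=
  Measure.sum fun x : generation N n ω => Measure.dirac (toRBar ((position X ω x.1 - b) / a))

/-- The offspring numbers `N` are iid with law `p`, the displacements `X` are iid with law `ν`, and
the two families are independent. -/
structure IsBranchingRandomWalk [MeasurableSpace Ω] (p : Measure ℕ) (ν : Measure ℝ)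
    (N : Label → Ω → ℕ) (X : NonRoot → Ω → ℝ) (P : Measure Ω) : Prop where
  measurable_offspring : ∀ u, Measurable (N u)
  measurable_displacement : ∀ y, Measurable (X y)
  law_offspring : ∀ u, P.map (N u) = p
  law_displacement : ∀ y, P.map (X y) = ν
  iIndep_offspring : iIndepFun N P
  iIndep_displacement : iIndepFun X P
  indep : IndepFun (fun ω u => N u ω) (fun ω y => X y ω) P

end Model

/-! ### Assumptions on the offspring law and on the displacement law -/

/-- The mean `m` of the offspring law. -/
def offspringMean (p : Measure ℕ) : ℝ := ∫ k, (k : ℝ) ∂p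

/-- Supercriticality `m ∈ (1, ∞)` and `E[Z_1 log⁺ Z_1] < ∞`. -/
structure OffspringAssumption (p : Measure ℕ) : Prop where
  integrable : Integrable (fun k : ℕ => (k : ℝ)) p
  one_lt_mean : 1 < offspringMean p
  integrable_mul_log : Integrable (fun k : ℕ => (k : ℝ) * Real.posLog (k : ℝ)) p

/-- Slow variation at `+∞`. -/
def IsSlowlyVarying (f : ℝ → ℝ) : Prop :=
  ∀ c : ℝ, 0 < c → Tendsto (fun t => f (c * t) / f t) atTop (𝓝 1)

/-- The assumptions on the displacement law in the suplogarithmic case. -/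
structure SuplogAssumption (ν : Measure ℝ) (a L : ℝ → ℝ) : Prop where
  tail : ∀ t : ℝ, ν.real (Set.Ioi t) = a t * Real.exp (-L t)
  prefactor : ∃ a₀ : ℝ, 0 < a₀ ∧ Tendsto a atTop (𝓝 a₀)
  contDiff : ContDiff ℝ 2 L
  slowlyVarying : IsSlowlyVarying L
  vonMises : Tendsto (fun x => deriv (deriv L) x / (deriv L x) ^ 2) atTop (𝓝 0)
  growth : Tendsto
    (fun x => L x / (x * deriv L x * Real.sqrt (Real.log (Real.log (L x))))) atTop atTop
  decreasing : ∃ x₀ : ℝ, AntitoneOn (fun x => x ^ (-(1 / 3) : ℝ) * L x) (Set.Ici x₀)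
  leftTail : ∃ ε : ℝ, 0 < ε ∧ ∀ᶠ t in atTop, ν.real (Set.Iio (-t)) ≤ t ^ (-ε)

/-- The centring `b_n = inf {t ≥ 0 : P[X > t] ≤ m ^ (-n)}`. -/
def centring (ν : Measure ℝ) (m : ℝ) (n : ℕ) : ℝ :=
  sInf {t : ℝ | 0 ≤ t ∧ ν.real (Set.Ioi t) ≤ (m ^ n)⁻¹}

/-- The scaling `a_n = 1 / L'(b_n)`. -/
def scaling (ν : Measure ℝ) (L : ℝ → ℝ) (m : ℝ) (n : ℕ) : ℝ :=
  1 / deriv L (centring ν m n)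

/-! ### The limiting cluster Cox process -/

/-- The random measure `Ξ` is a Poisson point process with intensity `Λ`: its counts are Poisson,
and independent on disjoint sets. -/
structure IsPoissonProcess {Ω E : Type*} [MeasurableSpace Ω] [MeasurableSpace E]
    (Ξ : Ω → Measure E) (Λ : Measure E) (P : Measure Ω) : Prop where
  count_law : ∀ B : Set E, MeasurableSet B → Λ B ≠ ∞ →
    HasLaw (fun ω => Ξ ω B)
      ((poissonMeasure (Λ B).toNNReal).map (fun k : ℕ => (k : ℝ≥0∞))) P
  count_indep : ∀ (n : ℕ) (B : Fin n → Set E), (∀ i, MeasurableSet (B i)) →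
    Pairwise (Function.onFun Disjoint B) → iIndepFun (fun i ω => Ξ ω (B i)) P

/-- The measure `e^{-x} dx` on the real line. -/
def gumbelIntensity : Measure ℝ :=
  (volume : Measure ℝ).withDensity fun x => ENNReal.ofReal (Real.exp (-x))

/-- The constant `v = ∑_l m^{-l} P[Z_l > 0]`. -/
def clusterConst {Ω : Type*} [MeasurableSpace Ω] (P : Measure Ω) (N : Label → Ω → ℕ) (m : ℝ) : ℝ :=
  ∑' l : ℕ, (m ^ l)⁻¹ * P.real {ω | 0 < gwSize N l ω}

/-- The probability weights `(1/v) ∑_l m^{-l} P[Z_l = j]`, `j ≥ 1`, of the cluster size. -/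
def clusterWeight {Ω : Type*} [MeasurableSpace Ω] (P : Measure Ω) (N : Label → Ω → ℕ) (m : ℝ)
    (j : ℕ) : ℝ :=
  1 / clusterConst P N m * ∑' l : ℕ, (m ^ l)⁻¹ * P.real {ω | gwSize N l ω = j}

/-- The ingredients of the limit, realised on some probability space `(Ω', P')`: the atoms `ℓ k` of
a Poisson process with intensity `e^{-x} dx`, iid cluster sizes `A k`, and a copy `W` of the limit
of the Galton–Watson martingale, all independent. -/
structure IsLimitData {Ω Ω' : Type*} [MeasurableSpace Ω] [MeasurableSpace Ω']
    (P : Measure Ω) (N : Label → Ω → ℕ) (m : ℝ) (P' : Measure Ω')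
    (ℓ : ℕ → Ω' → ℝ) (A : ℕ → Ω' → ℕ) (W : Ω' → ℝ) : Prop where
  measurable_atom : ∀ k, Measurable (ℓ k)
  measurable_size : ∀ k, Measurable (A k)
  measurable_shift : Measurable W
  poisson : IsPoissonProcess (fun ω => Measure.sum fun k => Measure.dirac (ℓ k ω))
    gumbelIntensity P'
  law_size : ∀ k j : ℕ, 1 ≤ j → P'.real {ω | A k ω = j} = clusterWeight P N m j
  iIndep_size : iIndepFun A P'
  law_shift : IdentDistrib W (gwLimit N m) P' P
  indep_atom : IndepFun (fun ω k => ℓ k ω) (fun ω => ((fun k => A k ω), W ω)) P'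
  indep_size_shift : IndepFun (fun ω k => A k ω) W P'

open Classical in
/-- The cluster Cox process `∑_k A_k δ_{ℓ_k + log(v W)}`, which is null when `W = 0`. -/
def clusterCox {Ω' : Type*} (v : ℝ) (ℓ : ℕ → Ω' → ℝ) (A : ℕ → Ω' → ℕ) (W : Ω' → ℝ) (ω : Ω') :
    Measure RBar :=
  if 0 < W ω then
    Measure.sum fun k =>
      (A k ω : ℝ≥0∞) • Measure.dirac (toRBar (ℓ k ω + Real.log (v * W ω)))
  else 0

end BRW

end

/-!
Convergence in distribution in the vague topology follows from the convergence of the Laplace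
functionals `E exp (-∫ f dV_n)` for all test functions `f` (`tendstoInDistribution_of_laplace`):
countably many test functions embed the space of Radon measures in the cube `[0, 1]^ℕ`, where the
convergence of moments suffices. So both sides are computed.

*One large displacement decides a position.* The mean size of generation `n` is `m ^ n`, and by the
many-to-one bound `lintegral_sum_treeGen_le` an event of probability `o(m^{-n})` for a single walk of
length `n` can be neglected. Two such events occur. A walk may exceed `b_n - C a_n` without a
displacement above `b_n - (C + 1) a_n`; this is excluded by `eventually_measure_sum_le`, which rests on
the exponential moments `exists_lintegral_exp_min_le` of truncated displacements: if all displacements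
are at most `b_n / 4`, Chernoff's bound is good enough, and otherwise one displacement is conditioned
on the sum of the others. Or a walk may have a displacement above `b_n - (C + 1) a_n` while the others
do not add up to `o(a_n)`; this is excluded by `eventually_measure_sum_erase_le`, since `a_n` grows
faster than every power of `n`. Hence the sum of `f` over the rescaled positions may be replaced by the
sum of `f` over all rescaled displacements on the ancestral lines
(`tendsto_lintegral_abs_exp_walkSum_sub`).

*The large displacements.* Given the tree the displacements are independent, and that of `y` counts as
often as `y` has descendants in generation `n`. The conditional Laplace functional is a product of
factors close to `1`, hence close to the exponential of a sum over the tree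
(`abs_integral_jumpSum_sub_le`). The von Mises condition gives
`m ^ n P(X > b_n + t a_n) → e^{-t}` (`tendsto_pow_mul_tail`), so the summand at a particle with `j`
descendants is nearly `m^{-n} g(j)` with `g(j) = ∫ (1 - e^{-j f(x)}) e^{-x} dx`. By a law of large
numbers for the subtrees (`tendsto_integral_exp_neg_clusterSum`) the sum tends to
`W ∑_l m^{-l} E g(Z_l)`.

*The limit.* For the cluster Cox process, integrating out the marks and then the Poisson process gives
the exponent `v W ∫ E[1 - e^{-A f(x)}] e^{-x} dx` (`lintegral_expNeg_clusterCox`), the shift by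
`log (v W)` having turned into the factor `v W`. By the definition of the law of `A` this is the same
exponent (`mul_lintegral_clusterDefect`).
-/

namespace BRW

/-! ### The vague topology is generated by countably many test functions -/

instance : LocallyCompactSpace RBar :=
  (isOpen_ne : IsOpen {x : EReal | x ≠ ⊥}).locallyCompactSpace

instance : SecondCountableTopology RBar :=
  inferInstanceAs (SecondCountableTopology {x : EReal | x ≠ ⊥})

/-- The functional `ν ↦ ∫ f dν` on Radon measures attached to a test function `f`. -/
noncomputable def testInt (f : C_c(RBar, ℝ≥0)) (ν : RadonM) : ℝ := ∫ x, (f x : ℝ) ∂ν.1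

lemma testInt_nonneg (f : C_c(RBar, ℝ≥0)) (ν : RadonM) : 0 ≤ testInt f ν :=
  integral_nonneg fun _ => NNReal.coe_nonneg _

lemma integrable_testFun (f : C_c(RBar, ℝ≥0)) (ν : RadonM) :
    Integrable (fun x => (f x : ℝ)) ν.1 := by
  have := ν.2
  have hf : Continuous fun x => (f x : ℝ) := by
    have := f.continuous
    fun_prop
  refine hf.integrable_of_hasCompactSupport ?_
  exact f.hasCompactSupport.comp_left (g := fun r : ℝ≥0 => (r : ℝ)) rfl

lemma continuous_testInt (f : C_c(RBar, ℝ≥0)) : Continuous (testInt f) := by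
  refine continuous_iInf_dom (i := f) ?_
  exact continuous_induced_dom

lemma testInt_add (f g : C_c(RBar, ℝ≥0)) (ν : RadonM) :
    testInt (f + g) ν = testInt f ν + testInt g ν := by
  unfold testInt
  rw [← integral_add (integrable_testFun f ν) (integrable_testFun g ν)]
  simp

/-- A countable family of test functions from which every test function `f` can be approximated
uniformly, with an error controlled by one further member `χ` of the family. -/
lemma exists_countable_test_family :
    ∃ D : Set C_c(RBar, ℝ≥0), D.Countable ∧ ∀ f : C_c(RBar, ℝ≥0), ∃ χ ∈ D,
      ∀ ε : ℝ, 0 < ε → ∃ g ∈ D, ∀ x, |(f x : ℝ) - g x| ≤ ε * χ x := by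
  classical
  let K : CompactExhaustion RBar := CompactExhaustion.choice RBar
  have hχ : ∀ k, ∃ χ : C_c(RBar, ℝ≥0), ∀ x ∈ K k, 1 ≤ χ x := by
    intro k
    obtain ⟨f, hf1, hf2, -, hf3⟩ :=
      exists_continuousMap_one_of_isCompact_subset_isOpen (K.isCompact k) isOpen_univ
        (Set.subset_univ _)
    refine ⟨⟨⟨fun x => (f x).toNNReal, by fun_prop⟩, ?_⟩, ?_⟩
    · exact HasCompactSupport.comp_left (g := Real.toNNReal) hf2 (by simp)
    · intro x hx
      have : f x = 1 := hf1 hx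
      change 1 ≤ (f x).toNNReal
      simp [this]
  choose χ hχ using hχ
  -- `C(RBar, ℝ≥0)` is second countable in the compact-open topology, so the functions supported by
  -- a given compact set contain a countable dense subset.
  let S : ℕ → Set C(RBar, ℝ≥0) := fun k => {f | tsupport f ⊆ K k}
  have hS : ∀ k, ∃ D : Set C(RBar, ℝ≥0), D ⊆ S k ∧ D.Countable ∧ S k ⊆ closure D := fun k =>
    (TopologicalSpace.IsSeparable.of_separableSpace (S k)).exists_countable_dense_subset
  choose D hDS hDc hDd using hS
  have hcs : ∀ k, ∀ f ∈ S k, HasCompactSupport f := fun k f hf =>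
    (K.isCompact k).of_isClosed_subset (isClosed_tsupport _) hf
  let E : ℕ → Set C_c(RBar, ℝ≥0) := fun k => {f | (f : C(RBar, ℝ≥0)) ∈ D k}
  have hinj : Function.Injective (fun f : C_c(RBar, ℝ≥0) => (f : C(RBar, ℝ≥0))) := by
    intro f g h
    ext x
    have := DFunLike.congr_fun h x
    exact congrArg _ this
  refine ⟨(⋃ k, E k) ∪ Set.range χ, ?_, ?_⟩
  · refine Set.Countable.union (Set.countable_iUnion fun k => ?_) (Set.countable_range _)
    exact (hDc k).preimage_of_injOn hinj.injOn
  intro f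
  obtain ⟨k, hk⟩ := K.exists_superset_of_isCompact f.hasCompactSupport
  refine ⟨χ k, Or.inr ⟨k, rfl⟩, fun ε hε => ?_⟩
  have hfS : (f : C(RBar, ℝ≥0)) ∈ closure (D k) := hDd k hk
  obtain ⟨u, huD, hu⟩ := mem_closure_iff_seq_limit.1 hfS
  have hu' := ContinuousMap.tendsto_iff_forall_isCompact_tendstoUniformlyOn.1 hu (K k)
    (K.isCompact k)
  rw [Metric.tendstoUniformlyOn_iff] at hu'
  obtain ⟨n, hn⟩ := (hu' ε hε).exists
  refine ⟨⟨u n, hcs k _ (hDS k (huD n))⟩, Or.inl (Set.mem_iUnion.2 ⟨k, huD n⟩), fun x => ?_⟩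
  by_cases hx : x ∈ K k
  · have h1 : |(f x : ℝ) - u n x| < ε := by
      have := hn x hx
      rwa [NNReal.dist_eq] at this
    have h2 : (1 : ℝ) ≤ χ k x := by exact_mod_cast hχ k x hx
    refine h1.le.trans ?_
    nlinarith
  · have h1 : f x = 0 := by
      by_contra h
      exact hx (hk (subset_tsupport _ h))
    have h2 : u n x = 0 := by
      by_contra h
      exact hx (hDS k (huD n) (subset_tsupport _ h))
    change |(f x : ℝ) - u n x| ≤ _
    rw [h1, h2]
    simp only [NNReal.coe_zero, sub_self, abs_zero]
    positivity

/-- Countably many test functions induce the vague topology. -/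
lemma exists_isInducing_testInt :
    ∃ g : ℕ → C_c(RBar, ℝ≥0), IsInducing fun (ν : RadonM) (k : ℕ) => testInt (g k) ν := by
  obtain ⟨D, hDc, hD⟩ := exists_countable_test_family
  have hne : D.Nonempty := let ⟨χ, h, _⟩ := hD 0; ⟨χ, h⟩
  obtain ⟨g, hg⟩ := hDc.exists_eq_range hne
  refine ⟨g, ⟨le_antisymm ?_ ?_⟩⟩
  · rw [← continuous_iff_le_induced]
    exact continuous_pi fun k => continuous_testInt _
  · let t : TopologicalSpace RadonM :=
      TopologicalSpace.induced (fun (ν : RadonM) (k : ℕ) => testInt (g k) ν) inferInstance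
    have hgc : ∀ h ∈ D, @Continuous _ _ t _ (testInt h) := by
      intro h hh
      rw [hg] at hh
      obtain ⟨k, rfl⟩ := hh
      exact @Continuous.comp _ _ _ t _ _ _ _ (continuous_apply k) continuous_induced_dom
    refine le_iInf fun f => ?_
    rw [← continuous_iff_le_induced]
    change @Continuous _ _ t _ (testInt f)
    obtain ⟨χ, hχ, happ⟩ := hD f
    have hχc := hgc χ hχ
    rw [continuous_iff_continuousAt]
    intro ν₀
    rw [ContinuousAt, Metric.tendsto_nhds]
    intro ε hε
    set M := testInt χ ν₀ + 1 with hM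
    have hMpos : 0 < M := by have := testInt_nonneg χ ν₀; linarith
    obtain ⟨h, hh, hfh⟩ := happ (ε / (4 * M)) (by positivity)
    have key : ∀ ν : RadonM, |testInt f ν - testInt h ν| ≤ ε / (4 * M) * testInt χ ν := by
      intro ν
      unfold testInt
      rw [← integral_sub (integrable_testFun f ν) (integrable_testFun h ν),
        ← integral_const_mul, ← Real.norm_eq_abs]
      exact norm_integral_le_of_norm_le ((integrable_testFun χ ν).const_mul _)
        (Eventually.of_forall fun x => hfh x)
    have e1 : ∀ᶠ ν in @nhds _ t ν₀, testInt χ ν < M :=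
      hχc.continuousAt.eventually (gt_mem_nhds (by linarith))
    have e2 : ∀ᶠ ν in @nhds _ t ν₀, dist (testInt h ν) (testInt h ν₀) < ε / 4 :=
      (hgc h hh).continuousAt.eventually (Metric.ball_mem_nhds _ (by positivity))
    filter_upwards [e1, e2] with ν h1 h2
    have k1 := key ν
    have k2 := key ν₀
    have h3 : ε / (4 * M) * testInt χ ν ≤ ε / 4 := by
      calc ε / (4 * M) * testInt χ ν ≤ ε / (4 * M) * M := by gcongr
        _ = ε / 4 := by field_simp
    have h4 : ε / (4 * M) * testInt χ ν₀ ≤ ε / 4 := by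
      calc ε / (4 * M) * testInt χ ν₀ ≤ ε / (4 * M) * M := by gcongr; linarith
        _ = ε / 4 := by field_simp
    rw [Real.dist_eq] at h2 ⊢
    rw [abs_le] at k1 k2
    rw [abs_lt] at h2 ⊢
    constructor <;> linarith

/-- A map into the space of Radon measures is measurable as soon as the integrals of test functions
are. -/
lemma measurable_radonM {Ω : Type*} [MeasurableSpace Ω] {V : Ω → RadonM}
    (hV : ∀ f, Measurable fun ω => testInt f (V ω)) : Measurable V := by
  obtain ⟨g, hg⟩ := exists_isInducing_testInt
  have h1 : borel RadonM =
      MeasurableSpace.comap (fun (ν : RadonM) (k : ℕ) => testInt (g k) ν) MeasurableSpace.pi := by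
    rw [hg.eq_induced, borel_comap, ← (Pi.borelSpace : BorelSpace (ℕ → ℝ)).measurable_eq]
  change @Measurable _ _ _ (borel RadonM) V
  rw [h1, measurable_comap_iff]
  exact measurable_pi_iff.2 fun k => hV (g k)

/-! ### Laplace functionals determine convergence in distribution -/

/-- On the compact space `[0, 1]^ℕ`, polynomials are dense among the continuous functions, so the
convergence of all mixed moments implies weak convergence. -/
lemma tendsto_integral_of_tendsto_moments {μ : ℕ → ProbabilityMeasure (ℕ → unitInterval)}
    {μ₀ : ProbabilityMeasure (ℕ → unitInterval)}
    (h : ∀ m ∈ Submonoid.closure (Set.range fun k : ℕ =>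
        (⟨fun x => (x k : ℝ), by fun_prop⟩ : C(ℕ → unitInterval, ℝ))),
      Tendsto (fun n => ∫ x, m x ∂(μ n : Measure (ℕ → unitInterval))) atTop
        (𝓝 (∫ x, m x ∂(μ₀ : Measure (ℕ → unitInterval))))) :
    Tendsto μ atTop (𝓝 μ₀) := by
  set c : ℕ → C(ℕ → unitInterval, ℝ) := fun k => ⟨fun x => (x k : ℝ), by fun_prop⟩ with hc
  let A := Algebra.adjoin ℝ (Set.range c)
  have hsep : A.SeparatesPoints := by
    intro x y hxy
    obtain ⟨k, hk⟩ := Function.ne_iff.1 hxy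
    refine ⟨c k, ⟨c k, Algebra.subset_adjoin ⟨k, rfl⟩, rfl⟩, ?_⟩
    simpa [hc] using fun h => hk (Subtype.ext h)
  have hdense := ContinuousMap.subalgebra_topologicalClosure_eq_top_of_separatesPoints A hsep
  have hint : ∀ (P : ProbabilityMeasure (ℕ → unitInterval)) (f : C(ℕ → unitInterval, ℝ)),
      Integrable f (P : Measure (ℕ → unitInterval)) := fun P f =>
    f.continuous.integrable_of_hasCompactSupport (HasCompactSupport.of_compactSpace _)
  have hA : ∀ f ∈ A, Tendsto (fun n => ∫ x, f x ∂(μ n : Measure (ℕ → unitInterval))) atTop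
        (𝓝 (∫ x, f x ∂(μ₀ : Measure (ℕ → unitInterval)))) := by
    intro f hf
    have hf' : f ∈ Submodule.span ℝ (Submonoid.closure (Set.range c) : Set C(ℕ → unitInterval, ℝ)) := by
      rw [← Algebra.adjoin_eq_span]
      exact hf
    clear hf
    induction hf' using Submodule.span_induction with
    | mem f hf => exact h f hf
    | zero => simp
    | add f g hf hg ihf ihg =>
      have e : ∀ P : ProbabilityMeasure (ℕ → unitInterval),
          ∫ x, (f + g) x ∂(P : Measure (ℕ → unitInterval)) = ∫ x, f x ∂(P : Measure _) +
            ∫ x, g x ∂(P : Measure _) := fun P => integral_add (hint P f) (hint P g)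
      simp_rw [e]
      exact ihf.add ihg
    | smul r f hf ihf =>
      have e : ∀ P : ProbabilityMeasure (ℕ → unitInterval),
          ∫ x, (r • f) x ∂(P : Measure (ℕ → unitInterval)) = r * ∫ x, f x ∂(P : Measure _) :=
        fun P => by
          rw [← integral_const_mul]; rfl
      simp_rw [e]
      exact ihf.const_mul r
  rw [ProbabilityMeasure.tendsto_iff_forall_integral_tendsto]
  intro f
  have hfA : f.toContinuousMap ∈ closure (A : Set C(ℕ → unitInterval, ℝ)) := by
    rw [← Subalgebra.topologicalClosure_coe, hdense]
    exact Set.mem_univ _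
  rw [Metric.tendsto_atTop]
  intro ε hε
  obtain ⟨g, hgA, hfg⟩ := Metric.mem_closure_iff.1 hfA (ε / 3) (by positivity)
  have key : ∀ P : ProbabilityMeasure (ℕ → unitInterval),
      |∫ x, f x ∂(P : Measure (ℕ → unitInterval)) - ∫ x, g x ∂(P : Measure _)| ≤ ε / 3 := by
    intro P
    change |∫ x, f.toContinuousMap x ∂(P : Measure (ℕ → unitInterval)) - _| ≤ _
    rw [← integral_sub (hint P f.toContinuousMap) (hint P g), ← Real.norm_eq_abs]
    refine (norm_integral_le_of_norm_le_const (C := ε / 3)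
      (Eventually.of_forall fun x => ?_)).trans (by simp)
    have := ContinuousMap.dist_apply_le_dist (f := f.toContinuousMap) (g := g) x
    rw [Real.dist_eq] at this
    exact this.trans hfg.le
  obtain ⟨n₀, hn₀⟩ := Metric.tendsto_atTop.1 (hA g hgA) (ε / 3) (by positivity)
  refine ⟨n₀, fun n hn => ?_⟩
  have h1 := hn₀ n hn
  have h2 := key (μ n)
  have h3 := key μ₀
  rw [Real.dist_eq] at h1 ⊢
  rw [abs_le] at h2 h3
  rw [abs_lt] at h1 ⊢
  constructor <;> linarith

/-- Convergence of the Laplace functionals implies convergence in distribution in the vague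
topology. Countably many coordinates `ν ↦ exp (-∫ gₖ dν)` identify the vague topology with that of
a subspace of `[0, 1]^ℕ`; monomials in them are again Laplace functionals, so the images converge
weakly in the cube, and open sets of the subspace are traces of open sets of the cube. -/
theorem tendstoInDistribution_of_laplace {Ω Ω' : Type*} [MeasurableSpace Ω] [MeasurableSpace Ω']
    {P : Measure Ω} [IsProbabilityMeasure P] {P' : Measure Ω'} [IsProbabilityMeasure P']
    {V : ℕ → Ω → RadonM} {V' : Ω' → RadonM}
    (hV : ∀ n, Measurable (V n)) (hV' : Measurable V')
    (h : ∀ f : C_c(RBar, ℝ≥0),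
      Tendsto (fun n => ∫ ω, Real.exp (-testInt f (V n ω)) ∂P) atTop
        (𝓝 (∫ ω, Real.exp (-testInt f (V' ω)) ∂P'))) :
    TendstoInDistribution V atTop V' (fun _ => P) P' := by
  obtain ⟨g, hg⟩ := exists_isInducing_testInt
  have hmem : ∀ (ν : RadonM) (k : ℕ), Real.exp (-testInt (g k) ν) ∈ unitInterval := fun ν k =>
    ⟨(Real.exp_pos _).le, Real.exp_le_one_iff.2 (neg_nonpos.2 (testInt_nonneg _ _))⟩
  let Ψ : RadonM → ℕ → unitInterval := fun ν k => ⟨Real.exp (-testInt (g k) ν), hmem ν k⟩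
  have hexp : IsInducing fun x : ℝ => Real.exp (-x) :=
    (Real.isOpenEmbedding_exp.isInducing).comp (Homeomorph.neg ℝ).isInducing
  have hΨ : IsInducing Ψ := by
    have h1 : IsInducing fun (ν : RadonM) (k : ℕ) => Real.exp (-testInt (g k) ν) :=
      (IsInducing.piMap fun _ => hexp).comp hg
    have h2 : IsInducing (Pi.map fun (_ : ℕ) (x : unitInterval) => (x : ℝ)) :=
      IsInducing.piMap fun _ => IsInducing.subtypeVal
    exact (h2.of_comp_iff (f := Ψ)).1 h1
  have hΨm : Measurable Ψ := hΨ.continuous.measurable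
  refine ⟨fun n => (hV n).aemeasurable, hV'.aemeasurable, ?_⟩
  have hlaw : Tendsto (β := ProbabilityMeasure (ℕ → unitInterval))
      (fun n => ⟨P.map (Ψ ∘ V n), Measure.isProbabilityMeasure_map
        (hΨm.comp (hV n)).aemeasurable⟩) atTop
      (𝓝 ⟨P'.map (Ψ ∘ V'), Measure.isProbabilityMeasure_map
        (hΨm.comp hV').aemeasurable⟩) := by
    refine tendsto_integral_of_tendsto_moments fun m hm => ?_
    -- a monomial in the coordinates `exp (-∫ gₖ dν)` is the Laplace functional of a sum of `gₖ`
    have hm' : ∃ f : C_c(RBar, ℝ≥0), ∀ ν, m (Ψ ν) = Real.exp (-testInt f ν) := by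
      induction hm using Submonoid.closure_induction with
      | mem m hm =>
        obtain ⟨k, rfl⟩ := hm
        exact ⟨g k, fun ν => rfl⟩
      | one => exact ⟨0, fun ν => by simp [testInt]⟩
      | mul m₁ m₂ _ _ ih₁ ih₂ =>
        obtain ⟨f₁, h₁⟩ := ih₁
        obtain ⟨f₂, h₂⟩ := ih₂
        refine ⟨f₁ + f₂, fun ν => ?_⟩
        rw [testInt_add, neg_add, Real.exp_add, ← h₁, ← h₂]
        rfl
    obtain ⟨f, hf⟩ := hm'
    have e : ∀ n, ∫ x, m x ∂(P.map (Ψ ∘ V n)) = ∫ ω, Real.exp (-testInt f (V n ω)) ∂P := by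
      intro n
      rw [integral_map (hΨm.comp (hV n)).aemeasurable
        m.continuous.measurable.aestronglyMeasurable]
      exact integral_congr_ae (Eventually.of_forall fun ω => hf _)
    have e' : ∫ x, m x ∂(P'.map (Ψ ∘ V')) = ∫ ω, Real.exp (-testInt f (V' ω)) ∂P' := by
      rw [integral_map (hΨm.comp hV').aemeasurable
        m.continuous.measurable.aestronglyMeasurable]
      exact integral_congr_ae (Eventually.of_forall fun ω => hf _)
    change Tendsto (fun n => ∫ x, m x ∂(P.map (Ψ ∘ V n))) atTop (𝓝 (∫ x, m x ∂(P'.map (Ψ ∘ V'))))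
    simp only [e, e']
    exact h f
  refine tendsto_of_forall_isOpen_le_liminf' fun G hG => ?_
  obtain ⟨O, hO, rfl⟩ := hΨ.isOpen_iff.1 hG
  have := ProbabilityMeasure.le_liminf_measure_open_of_tendsto hlaw hO
  simp only [ProbabilityMeasure.coe_mk] at this
  change P'.map V' _ ≤ liminf (fun n => P.map (V n) _) atTop
  rw [Measure.map_apply hV' (hΨm hO.measurableSet)]
  simp_rw [Measure.map_apply (hV _) (hΨm hO.measurableSet)]
  rw [Measure.map_apply (hΨm.comp hV') hO.measurableSet] at this
  simp_rw [Measure.map_apply (hΨm.comp (hV _)) hO.measurableSet] at this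
  exact this

/-! ### The Laplace functional of a Poisson process -/

/-- The function `x ↦ e^{-x}` on `[0, ∞]`, with `e^{-∞} = 0`. -/
noncomputable def expNeg (x : ℝ≥0∞) : ℝ≥0∞ := EReal.exp (-(x : EReal))

lemma continuous_expNeg : Continuous expNeg :=
  ENNReal.continuous_exp.comp (continuous_neg.comp continuous_coe_ennreal_ereal)

lemma measurable_expNeg : Measurable expNeg := continuous_expNeg.measurable

@[simp] lemma expNeg_zero : expNeg 0 = 1 := by simp [expNeg]

lemma expNeg_ofReal {r : ℝ} (hr : 0 ≤ r) :
    expNeg (ENNReal.ofReal r) = ENNReal.ofReal (Real.exp (-r)) := by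
  rw [expNeg, EReal.coe_ennreal_ofReal, max_eq_left hr, ← EReal.coe_neg, EReal.exp_coe]

lemma expNeg_add (x y : ℝ≥0∞) : expNeg (x + y) = expNeg x * expNeg y := by
  rw [expNeg, EReal.coe_ennreal_add, EReal.neg_add, sub_eq_add_neg, EReal.exp_add]
  · rfl
  · exact Or.inl (EReal.coe_ennreal_ne_bot _)
  · exact Or.inr (EReal.coe_ennreal_ne_bot _)

lemma expNeg_le_one (x : ℝ≥0∞) : expNeg x ≤ 1 := by
  rw [expNeg, EReal.exp_le_one_iff, EReal.neg_le_zero]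
  exact EReal.coe_ennreal_nonneg x

lemma expNeg_anti : Antitone expNeg := fun _ _ h =>
  EReal.exp_monotone (EReal.neg_le_neg_iff.2 (EReal.coe_ennreal_le_coe_ennreal_iff.2 h))

lemma expNeg_sum {ι : Type*} (s : Finset ι) (f : ι → ℝ≥0∞) :
    expNeg (∑ i ∈ s, f i) = ∏ i ∈ s, expNeg (f i) := by
  classical
  induction s using Finset.induction_on with
  | empty => simp
  | insert a s ha ih => rw [Finset.sum_insert ha, Finset.prod_insert ha, expNeg_add, ih]

lemma toReal_expNeg {x : ℝ≥0∞} (hx : x ≠ ∞) : (expNeg x).toReal = Real.exp (-x.toReal) := by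
  conv_lhs => rw [← ENNReal.ofReal_toReal hx]
  rw [expNeg_ofReal ENNReal.toReal_nonneg, ENNReal.toReal_ofReal (Real.exp_pos _).le]

/-- The Laplace transform `E e^{-cK} = exp (-λ (1 - e^{-c}))` of a Poisson variable `K`. -/
lemma lintegral_expNeg_poisson (lam : ℝ≥0) (c : ℝ≥0) :
    ∫⁻ k : ℕ, expNeg (c * (k : ℝ≥0∞)) ∂(poissonMeasure lam) =
      expNeg ((1 - expNeg c) * (lam : ℝ≥0∞)) := by
  have hc : expNeg c = ENNReal.ofReal (Real.exp (-c)) := by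
    rw [← expNeg_ofReal c.coe_nonneg, ENNReal.ofReal_coe_nnreal]
  have hle : Real.exp (-(c : ℝ)) ≤ 1 := Real.exp_le_one_iff.2 (neg_nonpos.2 c.coe_nonneg)
  have h1 : ∀ k : ℕ, expNeg (c * (k : ℝ≥0∞)) * poissonMeasure lam {k} =
      ENNReal.ofReal (Real.exp (-(lam * (1 - Real.exp (-c)))) *
        (Real.exp (-(lam * Real.exp (-c))) * (lam * Real.exp (-c)) ^ k / (k.factorial : ℝ))) := by
    intro k
    have h2 : (c : ℝ≥0∞) * (k : ℝ≥0∞) = ENNReal.ofReal (c * k) := by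
      rw [ENNReal.ofReal_mul c.coe_nonneg, ENNReal.ofReal_coe_nnreal, ENNReal.ofReal_natCast]
    rw [h2, expNeg_ofReal (by positivity), poissonMeasure_singleton,
      ← ENNReal.ofReal_mul (Real.exp_pos _).le]
    congr 1
    rw [← mul_div_assoc, ← mul_div_assoc, ← mul_assoc, ← mul_assoc, ← Real.exp_add,
      ← Real.exp_add, mul_pow, ← Real.exp_nat_mul]
    have : Real.exp (-(c * k : ℝ) + -lam) * (lam : ℝ) ^ k =
      Real.exp (-(lam * (1 - Real.exp (-c))) + -(lam * Real.exp (-c))) *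
        ((lam : ℝ) ^ k * Real.exp (k * -c)) := by
      rw [mul_comm ((lam : ℝ) ^ k), ← mul_assoc, ← Real.exp_add]
      congr 2
      ring
    rw [this]
  rw [lintegral_countable']
  simp_rw [h1]
  have hs := hasSum_one_poissonMeasure (lam * ⟨Real.exp (-c), (Real.exp_pos _).le⟩)
  have hs' : HasSum (fun k : ℕ => Real.exp (-(lam * (1 - Real.exp (-c)))) *
      (Real.exp (-(lam * Real.exp (-c))) * (lam * Real.exp (-c)) ^ k / (k.factorial : ℝ)))
      (Real.exp (-(lam * (1 - Real.exp (-c)))) * 1) := hs.mul_left _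
  rw [mul_one] at hs'
  rw [← ENNReal.ofReal_tsum_of_nonneg (fun k => by positivity) hs'.summable, hs'.tsum_eq, hc,
    ← ENNReal.ofReal_one, ← ENNReal.ofReal_sub _ (Real.exp_pos _).le, ← ENNReal.ofReal_coe_nnreal,
    ← ENNReal.ofReal_mul (by linarith), expNeg_ofReal
      (mul_nonneg (by linarith) lam.coe_nonneg), mul_comm]

section Poisson

variable {Ω E : Type*} [MeasurableSpace Ω] [MeasurableSpace E] {Ξ : Ω → Measure E}
  {Λ : Measure E} {P : Measure Ω} [IsProbabilityMeasure P]

omit [IsProbabilityMeasure P] in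
/-- For a simple function the integral is a linear combination of the counts of its level sets, which
are disjoint, so that the Laplace functional is a product of Poisson Laplace transforms. -/
lemma IsPoissonProcess.lintegral_expNeg_simpleFunc (h : IsPoissonProcess Ξ Λ P)
    (hm : ∀ B, MeasurableSet B → Measurable fun ω => Ξ ω B) (u : SimpleFunc E ℝ≥0∞)
    (hu : ∀ x, u x ≠ ∞) {B : Set E} (hΛB : Λ B ≠ ∞) (huB : ∀ x ∉ B, u x = 0) :
    ∫⁻ ω, expNeg (∫⁻ x, u x ∂(Ξ ω)) ∂P = expNeg (∫⁻ x, (1 - expNeg (u x)) ∂Λ) := by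
  classical
  set R : Finset ℝ≥0∞ := u.range.erase 0 with hR
  have hΛ : ∀ r ∈ R, Λ (u ⁻¹' {r}) ≠ ∞ := by
    intro r hr
    refine ne_top_of_le_ne_top hΛB (measure_mono fun x hx => ?_)
    by_contra hxB
    have : u x = r := hx
    rw [huB x hxB] at this
    exact (Finset.mem_erase.1 hr).1 this.symm
  have hfin : ∀ r ∈ R, r ≠ ∞ := by
    intro r hr
    obtain ⟨x, rfl⟩ := SimpleFunc.mem_range.1 (Finset.mem_erase.1 hr).2
    exact hu x
  have e1 : ∀ μ : Measure E, ∫⁻ x, u x ∂μ = ∑ r ∈ R, r * μ (u ⁻¹' {r}) := by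
    intro μ
    rw [SimpleFunc.lintegral_eq_lintegral, SimpleFunc.lintegral, hR]
    exact (Finset.sum_erase _ (by simp)).symm
  have e2 : ∫⁻ x, (1 - expNeg (u x)) ∂Λ = ∑ r ∈ R, (1 - expNeg r) * Λ (u ⁻¹' {r}) := by
    have : ∫⁻ x, (1 - expNeg (u x)) ∂Λ = ∫⁻ x, (u.map fun r => 1 - expNeg r) x ∂Λ := rfl
    rw [this, SimpleFunc.lintegral_eq_lintegral, SimpleFunc.map_lintegral, hR]
    exact (Finset.sum_erase _ (by simp)).symm
  have hind : iIndepFun (fun (r : R) ω => Ξ ω (u ⁻¹' {(r : ℝ≥0∞)})) P := by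
    have := h.count_indep R.card (fun i => u ⁻¹' {(R.equivFin.symm i : ℝ≥0∞)})
      (fun i => u.measurableSet_fiber _) (by
        intro i j hij
        refine Disjoint.preimage _ (Set.disjoint_singleton.2 fun hh => hij ?_)
        exact R.equivFin.symm.injective (Subtype.ext hh))
    have h2 := this.precomp (g := R.equivFin) R.equivFin.injective
    simpa using h2
  rw [e2, expNeg_sum]
  simp_rw [e1, expNeg_sum]
  have h3 := lintegral_prod_eq_prod_lintegral_of_indepFun (μ := P) (Finset.univ : Finset R)
    (fun (r : R) ω => expNeg (r * Ξ ω (u ⁻¹' {(r : ℝ≥0∞)})))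
    (hind.comp (fun r x => expNeg (r * x)) fun r =>
      measurable_expNeg.comp (measurable_const.mul measurable_id))
    (fun r => measurable_expNeg.comp (measurable_const.mul (hm _ (u.measurableSet_fiber _))))
  simp_rw [← Finset.prod_coe_sort R]
  rw [h3]
  refine Finset.prod_congr rfl fun r _ => ?_
  have hlaw := h.count_law _ (u.measurableSet_fiber r) (hΛ r r.2)
  have hmr : Measurable fun x => expNeg ((r : ℝ≥0∞) * x) :=
    measurable_expNeg.comp (measurable_const.mul measurable_id)
  rw [hlaw.lintegral_comp hmr.aemeasurable, lintegral_map hmr (measurable_of_countable _)]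
  obtain ⟨c, hc⟩ : ∃ c : ℝ≥0, (c : ℝ≥0∞) = r := ⟨_, ENNReal.coe_toNNReal (hfin r r.2)⟩
  rw [← hc]
  rw [lintegral_expNeg_poisson, ENNReal.coe_toNNReal]
  rw [hc]
  exact hΛ r r.2

/-- The Laplace functional of a Poisson process, for a function supported by a set of finite
intensity. -/
lemma IsPoissonProcess.lintegral_expNeg (h : IsPoissonProcess Ξ Λ P)
    (hm : ∀ B, MeasurableSet B → Measurable fun ω => Ξ ω B) {u : E → ℝ≥0∞} (hu : Measurable u)
    {B : Set E} (hΛB : Λ B ≠ ∞) (huB : ∀ x ∉ B, u x = 0) :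
    ∫⁻ ω, expNeg (∫⁻ x, u x ∂(Ξ ω)) ∂P = expNeg (∫⁻ x, (1 - expNeg (u x)) ∂Λ) := by
  have hmono := SimpleFunc.monotone_eapprox u
  have hlim : ∀ x, Tendsto (fun n => SimpleFunc.eapprox u n x) atTop (𝓝 (u x)) := by
    intro x
    rw [← SimpleFunc.iSup_eapprox_apply hu x]
    exact tendsto_atTop_iSup fun i j hij => hmono hij x
  have hle : ∀ n x, SimpleFunc.eapprox u n x ≤ u x := fun n x => by
    rw [← SimpleFunc.iSup_eapprox_apply hu x]
    exact le_iSup (fun n => SimpleFunc.eapprox u n x) n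
  have hn := fun n => h.lintegral_expNeg_simpleFunc hm (SimpleFunc.eapprox u n)
    (fun x => (SimpleFunc.eapprox_lt_top u n x).ne) hΛB
    (fun x hx => le_antisymm (huB x hx ▸ hle n x) zero_le)
  have l1 : Tendsto (fun n => ∫⁻ ω, expNeg (∫⁻ x, SimpleFunc.eapprox u n x ∂(Ξ ω)) ∂P) atTop
      (𝓝 (∫⁻ ω, expNeg (∫⁻ x, u x ∂(Ξ ω)) ∂P)) := by
    refine tendsto_lintegral_of_dominated_convergence' (fun _ => 1) (fun n => ?_) (fun n => ?_)
      (by simp) (Eventually.of_forall fun ω => ?_)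
    · refine (measurable_expNeg.comp ?_).aemeasurable
      simp_rw [SimpleFunc.lintegral_eq_lintegral]
      unfold SimpleFunc.lintegral
      exact Finset.measurable_sum _ fun r _ =>
        measurable_const.mul (hm _ (SimpleFunc.measurableSet_fiber _ _))
    · exact Eventually.of_forall fun ω => expNeg_le_one _
    · refine (continuous_expNeg.tendsto _).comp ?_
      refine lintegral_tendsto_of_tendsto_of_monotone
        (fun n => (SimpleFunc.measurable _).aemeasurable) ?_ ?_
      · exact Eventually.of_forall fun x i j hij => hmono hij x
      · exact Eventually.of_forall hlim
  have l2 : Tendsto (fun n => expNeg (∫⁻ x, (1 - expNeg (SimpleFunc.eapprox u n x)) ∂Λ)) atTop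
      (𝓝 (expNeg (∫⁻ x, (1 - expNeg (u x)) ∂Λ))) := by
    refine (continuous_expNeg.tendsto _).comp ?_
    refine lintegral_tendsto_of_tendsto_of_monotone
      (fun n => (measurable_const.sub
        (measurable_expNeg.comp (SimpleFunc.measurable _))).aemeasurable) ?_ ?_
    · exact Eventually.of_forall fun x i j hij => tsub_le_tsub_left (expNeg_anti (hmono hij x)) _
    · refine Eventually.of_forall fun x => ?_
      exact ENNReal.Tendsto.sub tendsto_const_nhds
        ((continuous_expNeg.tendsto _).comp (hlim x)) (Or.inl (by simp))
  simp_rw [hn] at l1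
  exact tendsto_nhds_unique l1 l2

end Poisson

/-! ### Compact subsets of `(-∞, ∞]` and measurability of random Radon measures -/

lemma isCompact_setOf_le (t : ℝ) : IsCompact {x : RBar | (t : EReal) ≤ x.1} := by
  rw [Topology.IsEmbedding.subtypeVal.isCompact_iff]
  have : Subtype.val '' {x : RBar | (t : EReal) ≤ x.1} = Set.Ici (t : EReal) := by
    ext x
    constructor
    · rintro ⟨y, hy, rfl⟩
      exact hy
    · intro hx
      exact ⟨⟨x, ((EReal.bot_lt_coe t).trans_le hx).ne'⟩, hx, rfl⟩
  rw [this]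
  exact isClosed_Ici.isCompact

lemma exists_lt_of_isCompact {K : Set RBar} (hK : IsCompact K) :
    ∃ c : ℝ, ∀ x ∈ K, (c : EReal) < x.1 := by
  rcases K.eq_empty_or_nonempty with rfl | hne
  · exact ⟨0, by simp⟩
  · obtain ⟨x, hxK, hx⟩ := hK.exists_isLeast hne
    obtain ⟨c, -, hc⟩ := EReal.lt_iff_exists_real_btwn.1 (bot_lt_iff_ne_bot.2 x.2)
    exact ⟨c, fun y hy => hc.trans_le (hx hy)⟩

lemma exists_eq_zero_of_lt (f : C_c(RBar, ℝ≥0)) : ∃ c : ℝ, ∀ x : ℝ, x ≤ c → f (toRBar x) = 0 := by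
  obtain ⟨c, hc⟩ := exists_lt_of_isCompact f.hasCompactSupport
  refine ⟨c, fun x hx => ?_⟩
  by_contra h
  have := hc _ (subset_tsupport _ h)
  exact absurd (EReal.coe_lt_coe_iff.1 this) (not_lt.2 hx)

lemma isFiniteMeasureOnCompacts_iff (ν : Measure RBar) :
    IsFiniteMeasureOnCompacts ν ↔ ∀ j : ℕ, ν {x | ((-(j : ℝ) : ℝ) : EReal) ≤ x.1} < ∞ := by
  constructor
  · intro h j
    exact (isCompact_setOf_le _).measure_lt_top
  · intro h
    refine ⟨fun {K} hK => ?_⟩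
    obtain ⟨c, hc⟩ := exists_lt_of_isCompact hK
    obtain ⟨j, hj⟩ := exists_nat_ge (-c)
    refine (measure_mono fun x hx => ?_).trans_lt (h j)
    refine le_trans ?_ (hc x hx).le
    exact EReal.coe_le_coe_iff.2 (by linarith)

lemma measurable_toRBar : Measurable toRBar :=
  measurable_coe_real_ereal.subtype_mk

lemma continuous_toRBar : Continuous toRBar :=
  continuous_coe_real_ereal.subtype_mk _

lemma testInt_eq_toReal (f : C_c(RBar, ℝ≥0)) (ν : RadonM) :
    testInt f ν = (∫⁻ x, (f x : ℝ≥0∞) ∂ν.1).toReal := by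
  unfold testInt
  rw [integral_eq_lintegral_of_nonneg_ae (Eventually.of_forall fun x => NNReal.coe_nonneg _)]
  · simp
  · exact (integrable_testFun f ν).aestronglyMeasurable

lemma lintegral_testFun_ne_top (f : C_c(RBar, ℝ≥0)) (ν : RadonM) :
    ∫⁻ x, (f x : ℝ≥0∞) ∂ν.1 ≠ ∞ := by
  have := (integrable_testFun f ν).2
  rw [hasFiniteIntegral_iff_ofReal (Eventually.of_forall fun x => NNReal.coe_nonneg _)] at this
  simpa using this.ne

lemma toRadonM_of_isFinite {ν : Measure RBar} (h : IsFiniteMeasureOnCompacts ν) :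
    toRadonM ν = ⟨ν, h⟩ := dif_pos h

lemma toRadonM_of_not_isFinite {ν : Measure RBar} (h : ¬ IsFiniteMeasureOnCompacts ν) :
    toRadonM ν = ⟨0, inferInstance⟩ := dif_neg h

lemma testInt_toRadonM (f : C_c(RBar, ℝ≥0)) {ν : Measure RBar}
    (h : IsFiniteMeasureOnCompacts ν) :
    testInt f (toRadonM ν) = (∫⁻ x, (f x : ℝ≥0∞) ∂ν).toReal := by
  rw [testInt_eq_toReal, toRadonM_of_isFinite h]

lemma ofReal_exp_neg_testInt (f : C_c(RBar, ℝ≥0)) {ν : Measure RBar}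
    (h : IsFiniteMeasureOnCompacts ν) :
    ENNReal.ofReal (Real.exp (-testInt f (toRadonM ν))) = expNeg (∫⁻ x, (f x : ℝ≥0∞) ∂ν) := by
  rw [testInt_toRadonM f h, ← toReal_expNeg, ENNReal.ofReal_toReal]
  · exact ne_top_of_le_ne_top ENNReal.one_ne_top (expNeg_le_one _)
  · have := lintegral_testFun_ne_top f ⟨ν, h⟩
    exact this

lemma measurable_testFun (f : C_c(RBar, ℝ≥0)) : Measurable fun x => (f x : ℝ≥0∞) :=
  f.continuous.measurable.coe_nnreal_ennreal

/-- Local finiteness is a measurable condition, being finiteness on the countably many sets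
`[-j, ∞]`. -/
lemma measurable_toRadonM {Ω : Type*} [MeasurableSpace Ω] {κ : Ω → Measure RBar}
    (hκ : Measurable κ) : Measurable fun ω => toRadonM (κ ω) := by
  classical
  refine measurable_radonM fun f => ?_
  have hset : MeasurableSet {ω | IsFiniteMeasureOnCompacts (κ ω)} := by
    simp_rw [isFiniteMeasureOnCompacts_iff, Set.ofPred_forall]
    refine MeasurableSet.iInter fun j => ?_
    exact (Measure.measurable_coe (isCompact_setOf_le _).isClosed.measurableSet).comp hκ
      measurableSet_Iio
  have e : (fun ω => testInt f (toRadonM (κ ω))) = fun ω =>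
      if ω ∈ {ω | IsFiniteMeasureOnCompacts (κ ω)} then (∫⁻ x, (f x : ℝ≥0∞) ∂(κ ω)).toReal
        else 0 := by
    funext ω
    split_ifs with h
    · exact testInt_toRadonM f h
    · rw [testInt, toRadonM_of_not_isFinite h]
      simp
  rw [e]
  exact Measurable.ite hset
    ((Measure.measurable_lintegral (measurable_testFun f)).comp hκ).ennreal_toReal measurable_const

/-! ### The intensity `e^{-x} dx` -/

lemma gumbelIntensity_Ioi (t : ℝ) :
    gumbelIntensity (Set.Ioi t) = ENNReal.ofReal (Real.exp (-t)) := by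
  rw [gumbelIntensity, withDensity_apply _ measurableSet_Ioi,
    ← ofReal_integral_eq_lintegral_ofReal (integrableOn_exp_neg_Ioi t)
      (Eventually.of_forall fun x => (Real.exp_pos _).le), integral_exp_neg_Ioi]

/-- Shifting the atoms by `c` multiplies the intensity `e^{-x} dx` by `e^c`. -/
lemma lintegral_gumbel_shift {h : ℝ → ℝ≥0∞} (hh : Measurable h) (c : ℝ) :
    ∫⁻ x, h (x + c) ∂gumbelIntensity =
      ENNReal.ofReal (Real.exp c) * ∫⁻ x, h x ∂gumbelIntensity := by
  have hd : Measurable fun x : ℝ => ENNReal.ofReal (Real.exp (-x)) := by fun_prop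
  have hs : Measurable fun x => h (x + c) := hh.comp (measurable_id.add_const c)
  unfold gumbelIntensity
  rw [lintegral_withDensity_eq_lintegral_mul _ hd hs,
    lintegral_withDensity_eq_lintegral_mul _ hd hh,
    ← lintegral_const_mul _ (hd.mul hh),
    ← lintegral_add_right_eq_self (fun x => ENNReal.ofReal (Real.exp c) * _) c]
  refine lintegral_congr fun x => ?_
  simp only [Pi.mul_apply]
  rw [← mul_assoc, ← ENNReal.ofReal_mul (Real.exp_pos _).le, ← Real.exp_add]
  congr 3
  ring

/-! ### The Laplace functional of the cluster Cox process -/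

/-- The inverse of `expNeg` on `(0, 1]`. -/
noncomputable def negLog (q : ℝ≥0∞) : ℝ≥0∞ := ENNReal.ofReal (-Real.log q.toReal)

lemma expNeg_negLog {q : ℝ≥0∞} (h0 : q ≠ 0) (h1 : q ≤ 1) : expNeg (negLog q) = q := by
  have hq : q ≠ ∞ := ne_top_of_le_ne_top ENNReal.one_ne_top h1
  have hpos : 0 < q.toReal := ENNReal.toReal_pos h0 hq
  have hle : q.toReal ≤ 1 := by
    have := ENNReal.toReal_mono ENNReal.one_ne_top h1
    simpa using this
  rw [negLog, expNeg_ofReal (neg_nonneg.2 (Real.log_nonpos hpos.le hle)), neg_neg,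
    Real.exp_log hpos, ENNReal.ofReal_toReal hq]

lemma measurable_negLog : Measurable negLog :=
  (Real.measurable_log.comp ENNReal.measurable_toReal).neg.ennreal_ofReal

@[simp] lemma negLog_one : negLog 1 = 0 := by simp [negLog]

/-- Independent marks `A k` with a common Laplace transform `q` turn a sum into an exponential of a
sum. -/
lemma lintegral_expNeg_tsum_marks {Ω : Type*} [MeasurableSpace Ω] {P : Measure Ω}
    [IsProbabilityMeasure P] {A : ℕ → Ω → ℕ} (hA : ∀ k, Measurable (A k)) (hi : iIndepFun A P)
    {q : ℝ≥0∞ → ℝ≥0∞} (hq0 : ∀ s, s ≠ ∞ → q s ≠ 0)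
    (hq : ∀ k s, ∫⁻ ω, expNeg (A k ω * s) ∂P = q s) {s : ℕ → ℝ≥0∞} (hs : ∀ k, s k ≠ ∞) :
    ∫⁻ ω, expNeg (∑' k, A k ω * s k) ∂P = expNeg (∑' k, negLog (q (s k))) := by
  have hm : ∀ k, Measurable fun ω => expNeg (A k ω * s k) := fun k =>
    measurable_expNeg.comp (((measurable_of_countable (fun j : ℕ => (j : ℝ≥0∞))).comp
      (hA k)).mul_const _)
  have hfin : ∀ n, ∫⁻ ω, expNeg (∑ k ∈ Finset.range n, A k ω * s k) ∂P =
      expNeg (∑ k ∈ Finset.range n, negLog (q (s k))) := by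
    intro n
    simp_rw [expNeg_sum]
    rw [lintegral_prod_eq_prod_lintegral_of_indepFun (Finset.range n)
      (fun k ω => expNeg (A k ω * s k))
      (hi.comp (fun k (j : ℕ) => expNeg (j * s k)) fun k => measurable_of_countable _) hm]
    refine Finset.prod_congr rfl fun k _ => ?_
    rw [hq, expNeg_negLog (hq0 _ (hs k))]
    rw [← hq k]
    refine (lintegral_mono fun ω => expNeg_le_one _).trans (by simp)
  have l1 : Tendsto (fun n => ∫⁻ ω, expNeg (∑ k ∈ Finset.range n, A k ω * s k) ∂P) atTop
      (𝓝 (∫⁻ ω, expNeg (∑' k, A k ω * s k) ∂P)) := by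
    refine tendsto_lintegral_of_dominated_convergence' (fun _ => 1) (fun n => ?_)
      (fun n => Eventually.of_forall fun ω => expNeg_le_one _) (by simp)
      (Eventually.of_forall fun ω => ?_)
    · simp_rw [expNeg_sum]
      exact (Finset.measurable_prod _ fun k _ => hm k).aemeasurable
    · exact (continuous_expNeg.tendsto _).comp (ENNReal.tendsto_nat_tsum _)
  have l2 : Tendsto (fun n => expNeg (∑ k ∈ Finset.range n, negLog (q (s k)))) atTop
      (𝓝 (expNeg (∑' k, negLog (q (s k))))) :=
    (continuous_expNeg.tendsto _).comp (ENNReal.tendsto_nat_tsum _)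
  simp_rw [hfin] at l1
  exact tendsto_nhds_unique l1 l2

/-- The function `s ↦ E[1 - e^{-sA}]` of the cluster size `A`. -/
noncomputable def clusterDefect {Ω : Type*} [MeasurableSpace Ω] (P : Measure Ω)
    (N : Label → Ω → ℕ) (m : ℝ) (s : ℝ≥0∞) : ℝ≥0∞ :=
  ∑' j : ℕ, (1 - expNeg (j * s)) * ENNReal.ofReal (clusterWeight P N m j)

section Cluster

variable {Ω Ω' : Type*} [MeasurableSpace Ω] [MeasurableSpace Ω'] {P : Measure Ω}
  {P' : Measure Ω'} [IsProbabilityMeasure P'] {N : Label → Ω → ℕ} {m v : ℝ}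
  {ℓ : ℕ → Ω' → ℝ} {A : ℕ → Ω' → ℕ} {W : Ω' → ℝ}

omit [IsProbabilityMeasure P'] in
omit [MeasurableSpace Ω'] in
lemma lintegral_clusterCox (F : RBar → ℝ≥0∞) (hF : Measurable F) (ω : Ω') :
    ∫⁻ x, F x ∂(clusterCox v ℓ A W ω) =
      if 0 < W ω then ∑' k, A k ω * F (toRBar (ℓ k ω + Real.log (v * W ω))) else 0 := by
  unfold clusterCox
  split_ifs
  · rw [lintegral_sum_measure]
    refine tsum_congr fun k => ?_
    rw [lintegral_smul_measure, lintegral_dirac' _ hF]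
    rfl
  · simp

omit [IsProbabilityMeasure P'] in
lemma measurable_clusterCox (hℓ : ∀ k, Measurable (ℓ k)) (hA : ∀ k, Measurable (A k))
    (hW : Measurable W) : Measurable (clusterCox v ℓ A W) := by
  refine Measure.measurable_of_measurable_coe _ fun s hs => ?_
  have e : (fun ω => clusterCox v ℓ A W ω s) = fun ω => if 0 < W ω then
      ∑' k, (A k ω : ℝ≥0∞) * s.indicator 1 (toRBar (ℓ k ω + Real.log (v * W ω))) else 0 := by
    funext ω
    rw [← lintegral_clusterCox _ (measurable_one.indicator hs) ω, lintegral_indicator_one hs]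
  rw [e]
  refine Measurable.ite (hW measurableSet_Ioi) (Measurable.tsum fun k => ?_)
    measurable_const
  have hAk : Measurable fun ω => (A k ω : ℝ≥0∞) :=
    (measurable_of_countable (fun j : ℕ => (j : ℝ≥0∞))).comp (hA k)
  refine hAk.mul ?_
  refine (measurable_one.indicator hs).comp (measurable_toRBar.comp ?_)
  exact (hℓ k).add (Real.measurable_log.comp (measurable_const.mul hW))

lemma IsLimitData.one_sub_clusterDefect (h : IsLimitData P N m P' ℓ A W) (k : ℕ) (s : ℝ≥0∞) :
    ∫⁻ ω, (1 - expNeg (A k ω * s)) ∂P' = clusterDefect P N m s := by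
  have e : ∫⁻ ω, (1 - expNeg (A k ω * s)) ∂P' =
      ∫⁻ j : ℕ, (1 - expNeg (j * s)) ∂(P'.map (A k)) :=
    (lintegral_map (f := fun j : ℕ => 1 - expNeg (j * s)) (measurable_of_countable _)
      (h.measurable_size k)).symm
  rw [e, lintegral_countable', clusterDefect]
  refine tsum_congr fun j => ?_
  rcases Nat.eq_zero_or_pos j with rfl | hj
  · simp
  · rw [Measure.map_apply (h.measurable_size k) (measurableSet_singleton j),
      ← h.law_size k j hj, ofReal_measureReal]
    rfl

lemma IsLimitData.lintegral_expNeg_size (h : IsLimitData P N m P' ℓ A W) (k : ℕ) (s : ℝ≥0∞) :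
    ∫⁻ ω, expNeg (A k ω * s) ∂P' = 1 - clusterDefect P N m s := by
  have hm : Measurable fun ω => expNeg (A k ω * s) :=
    measurable_expNeg.comp (((measurable_of_countable (fun j : ℕ => (j : ℝ≥0∞))).comp
      (h.measurable_size k)).mul_const _)
  have hle : ∫⁻ ω, expNeg (A k ω * s) ∂P' ≤ 1 :=
    (lintegral_mono fun ω => expNeg_le_one _).trans (by simp)
  rw [← h.one_sub_clusterDefect k s, lintegral_sub hm (ne_top_of_le_ne_top (by simp) hle)
    (Eventually.of_forall fun ω => expNeg_le_one _)]
  simp [ENNReal.sub_sub_cancel ENNReal.one_ne_top hle]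

lemma measurable_clusterDefect : Measurable (clusterDefect P N m) := by
  refine Measurable.tsum fun j => ?_
  exact (measurable_const.sub (measurable_expNeg.comp (measurable_const.mul measurable_id))).mul
    measurable_const

omit [IsProbabilityMeasure P'] in
lemma IsLimitData.measurable_count (h : IsLimitData P N m P' ℓ A W) (B : Set ℝ)
    (hB : MeasurableSet B) :
    Measurable fun ω => Measure.sum (fun k => Measure.dirac (ℓ k ω)) B := by
  simp_rw [Measure.sum_apply _ hB, Measure.dirac_apply' _ hB]
  exact Measurable.tsum fun k => (measurable_one.indicator hB).comp (h.measurable_atom k)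

/-- The Laplace functional of the Cox process of clusters. -/
theorem IsLimitData.lintegral_expNeg_clusterCox (h : IsLimitData P N m P' ℓ A W) (hv : 0 < v)
    (f : C_c(RBar, ℝ≥0)) :
    ∫⁻ ω, expNeg (∫⁻ x, f x ∂(clusterCox v ℓ A W ω)) ∂P' =
      ∫⁻ ω, expNeg (ENNReal.ofReal (v * W ω) *
        ∫⁻ x, clusterDefect P N m (f (toRBar x)) ∂gumbelIntensity) ∂P' := by
  classical
  set φ : ℝ → ℝ≥0∞ := fun x => f (toRBar x) with hφ
  have hφm : Measurable φ := (measurable_testFun f).comp measurable_toRBar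
  have hφtop : ∀ x, φ x ≠ ∞ := fun x => ENNReal.coe_ne_top
  obtain ⟨c₀, hc₀⟩ := exists_eq_zero_of_lt f
  set q : ℝ≥0∞ → ℝ≥0∞ := fun s => 1 - clusterDefect P N m s with hq
  have hqm : Measurable q := measurable_const.sub measurable_clusterDefect
  have hq0 : ∀ s, s ≠ ∞ → q s ≠ 0 := by
    intro s hs h0
    rw [hq] at h0
    simp only at h0
    have hm : Measurable fun ω => expNeg (A 0 ω * s) :=
      measurable_expNeg.comp (((measurable_of_countable (fun j : ℕ => (j : ℝ≥0∞))).comp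
        (h.measurable_size 0)).mul_const _)
    rw [← h.lintegral_expNeg_size 0 s, lintegral_eq_zero_iff hm] at h0
    obtain ⟨ω, hω⟩ := h0.exists
    have : expNeg (A 0 ω * s) ≠ 0 := by
      rw [expNeg]
      simp only [ne_eq, EReal.exp_eq_zero_iff, EReal.neg_eq_bot_iff, EReal.coe_ennreal_eq_top_iff]
      exact ENNReal.mul_ne_top (by simp) hs
    exact this hω
  have hq1 : ∀ s, 1 - q s = clusterDefect P N m s := by
    intro s
    refine ENNReal.sub_sub_cancel ENNReal.one_ne_top ?_
    rw [← h.one_sub_clusterDefect 0 s]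
    exact (lintegral_mono fun ω => tsub_le_self).trans (by simp)
  -- the integral of `f` as a function of the atoms, the marks and the shift, which are independent:
  -- integrate out the marks, then the atoms, for a fixed value `w` of the shift
  let G : (ℕ → ℝ) × ((ℕ → ℕ) × ℝ) → ℝ≥0∞ := fun z =>
    if 0 < z.2.2 then ∑' k, (z.2.1 k : ℝ≥0∞) * φ (z.1 k + Real.log (v * z.2.2)) else 0
  have hGm : Measurable G := by
    refine Measurable.ite (measurable_snd.snd measurableSet_Ioi) (Measurable.tsum fun k => ?_)
      measurable_const
    refine ((measurable_of_countable (fun j : ℕ => (j : ℝ≥0∞))).comp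
      ((measurable_pi_apply k).comp measurable_snd.fst)).mul (hφm.comp ?_)
    exact ((measurable_pi_apply k).comp measurable_fst).add
      (Real.measurable_log.comp (measurable_const.mul measurable_snd.snd))
  have hℓm : Measurable fun ω k => ℓ k ω := measurable_pi_iff.2 h.measurable_atom
  have hAm : Measurable fun ω k => A k ω := measurable_pi_iff.2 h.measurable_size
  have hWm := h.measurable_shift
  have hlaw : P'.map (fun ω => ((fun k => ℓ k ω), ((fun k => A k ω), W ω))) =
      (P'.map fun ω k => ℓ k ω).prod ((P'.map fun ω k => A k ω).prod (P'.map W)) := by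
    rw [(indepFun_iff_map_prod_eq_prod_map_map hℓm.aemeasurable
      (hAm.prodMk hWm).aemeasurable).1 h.indep_atom,
      (indepFun_iff_map_prod_eq_prod_map_map hAm.aemeasurable hWm.aemeasurable).1
        h.indep_size_shift]
  have := Measure.isProbabilityMeasure_map hℓm.aemeasurable (μ := P')
  have := Measure.isProbabilityMeasure_map hAm.aemeasurable (μ := P')
  have := Measure.isProbabilityMeasure_map hWm.aemeasurable (μ := P')
  have hEm : Measurable fun z => expNeg (G z) := measurable_expNeg.comp hGm
  have step1 : ∫⁻ ω, expNeg (∫⁻ x, f x ∂(clusterCox v ℓ A W ω)) ∂P' =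
      ∫⁻ w, ∫⁻ l, ∫⁻ a, expNeg (G (l, (a, w))) ∂(P'.map fun ω k => A k ω)
        ∂(P'.map fun ω k => ℓ k ω) ∂(P'.map W) := by
    have e1 : ∀ ω, expNeg (∫⁻ x, f x ∂(clusterCox v ℓ A W ω)) =
        expNeg (G ((fun k => ℓ k ω), ((fun k => A k ω), W ω))) := by
      intro ω
      rw [lintegral_clusterCox _ (measurable_testFun f)]
    simp_rw [e1]
    rw [← lintegral_map (f := fun z => expNeg (G z)) hEm (hℓm.prodMk (hAm.prodMk hWm)), hlaw,
      lintegral_prod _ hEm.aemeasurable]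
    have e2 : ∀ l, ∫⁻ y, expNeg (G (l, y)) ∂((P'.map fun ω k => A k ω).prod (P'.map W)) =
        ∫⁻ w, ∫⁻ a, expNeg (G (l, (a, w))) ∂(P'.map fun ω k => A k ω) ∂(P'.map W) := by
      intro l
      have : Measurable fun y => expNeg (G (l, y)) := hEm.comp measurable_prodMk_left
      rw [lintegral_prod_symm _ this.aemeasurable]
    simp_rw [e2]
    rw [lintegral_lintegral_swap]
    refine Measurable.aemeasurable ?_
    have : Measurable fun z : ((ℕ → ℝ) × ℝ) × (ℕ → ℕ) => expNeg (G (z.1.1, (z.2, z.1.2))) :=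
      hEm.comp (measurable_fst.fst.prodMk (measurable_snd.prodMk measurable_fst.snd))
    exact this.lintegral_prod_right'
  have step2 : ∀ w, ∫⁻ l, ∫⁻ a, expNeg (G (l, (a, w))) ∂(P'.map fun ω k => A k ω)
        ∂(P'.map fun ω k => ℓ k ω) = expNeg (ENNReal.ofReal (v * w) *
        ∫⁻ x, clusterDefect P N m (φ x) ∂gumbelIntensity) := by
    intro w
    by_cases hw : 0 < w
    · set c := Real.log (v * w) with hc
      have e1 : ∀ l, ∫⁻ a, expNeg (G (l, (a, w))) ∂(P'.map fun ω k => A k ω) =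
          expNeg (∑' k, negLog (q (φ (l k + c)))) := by
        intro l
        have : Measurable fun a => expNeg (G (l, (a, w))) :=
          hEm.comp (measurable_prodMk_left.comp measurable_prodMk_right)
        rw [lintegral_map this hAm]
        simp only [G, if_pos hw]
        exact lintegral_expNeg_tsum_marks h.measurable_size h.iIndep_size hq0
          h.lintegral_expNeg_size fun k => hφtop _
      simp_rw [e1]
      have hum : Measurable fun x => negLog (q (φ (x + c))) :=
        measurable_negLog.comp (hqm.comp (hφm.comp (measurable_id.add_const c)))
      rw [lintegral_map (f := fun l : ℕ → ℝ => expNeg (∑' k, negLog (q (φ (l k + c)))))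
        (measurable_expNeg.comp (Measurable.tsum fun k =>
          hum.comp (measurable_pi_apply k))) hℓm]
      have e2 : ∀ ω, expNeg (∑' k, negLog (q (φ (ℓ k ω + c)))) =
          expNeg (∫⁻ x, negLog (q (φ (x + c))) ∂(Measure.sum fun k => Measure.dirac (ℓ k ω))) := by
        intro ω
        rw [lintegral_sum_measure]
        simp_rw [lintegral_dirac' _ hum]
      simp_rw [e2]
      -- without the marks, what is left is the Laplace functional of the Poisson process, applied to
      -- `-log q ∘ φ` shifted by `c`
      rw [h.poisson.lintegral_expNeg h.measurable_count hum (B := Set.Ioi (c₀ - c))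
        (by rw [gumbelIntensity_Ioi]; exact ENNReal.ofReal_ne_top)]
      · have e3 : ∀ x, 1 - expNeg (negLog (q (φ (x + c)))) =
            (fun y => clusterDefect P N m (φ y)) (x + c) := by
          intro x
          rw [expNeg_negLog (hq0 _ (hφtop _)) tsub_le_self, hq1]
        simp_rw [e3]
        have hDm : Measurable fun y => clusterDefect P N m (φ y) :=
          measurable_clusterDefect.comp hφm
        rw [lintegral_gumbel_shift hDm, hc,
          Real.exp_log (mul_pos hv hw)]
      · intro x hx
        have : φ (x + c) = 0 := by
          simp only [hφ]
          rw [hc₀ (x + c) (by simp only [Set.mem_Ioi, not_lt] at hx; linarith)]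
          rfl
        rw [this, hq]
        simp [clusterDefect]
    -- for `w ≤ 0` the process is null, and `ENNReal.ofReal (v * w) = 0`
    · have : ENNReal.ofReal (v * w) = 0 := by
        rw [ENNReal.ofReal_eq_zero]
        exact mul_nonpos_of_nonneg_of_nonpos hv.le (not_lt.1 hw)
      rw [this]
      simp [G, hw]
  rw [step1]
  simp_rw [step2]
  rw [lintegral_map _ hWm]
  exact measurable_expNeg.comp ((measurable_const.mul measurable_id).ennreal_ofReal.mul_const _)

omit [IsProbabilityMeasure P'] in
/-- The Poisson process has finitely many atoms in each half-line `(-j, ∞)`, so the limit is almost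
surely locally finite and `toRadonM` does not discard it. -/
lemma IsLimitData.ae_isFiniteMeasureOnCompacts (h : IsLimitData P N m P' ℓ A W) :
    ∀ᵐ ω ∂P', IsFiniteMeasureOnCompacts (clusterCox v ℓ A W ω) := by
  have hcount : ∀ᵐ ω ∂P', ∀ j : ℕ,
      Measure.sum (fun k => Measure.dirac (ℓ k ω)) (Set.Ioi (-(j : ℝ))) < ∞ := by
    rw [ae_all_iff]
    intro j
    have hlaw := h.poisson.count_law (Set.Ioi (-(j : ℝ))) measurableSet_Ioi
      (by rw [gumbelIntensity_Ioi]; exact ENNReal.ofReal_ne_top)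
    have : ∀ᵐ x ∂((poissonMeasure (gumbelIntensity (Set.Ioi (-(j : ℝ)))).toNNReal).map
        (fun k : ℕ => (k : ℝ≥0∞))), x < ∞ := by
      rw [ae_map_iff (measurable_of_countable _).aemeasurable measurableSet_Iio]
      simp
    rw [← hlaw.map_eq] at this
    exact ae_of_ae_map hlaw.aemeasurable this
  filter_upwards [hcount] with ω hω
  rw [isFiniteMeasureOnCompacts_iff]
  intro j
  have hSm := (isCompact_setOf_le (-(j : ℝ))).isClosed.measurableSet
  rw [← lintegral_indicator_one hSm, lintegral_clusterCox _ (measurable_one.indicator hSm)]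
  split_ifs with hW
  · set c := Real.log (v * W ω)
    obtain ⟨i, hi⟩ := exists_nat_gt ((j : ℝ) + c)
    have hfin : {k | ℓ k ω ∈ Set.Ioi (-(i : ℝ))}.Finite := by
      have h2 := hω i
      rw [Measure.sum_apply _ measurableSet_Ioi] at h2
      have h3 := ENNReal.finite_const_le_of_tsum_ne_top h2.ne (ε := 1) one_ne_zero
      refine h3.subset fun k hk => ?_
      simp only [Set.mem_ofPred_eq] at hk ⊢
      rw [Measure.dirac_apply' _ measurableSet_Ioi, Set.indicator_of_mem hk]
      rfl
    rw [tsum_eq_sum (s := hfin.toFinset)]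
    · refine ENNReal.sum_lt_top.2 fun k _ => ENNReal.mul_lt_top (by simp) ?_
      refine lt_of_le_of_lt (Set.indicator_le_self' (by simp) _) (by simp)
    · intro k hk
      rw [Set.indicator_of_notMem, mul_zero]
      intro hmem
      apply hk
      simp only [Set.Finite.mem_toFinset, Set.mem_ofPred_eq, Set.mem_Ioi]
      have : (-(j : ℝ)) ≤ ℓ k ω + c := EReal.coe_le_coe_iff.1 hmem
      linarith
  · simp

end Cluster

/-! ### The combinatorics of the tree -/

section Tree

variable {Ω : Type*} {N : Label → Ω → ℕ} {ω : Ω}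

lemma generation_zero : generation N 0 ω = {[]} := by
  ext x
  simp only [generation, Set.mem_ofPred_eq, List.length_eq_zero_iff, Set.mem_singleton_iff]
  constructor
  · exact fun h => h.1
  · rintro rfl
    exact ⟨rfl, trivial⟩

lemma generation_succ (n : ℕ) :
    generation N (n + 1) ω = ⋃ x ∈ generation N n ω, (fun i => i :: x) '' Set.Iio (N x ω) := by
  ext x
  simp only [generation, Set.mem_ofPred_eq, Set.mem_iUnion, Set.mem_image, Set.mem_Iio,
    exists_prop]
  constructor
  · rintro ⟨hl, ht⟩
    cases x with
    | nil => simp at hl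
    | cons i x => exact ⟨x, ⟨by simpa using hl, ht.1⟩, i, ht.2, rfl⟩
  · rintro ⟨x, ⟨hl, ht⟩, i, hi, rfl⟩
    exact ⟨by simp [hl], ht, hi⟩

lemma finite_generation (n : ℕ) : (generation N n ω).Finite := by
  induction n with
  | zero => rw [generation_zero]; exact Set.finite_singleton _
  | succ n ih =>
    rw [generation_succ]
    exact ih.biUnion fun x _ => (Set.finite_Iio _).image _

variable (N ω) in
/-- The particles of generation `n`, as a finite set. -/
noncomputable def treeGen (n : ℕ) : Finset Label := (finite_generation (N := N) (ω := ω) n).toFinset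

lemma mem_treeGen {n : ℕ} {x : Label} : x ∈ treeGen N ω n ↔ x.length = n ∧ InTree N ω x := by
  simp [treeGen, generation]

lemma gwSize_eq_card (n : ℕ) : gwSize N n ω = (treeGen N ω n).card :=
  Set.ncard_eq_toFinset_card _ (finite_generation n)

@[simp] lemma treeGen_zero : treeGen N ω 0 = {[]} := by
  ext x
  rw [mem_treeGen, List.length_eq_zero_iff, Finset.mem_singleton]
  exact ⟨fun h => h.1, by rintro rfl; exact ⟨rfl, trivial⟩⟩

/-- The offspring numbers in the subtree descending from `y`. -/
def subtree (N : Label → Ω → ℕ) (y : Label) : Label → Ω → ℕ := fun x => N (x ++ y)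

lemma inTree_append (x y : Label) :
    InTree N ω (x ++ y) ↔ InTree N ω y ∧ InTree (subtree N y) ω x := by
  induction x with
  | nil => simp [InTree]
  | cons i x ih =>
    simp only [List.cons_append, InTree, ih, subtree, and_assoc]

/-- Generation `k + l` is the disjoint union of the `l`-th generations of the subtrees rooted in
generation `k`. -/
lemma sum_treeGen_add {M : Type*} [AddCommMonoid M] (k l : ℕ) (h : Label → M) :
    ∑ x ∈ treeGen N ω (k + l), h x =
      ∑ y ∈ treeGen N ω k, ∑ z ∈ treeGen (subtree N y) ω l, h (z ++ y) := by
  classical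
  rw [Finset.sum_sigma']
  symm
  refine Finset.sum_bij (fun p _ => p.2 ++ p.1) ?_ ?_ ?_ ?_
  · rintro ⟨y, z⟩ hp
    simp only [Finset.mem_sigma, mem_treeGen] at hp ⊢
    exact ⟨by rw [List.length_append]; omega, (inTree_append z y).2 ⟨hp.1.2, hp.2.2⟩⟩
  · rintro ⟨y, z⟩ hp ⟨y', z'⟩ hp' heq
    simp only [Finset.mem_sigma, mem_treeGen] at hp hp' heq
    obtain ⟨h1, h2⟩ := List.append_inj heq (by omega)
    subst h1 h2
    rfl
  · intro x hx
    rw [mem_treeGen] at hx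
    have hxx : x.take l ++ x.drop l = x := List.take_append_drop l x
    have hT := (inTree_append (N := N) (ω := ω) (x.take l) (x.drop l)).1 (hxx.symm ▸ hx.2)
    refine ⟨⟨x.drop l, x.take l⟩, ?_, hxx⟩
    simp only [Finset.mem_sigma, mem_treeGen, List.length_drop, List.length_take]
    exact ⟨⟨by omega, hT.1⟩, ⟨by omega, hT.2⟩⟩
  · intro p _
    rfl

lemma treeGen_one : treeGen N ω 1 = (Finset.range (N [] ω)).image fun i => [i] := by
  ext x
  rw [mem_treeGen, Finset.mem_image]
  constructor
  · rintro ⟨hl, ht⟩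
    obtain ⟨i, rfl⟩ := List.length_eq_one_iff.1 hl
    exact ⟨i, Finset.mem_range.2 ht.2, rfl⟩
  · rintro ⟨i, hi, rfl⟩
    exact ⟨rfl, trivial, Finset.mem_range.1 hi⟩

lemma gwSize_add (k l : ℕ) :
    gwSize N (k + l) ω = ∑ y ∈ treeGen N ω k, gwSize (subtree N y) l ω := by
  simp_rw [gwSize_eq_card, Finset.card_eq_sum_ones]
  exact sum_treeGen_add k l fun _ => 1

lemma gwSize_succ (n : ℕ) : gwSize N (n + 1) ω = ∑ y ∈ treeGen N ω n, N y ω := by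
  rw [gwSize_add]
  refine Finset.sum_congr rfl fun y _ => ?_
  rw [gwSize_eq_card, treeGen_one, Finset.card_image_of_injective _ (fun i j h => by simpa using h)]
  simp [subtree]

@[simp] lemma gwSize_zero : gwSize N 0 ω = 1 := by simp [gwSize_eq_card]

open Classical in
/-- A sum over the random set `treeGen N ω n` as a sum over all labels of length `n`, whose summands
are measurable in `ω`. -/
lemma coe_sum_treeGen (n : ℕ) (h : Label → ℝ≥0∞) :
    ∑ x ∈ treeGen N ω n, h x =
      ∑' x : {x : Label // x.length = n}, if InTree N ω x then h x else 0 := by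
  have e : ∑' x : {x : Label // x.length = n}, (if InTree N ω x then h x else 0) =
      ∑' x : Label, if x ∈ treeGen N ω n then h x else 0 := by
    have := tsum_subtype {x : Label | x.length = n} (fun x => if InTree N ω x then h x else 0)
    rw [show (∑' x : {x : Label // x.length = n}, (if InTree N ω x then h x else 0)) =
      ∑' x : {x : Label | x.length = n}, (if InTree N ω x then h x else 0) from rfl, this]
    refine tsum_congr fun x => ?_
    simp only [Set.indicator, Set.mem_ofPred_eq, mem_treeGen]
    split_ifs <;> simp_all
  rw [e, tsum_eq_sum (s := treeGen N ω n) (fun x hx => by simp [hx])]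
  exact Finset.sum_congr rfl fun x hx => by simp [hx]

/-! Everything above depends on `ω` only through the family `(N u ω)_u`. -/

lemma inTree_congr {Ω₂ : Type*} {N₂ : Label → Ω₂ → ℕ} {ω₂ : Ω₂} (h : ∀ u, N u ω = N₂ u ω₂)
    (x : Label) : InTree N ω x ↔ InTree N₂ ω₂ x := by
  induction x with
  | nil => simp [InTree]
  | cons i x ih => simp [InTree, ih, h]

lemma gwSize_congr {Ω₂ : Type*} {N₂ : Label → Ω₂ → ℕ} {ω₂ : Ω₂} (h : ∀ u, N u ω = N₂ u ω₂)
    (n : ℕ) : gwSize N n ω = gwSize N₂ n ω₂ := by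
  simp only [gwSize, generation, inTree_congr h]

end Tree

/-! ### Measurability and independence in the tree -/

section Measurability

variable {Ω : Type*} {N : Label → Ω → ℕ}

lemma measurableSet_inTree {mΩ : MeasurableSpace Ω} (n : ℕ)
    (h : ∀ u : Label, u.length < n → Measurable (N u)) (x : Label) (hx : x.length ≤ n) :
    MeasurableSet {ω | InTree N ω x} := by
  induction x with
  | nil => simp [InTree]
  | cons i x ih =>
    simp only [List.length_cons] at hx
    have : {ω | InTree N ω (i :: x)} = {ω | InTree N ω x} ∩ N x ⁻¹' Set.Ioi i := by
      ext ω; rfl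
    rw [this]
    exact (ih (by omega)).inter (h x (by omega) measurableSet_Ioi)

/-- Generation `n` is determined by the offspring numbers of the labels of length less than `n`. The
`σ`-algebra is arbitrary, so as to cover the ones generated by a part of the tree. -/
lemma measurableSet_treeGen_eq {mΩ : MeasurableSpace Ω} (n : ℕ)
    (h : ∀ u : Label, u.length < n → Measurable (N u)) (S : Finset Label) :
    MeasurableSet {ω | treeGen N ω n = S} := by
  have : {ω | treeGen N ω n = S} = ⋂ x : Label, {ω | x ∈ treeGen N ω n ↔ x ∈ S} := by
    ext ω
    simp [Finset.ext_iff]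
  rw [this]
  refine MeasurableSet.iInter fun x => ?_
  have hx : MeasurableSet {ω | x ∈ treeGen N ω n} := by
    by_cases hl : x.length = n
    · simp only [mem_treeGen, hl, true_and]
      exact measurableSet_inTree n h x hl.le
    · simp [mem_treeGen, hl]
  by_cases hS : x ∈ S
  · simpa [hS] using hx
  · have e : {ω | x ∈ treeGen N ω n ↔ x ∈ S} = {ω | x ∈ treeGen N ω n}ᶜ := by
      ext ω
      simp [hS]
    rw [e]
    exact hx.compl

lemma measurable_gwSize_of {mΩ : MeasurableSpace Ω} (n : ℕ)
    (h : ∀ u : Label, u.length < n → Measurable (N u)) : Measurable (gwSize N n) := by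
  refine measurable_to_countable' fun j => ?_
  have : gwSize N n ⁻¹' {j} = ⋃ S : {S : Finset Label // S.card = j},
      {ω | treeGen N ω n = S} := by
    ext ω
    simp [gwSize_eq_card]
  rw [this]
  exact MeasurableSet.iUnion fun S => measurableSet_treeGen_eq n h S

/-- **Freezing**: a random index `T` with countably many values may be replaced by its value when
it is independent of the family it selects from. -/
lemma lintegral_freeze {M₁ M₂ mΩ : MeasurableSpace Ω} {P : Measure Ω} {κ : Type*} [Countable κ]
    (h₁ : M₁ ≤ mΩ) (h₂ : M₂ ≤ mΩ) (hi : Indep M₁ M₂ P)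
    {T : Ω → κ} (hT : ∀ t, MeasurableSet[M₁] {ω | T ω = t})
    {F : κ → Ω → ℝ≥0∞} (hF : ∀ t, Measurable[M₂] (F t)) :
    ∫⁻ ω, F (T ω) ω ∂P = ∫⁻ ω, (∫⁻ ω', F (T ω) ω' ∂P) ∂P := by
  classical
  have e1 : ∀ (G : κ → Ω → ℝ≥0∞) ω, G (T ω) ω =
      ∑' t, {ω | T ω = t}.indicator (fun _ => 1) ω * G t ω := by
    intro G ω
    rw [tsum_eq_single (T ω)]
    · simp [Set.indicator]
    · intro t ht
      simp [Set.indicator, ht.symm]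
  simp_rw [e1 F, e1 (fun t _ => ∫⁻ ω', F t ω' ∂P)]
  have hm1 : ∀ t, Measurable[M₁] ({ω | T ω = t}.indicator (fun _ => (1 : ℝ≥0∞))) := fun t =>
    Measurable.indicator (m := M₁) measurable_const (hT t)
  have hm1' : ∀ t, Measurable ({ω | T ω = t}.indicator (fun _ => (1 : ℝ≥0∞))) := fun t =>
    (hm1 t).mono h₁ le_rfl
  have hm2 : ∀ t, AEMeasurable
      (fun ω => {ω | T ω = t}.indicator (fun _ => (1 : ℝ≥0∞)) ω * F t ω) P := fun t =>
    ((hm1' t).mul ((hF t).mono h₂ le_rfl)).aemeasurable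
  have hm3 : ∀ t, AEMeasurable
      (fun ω => {ω | T ω = t}.indicator (fun _ => (1 : ℝ≥0∞)) ω * ∫⁻ ω', F t ω' ∂P) P := fun t =>
    ((hm1' t).mul measurable_const).aemeasurable
  rw [lintegral_tsum hm2, lintegral_tsum hm3]
  refine tsum_congr fun t => ?_
  rw [lintegral_mul_eq_lintegral_mul_lintegral_of_independent_measurableSpace h₁ h₂ hi (hm1 t)
    (hF t), lintegral_mul_const _ (hm1' t)]

end Measurability

section Independence

variable {Ω : Type*} [mΩ : MeasurableSpace Ω] {P : Measure Ω} [IsProbabilityMeasure P]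
  {p : Measure ℕ} {ν : Measure ℝ} {N : Label → Ω → ℕ} {X : NonRoot → Ω → ℝ}

/-- The information carried by the offspring numbers of the particles in `S`. -/
@[reducible] def sigmaN (N : Label → Ω → ℕ) (S : Set Label) : MeasurableSpace Ω :=
  ⨆ u ∈ S, MeasurableSpace.comap (N u) inferInstance

omit mΩ in
lemma measurable_sigmaN {S : Set Label} {u : Label} (hu : u ∈ S) : Measurable[sigmaN N S] (N u) :=
  (comap_measurable (N u)).mono (le_iSup₂_of_le u hu le_rfl) le_rfl

lemma sigmaN_le (hN : ∀ u, Measurable (N u)) (S : Set Label) : sigmaN N S ≤ mΩ :=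
  iSup₂_le fun u _ => (hN u).comap_le

omit [IsProbabilityMeasure P] in
lemma indep_sigmaN (hN : ∀ u, Measurable (N u)) (hi : iIndepFun N P) {S T : Set Label}
    (hST : Disjoint S T) : Indep (sigmaN N S) (sigmaN N T) P :=
  indep_iSup_of_disjoint (fun u => (hN u).comap_le) hi hST

omit mΩ in
lemma measurable_sigmaN_gwSize_subtree (y : Label) (n : ℕ) :
    Measurable[sigmaN N {u | y <:+ u}] (gwSize (subtree N y) n) :=
  measurable_gwSize_of (mΩ := sigmaN N {u | y <:+ u}) n fun u _ =>
    measurable_sigmaN (S := {u | y <:+ u}) (List.suffix_append u y)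

omit mΩ in
lemma sigmaN_mono {S T : Set Label} (h : S ⊆ T) : sigmaN N S ≤ sigmaN N T :=
  biSup_mono h

variable (hB : IsBranchingRandomWalk p ν N X P)
include hB

omit [IsProbabilityMeasure P] in
lemma IsBranchingRandomWalk.measurable_gwSize (n : ℕ) : Measurable (gwSize N n) :=
  measurable_gwSize_of n fun u _ => hB.measurable_offspring u

omit [IsProbabilityMeasure P] in
lemma IsBranchingRandomWalk.measurable_coe_gwSize (n : ℕ) :
    Measurable fun ω => (gwSize N n ω : ℝ≥0∞) :=
  (measurable_of_countable (fun j : ℕ => (j : ℝ≥0∞))).comp (hB.measurable_gwSize n)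

omit [IsProbabilityMeasure P] in
lemma IsBranchingRandomWalk.measurable_gwSize_subtree (y : Label) (n : ℕ) :
    Measurable (gwSize (subtree N y) n) :=
  measurable_gwSize_of n fun u _ => hB.measurable_offspring (u ++ y)

lemma IsBranchingRandomWalk.isProbabilityMeasure_displacement : IsProbabilityMeasure ν := by
  rw [← hB.law_displacement ⟨[0], by simp⟩]
  exact Measure.isProbabilityMeasure_map (hB.measurable_displacement _).aemeasurable

omit [IsProbabilityMeasure P] in
/-- Subtrees have the same law as the whole tree. -/
lemma IsBranchingRandomWalk.map_gwSize_subtree (y : Label) (n : ℕ) :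
    P.map (gwSize (subtree N y) n) = P.map (gwSize N n) := by
  have h1 := hB.iIndep_offspring.map_fun_eq_infinitePi_map hB.measurable_offspring
  have hinj : Function.Injective fun x : Label => x ++ y := List.append_left_injective y
  have hm : ∀ x, Measurable (subtree N y x) := fun x => hB.measurable_offspring (x ++ y)
  have h2 := (hB.iIndep_offspring.precomp hinj).map_fun_eq_infinitePi_map
    (X := subtree N y) hm
  have h3 : P.map (fun ω x => subtree N y x ω) = P.map (fun ω x => N x ω) := by
    rw [h1, h2]
    congr 1
    funext x
    rw [subtree, hB.law_offspring, hB.law_offspring]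
  let c : Label → (Label → ℕ) → ℕ := fun u η => η u
  have hc : Measurable (gwSize c n) := measurable_gwSize_of n fun u _ => measurable_pi_apply u
  have e1 : gwSize N n = gwSize c n ∘ fun ω u => N u ω := by
    funext ω
    exact gwSize_congr (N := N) (N₂ := c) (ω := ω) (ω₂ := fun u => N u ω) (fun u => rfl) n
  have e2 : gwSize (subtree N y) n = gwSize c n ∘ fun ω u => subtree N y u ω := by
    funext ω
    exact gwSize_congr (N := subtree N y) (N₂ := c) (ω := ω)
      (ω₂ := fun u => subtree N y u ω) (fun u => rfl) n
  rw [e1, e2, ← Measure.map_map hc (measurable_pi_iff.2 hB.measurable_offspring),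
    ← Measure.map_map hc (measurable_pi_iff.2 hm), h3]

lemma IsBranchingRandomWalk.lintegral_gwSize_subtree (y : Label) (n : ℕ) (h : ℕ → ℝ≥0∞) :
    ∫⁻ ω, h (gwSize (subtree N y) n ω) ∂P = ∫⁻ ω, h (gwSize N n ω) ∂P := by
  have hh : Measurable h := measurable_of_countable h
  rw [← lintegral_map hh (hB.measurable_gwSize_subtree y n), hB.map_gwSize_subtree,
    lintegral_map hh (hB.measurable_gwSize n)]

end Independence

/-! ### The Galton–Watson martingale -/

section GaltonWatson

variable {Ω : Type*} [mΩ : MeasurableSpace Ω] {P : Measure Ω} [IsProbabilityMeasure P]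
  {p : Measure ℕ} {ν : Measure ℝ} {N : Label → Ω → ℕ} {X : NonRoot → Ω → ℝ}

lemma OffspringAssumption.mean_pos (hp : OffspringAssumption p) : 0 < offspringMean p :=
  zero_lt_one.trans hp.one_lt_mean

omit [IsProbabilityMeasure P] in
lemma IsBranchingRandomWalk.lintegral_offspring (hB : IsBranchingRandomWalk p ν N X P)
    (hp : OffspringAssumption p) (u : Label) :
    ∫⁻ ω, (N u ω : ℝ≥0∞) ∂P = ENNReal.ofReal (offspringMean p) := by
  have hm : Measurable fun k : ℕ => (k : ℝ≥0∞) := measurable_of_countable _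
  rw [← lintegral_map hm (hB.measurable_offspring u), hB.law_offspring, offspringMean,
    ofReal_integral_eq_lintegral_ofReal hp.integrable
      (Eventually.of_forall fun k => Nat.cast_nonneg k)]
  simp

omit [IsProbabilityMeasure P] in
/-- The labels of length at least `n` and those of length less than `n` carry independent
information. -/
lemma indep_sigmaN_length (hN : ∀ u, Measurable (N u)) (hi : iIndepFun N P) (n : ℕ) :
    Indep (sigmaN N {u | u.length < n}) (sigmaN N {u | n ≤ u.length}) P := by
  refine indep_sigmaN hN hi (Set.disjoint_left.2 fun u hu hu' => ?_)
  simp only [Set.mem_ofPred_eq] at hu hu'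
  omega

/-- The martingale property of the Galton–Watson process, in integrated form. -/
lemma IsBranchingRandomWalk.setLIntegral_gwSize_succ (hB : IsBranchingRandomWalk p ν N X P)
    (hp : OffspringAssumption p) (n : ℕ) {A : Set Ω}
    (hA : MeasurableSet[sigmaN N {u | u.length < n}] A) :
    ∫⁻ ω in A, (gwSize N (n + 1) ω : ℝ≥0∞) ∂P =
      ENNReal.ofReal (offspringMean p) * ∫⁻ ω in A, (gwSize N n ω : ℝ≥0∞) ∂P := by
  classical
  have hN := hB.measurable_offspring
  have hA' : MeasurableSet A := sigmaN_le hN _ A hA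
  -- freeze both generation `n` and the occurrence of `A`: the filter by length in `F` has no effect
  -- on generation `n`, but makes `F t` depend on late offspring numbers only for every index `t`
  let T : Ω → Finset Label × Bool := fun ω => (treeGen N ω n, decide (ω ∈ A))
  let F : Finset Label × Bool → Ω → ℝ≥0∞ := fun t ω =>
    if t.2 then ∑ y ∈ t.1.filter (fun y => y.length = n), (N y ω : ℝ≥0∞) else 0
  have hfil : ∀ ω, (treeGen N ω n).filter (fun y => y.length = n) = treeGen N ω n := fun ω =>
    Finset.filter_true_of_mem fun y hy => (mem_treeGen.1 hy).1
  have hT : ∀ t, MeasurableSet[sigmaN N {u | u.length < n}] {ω | T ω = t} := by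
    rintro ⟨S, b⟩
    have : {ω | T ω = (S, b)} = {ω | treeGen N ω n = S} ∩ (if b then A else Aᶜ) := by
      ext ω
      cases b <;> simp [T]
    rw [this]
    refine MeasurableSet.inter (measurableSet_treeGen_eq (mΩ := sigmaN N {u | u.length < n}) n
      (fun u hu => measurable_sigmaN (S := {u | u.length < n}) hu) S) ?_
    cases b
    · simpa using hA.compl
    · simpa using hA
  have hF : ∀ t, Measurable[sigmaN N {u | n ≤ u.length}] (F t) := by
    rintro ⟨S, b⟩
    cases b
    · simp only [F, Bool.false_eq_true, if_false]
      exact measurable_const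
    · simp only [F, if_true]
      refine Finset.measurable_sum _ fun y hy => ?_
      have h1 : Measurable[sigmaN N {u | n ≤ u.length}] (N y) :=
        measurable_sigmaN (S := {u | n ≤ u.length}) (Finset.mem_filter.1 hy).2.ge
      exact (measurable_of_countable (fun j : ℕ => (j : ℝ≥0∞))).comp h1
  have key := lintegral_freeze (sigmaN_le hN _) (sigmaN_le hN _)
    (indep_sigmaN_length hN hB.iIndep_offspring n) hT hF
  have e1 : ∀ ω, F (T ω) ω = A.indicator (fun ω => (gwSize N (n + 1) ω : ℝ≥0∞)) ω := by
    intro ω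
    by_cases h : ω ∈ A
    · simp [F, T, h, hfil, gwSize_succ]
    · simp [F, T, h]
  have e2 : ∀ ω, ∫⁻ ω', F (T ω) ω' ∂P =
      ENNReal.ofReal (offspringMean p) * A.indicator (fun ω => (gwSize N n ω : ℝ≥0∞)) ω := by
    intro ω
    by_cases h : ω ∈ A
    · simp only [F, T, h, decide_true, if_true, hfil, Set.indicator_of_mem]
      rw [lintegral_finsetSum]
      · simp_rw [hB.lintegral_offspring hp]
        rw [Finset.sum_const, nsmul_eq_mul, gwSize_eq_card, mul_comm]
      · exact fun y _ => (measurable_of_countable (fun j : ℕ => (j : ℝ≥0∞))).comp (hN y)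
    · simp [F, T, h]
  have hZ : Measurable (A.indicator fun ω => (gwSize N n ω : ℝ≥0∞)) :=
    (hB.measurable_coe_gwSize n).indicator hA'
  simp_rw [e1, e2] at key
  rw [lintegral_const_mul _ hZ, lintegral_indicator hA', lintegral_indicator hA'] at key
  exact key

lemma IsBranchingRandomWalk.lintegral_gwSize (hB : IsBranchingRandomWalk p ν N X P)
    (hp : OffspringAssumption p) (n : ℕ) :
    ∫⁻ ω, (gwSize N n ω : ℝ≥0∞) ∂P = ENNReal.ofReal (offspringMean p ^ n) := by
  induction n with
  | zero => simp
  | succ n ih =>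
    have := hB.setLIntegral_gwSize_succ hp n (A := Set.univ) MeasurableSet.univ
    rw [setLIntegral_univ, setLIntegral_univ, ih, ← ENNReal.ofReal_mul hp.mean_pos.le] at this
    rw [this, pow_succ']

lemma IsBranchingRandomWalk.integrable_gwSize (hB : IsBranchingRandomWalk p ν N X P)
    (hp : OffspringAssumption p) (n : ℕ) : Integrable (fun ω => (gwSize N n ω : ℝ)) P := by
  refine ⟨((measurable_of_countable (fun j : ℕ => (j : ℝ))).comp
    (hB.measurable_gwSize n)).aestronglyMeasurable, ?_⟩
  rw [hasFiniteIntegral_iff_ofReal (Eventually.of_forall fun ω => Nat.cast_nonneg _)]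
  simp only [ENNReal.ofReal_natCast]
  rw [hB.lintegral_gwSize hp]
  exact ENNReal.ofReal_lt_top

/-- The normalized population size converges almost surely. -/
theorem IsBranchingRandomWalk.ae_tendsto_gwLimit (hB : IsBranchingRandomWalk p ν N X P)
    (hp : OffspringAssumption p) :
    ∀ᵐ ω ∂P, Tendsto (fun n : ℕ => (gwSize N n ω : ℝ) / offspringMean p ^ n) atTop
      (𝓝 (gwLimit N (offspringMean p) ω)) := by
  set m := offspringMean p with hm
  have hm0 : 0 < m := hp.mean_pos
  have hN := hB.measurable_offspring
  let ℱ : Filtration ℕ mΩ :=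
    ⟨fun n => sigmaN N {u | u.length < n},
      fun i j hij => sigmaN_mono fun u hu => lt_of_lt_of_le (a := u.length) hu hij,
      fun n => sigmaN_le hN _⟩
  let M : ℕ → Ω → ℝ := fun n ω => (gwSize N n ω : ℝ) / m ^ n
  have hint : ∀ n, Integrable (M n) P := fun n => (hB.integrable_gwSize hp n).div_const _
  have hadp : ∀ n, StronglyMeasurable[ℱ n] (M n) := by
    intro n
    have h1 : Measurable[sigmaN N {u | u.length < n}] (gwSize N n) :=
      measurable_gwSize_of (mΩ := sigmaN N {u | u.length < n}) n
        fun u hu => measurable_sigmaN (S := {u | u.length < n}) hu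
    have h2 : Measurable[sigmaN N {u | u.length < n}] (M n) :=
      (measurable_of_countable (fun j : ℕ => (j : ℝ) / m ^ n)).comp h1
    exact h2.stronglyMeasurable
  have hset : ∀ n (s : Set Ω), MeasurableSet s → ∫ ω in s, M n ω ∂P =
      (∫⁻ ω in s, (gwSize N n ω : ℝ≥0∞) ∂P).toReal / m ^ n := by
    intro n s hs
    rw [integral_div, integral_eq_lintegral_of_nonneg_ae
      (Eventually.of_forall fun ω => Nat.cast_nonneg _)
      (hB.integrable_gwSize hp n).aestronglyMeasurable.restrict]
    simp
  have hmart : Martingale M ℱ P := by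
    refine martingale_nat hadp hint fun n => ?_
    refine ae_eq_condExp_of_forall_setIntegral_eq (ℱ.le n) (hint (n + 1))
      (fun s _ _ => (hint n).integrableOn) (fun s hs _ => ?_) (hadp n).aestronglyMeasurable
    have hs' : MeasurableSet s := ℱ.le n s hs
    rw [hset _ _ hs', hset _ _ hs', hB.setLIntegral_gwSize_succ hp n hs, ENNReal.toReal_mul,
      ENNReal.toReal_ofReal hm0.le, pow_succ', mul_div_mul_left _ _ hm0.ne']
  -- a martingale bounded in `L¹` converges almost surely
  have hbdd : ∀ n, eLpNorm (M n) 1 P ≤ ((1 : ℝ≥0) : ℝ≥0∞) := by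
    intro n
    rw [eLpNorm_one_eq_lintegral_enorm]
    have : ∀ ω, ‖M n ω‖ₑ = (gwSize N n ω : ℝ≥0∞) * ENNReal.ofReal ((m ^ n)⁻¹) := by
      intro ω
      have h0 : (0 : ℝ) ≤ gwSize N n ω := Nat.cast_nonneg _
      rw [Real.enorm_eq_ofReal (by positivity)]
      simp only [M]
      rw [div_eq_mul_inv, ENNReal.ofReal_mul h0,
        ENNReal.ofReal_natCast]
    simp_rw [this]
    rw [lintegral_mul_const _ (hB.measurable_coe_gwSize n), hB.lintegral_gwSize hp, ← ENNReal.ofReal_mul (by positivity),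
      mul_inv_cancel₀ (by positivity)]
    simp
  filter_upwards [hmart.submartingale.ae_tendsto_limitProcess hbdd] with ω hω
  have : gwLimit N m ω = Filtration.limitProcess M ℱ P ω := hω.limUnder_eq
  rw [this]
  exact hω

lemma IsBranchingRandomWalk.ae_gwLimit_nonneg (hB : IsBranchingRandomWalk p ν N X P)
    (hp : OffspringAssumption p) : ∀ᵐ ω ∂P, 0 ≤ gwLimit N (offspringMean p) ω := by
  filter_upwards [hB.ae_tendsto_gwLimit hp] with ω hω
  have := hp.mean_pos
  exact ge_of_tendsto' hω fun n => by positivity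

/-! ### Law of large numbers for functionals of the subtrees -/

/-- Expectation of a sum over a generation of a functional of the subtrees. -/
lemma IsBranchingRandomWalk.lintegral_sum_subtree (hB : IsBranchingRandomWalk p ν N X P)
    (hp : OffspringAssumption p) (k l : ℕ) (h : ℕ → ℝ≥0∞) :
    ∫⁻ ω, ∑ y ∈ treeGen N ω k, h (gwSize (subtree N y) l ω) ∂P =
      ENNReal.ofReal (offspringMean p ^ k) * ∫⁻ ω, h (gwSize N l ω) ∂P := by
  classical
  have hN := hB.measurable_offspring
  let F : Finset Label → Ω → ℝ≥0∞ := fun S ω =>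
    ∑ y ∈ S.filter (fun y => y.length = k), h (gwSize (subtree N y) l ω)
  have hfil : ∀ ω, (treeGen N ω k).filter (fun y => y.length = k) = treeGen N ω k := fun ω =>
    Finset.filter_true_of_mem fun y hy => (mem_treeGen.1 hy).1
  have hF : ∀ S, Measurable[sigmaN N {u | k ≤ u.length}] (F S) := by
    intro S
    refine Finset.measurable_sum _ fun y hy => (measurable_of_countable h).comp ?_
    refine (measurable_sigmaN_gwSize_subtree (N := N) y l).mono (sigmaN_mono fun u hu => ?_) le_rfl
    exact (Finset.mem_filter.1 hy).2.ge.trans (List.IsSuffix.length_le hu)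
  have key := lintegral_freeze (sigmaN_le hN _) (sigmaN_le hN _)
    (indep_sigmaN_length hN hB.iIndep_offspring k) (T := fun ω => treeGen N ω k)
    (fun S => measurableSet_treeGen_eq (mΩ := sigmaN N {u | u.length < k}) k
      (fun u hu => measurable_sigmaN (S := {u | u.length < k}) hu) S) hF
  simp only [F, hfil] at key
  rw [key]
  have e : ∀ ω, ∫⁻ ω', ∑ y ∈ treeGen N ω k, h (gwSize (subtree N y) l ω') ∂P =
      (gwSize N k ω : ℝ≥0∞) * ∫⁻ ω, h (gwSize N l ω) ∂P := by
    intro ω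
    rw [lintegral_finsetSum]
    · simp_rw [hB.lintegral_gwSize_subtree]
      rw [Finset.sum_const, nsmul_eq_mul, gwSize_eq_card]
    · exact fun y _ => (measurable_of_countable h).comp (hB.measurable_gwSize_subtree y l)
  simp_rw [e]
  rw [lintegral_mul_const _ (hB.measurable_coe_gwSize k), hB.lintegral_gwSize hp]

omit [IsProbabilityMeasure P] in
/-- The subtrees rooted at two particles of the same generation are independent, since they use
disjoint sets of labels. -/
lemma IsBranchingRandomWalk.indepFun_subtree (hB : IsBranchingRandomWalk p ν N X P) {k : ℕ} (l : ℕ)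
    {y y' : Label} (hy : y.length = k) (hy' : y'.length = k) (hne : y ≠ y') :
    IndepFun (gwSize (subtree N y) l) (gwSize (subtree N y') l) P := by
  rw [IndepFun_iff_Indep]
  refine indep_of_indep_of_le_left (indep_of_indep_of_le_right
    (indep_sigmaN hB.measurable_offspring hB.iIndep_offspring (S := {u | y <:+ u})
      (T := {u | y' <:+ u}) ?_) (measurable_sigmaN_gwSize_subtree y' l).comap_le)
    (measurable_sigmaN_gwSize_subtree y l).comap_le
  refine Set.disjoint_left.2 fun u hu hu' => hne ?_
  exact List.IsSuffix.eq_of_length (List.suffix_of_suffix_length_le hu hu' (hy.trans hy'.symm).le)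
    (hy.trans hy'.symm)

/-- The fluctuations of a sum over generation `k` of a bounded functional of the subtrees are of
order at most `m ^ (k / 2)`. -/
lemma IsBranchingRandomWalk.lintegral_abs_sum_subtree_le (hB : IsBranchingRandomWalk p ν N X P)
    (hp : OffspringAssumption p) (k l : ℕ) {g : ℕ → ℝ} {c : ℝ} (hc : 0 < c)
    (hg0 : ∀ j, 0 ≤ g j) (hgc : ∀ j, g j ≤ c) :
    ∫⁻ ω, ENNReal.ofReal |∑ y ∈ treeGen N ω k, g (gwSize (subtree N y) l ω) -
        gwSize N k ω * ∫ ω, g (gwSize N l ω) ∂P| ∂P ≤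
      ENNReal.ofReal (c * √(offspringMean p ^ k)) := by
  classical
  have hN := hB.measurable_offspring
  set m := offspringMean p with hm
  have hm0 : 0 < m := hp.mean_pos
  set e := ∫ ω, g (gwSize N l ω) ∂P with he
  have hgm : ∀ y, Measurable fun ω => g (gwSize (subtree N y) l ω) := fun y =>
    (measurable_of_countable g).comp (hB.measurable_gwSize_subtree y l)
  have hmean : ∀ y, ∫ ω, g (gwSize (subtree N y) l ω) ∂P = e := by
    intro y
    rw [he, ← integral_map (φ := gwSize (subtree N y) l) (f := g)
      (hB.measurable_gwSize_subtree y l).aemeasurable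
      (measurable_of_countable g).aestronglyMeasurable, hB.map_gwSize_subtree,
      integral_map (hB.measurable_gwSize l).aemeasurable
      (measurable_of_countable g).aestronglyMeasurable]
  have hLp : ∀ y, MemLp (fun ω => g (gwSize (subtree N y) l ω)) 2 P := fun y =>
    MemLp.of_bound (hgm y).aestronglyMeasurable c
      (Eventually.of_forall fun ω => by
        rw [Real.norm_eq_abs, abs_of_nonneg (hg0 _)]; exact hgc _)
  -- the centred sum over a fixed set of labels, restricted to those of length `k`
  let D : Finset Label → Ω → ℝ := fun S ω =>
    ∑ y ∈ S.filter (fun y => y.length = k), g (gwSize (subtree N y) l ω) -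
      (S.filter (fun y => y.length = k)).card * e
  have hfil : ∀ ω, (treeGen N ω k).filter (fun y => y.length = k) = treeGen N ω k := fun ω =>
    Finset.filter_true_of_mem fun y hy => (mem_treeGen.1 hy).1
  have hDm : ∀ S, Measurable[sigmaN N {u | k ≤ u.length}] (D S) := by
    intro S
    refine Measurable.sub (Finset.measurable_sum _ fun y hy =>
      (measurable_of_countable g).comp ?_) measurable_const
    refine (measurable_sigmaN_gwSize_subtree (N := N) y l).mono (sigmaN_mono fun u hu => ?_) le_rfl
    exact (Finset.mem_filter.1 hy).2.ge.trans (List.IsSuffix.length_le hu)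
  -- the second moment, for a frozen generation
  have hsq : ∀ S, ∫⁻ ω, ENNReal.ofReal (D S ω ^ 2) ∂P ≤ ENNReal.ofReal (c ^ 2) * S.card := by
    intro S
    set S' := S.filter (fun y => y.length = k) with hS'
    have hvar := IndepFun.variance_sum (μ := P) (s := S')
      (X := fun y ω => g (gwSize (subtree N y) l ω)) (fun y _ => hLp y) (by
        intro y hy y' hy' hne
        exact (hB.indepFun_subtree l (Finset.mem_filter.1 hy).2 (Finset.mem_filter.1 hy').2
          hne).comp (measurable_of_countable g) (measurable_of_countable g))
    have hsumm : Measurable (∑ y ∈ S', fun ω => g (gwSize (subtree N y) l ω)) :=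
      Finset.sum_induction _ Measurable (fun _ _ => Measurable.add) measurable_zero
        fun y _ => hgm y
    rw [variance_eq_integral hsumm.aemeasurable] at hvar
    have hI : ∫ ω, (∑ y ∈ S', fun ω => g (gwSize (subtree N y) l ω)) ω ∂P = S'.card * e := by
      simp only [Finset.sum_apply]
      rw [integral_finsetSum _ fun y _ => (hLp y).integrable (by norm_num)]
      simp_rw [hmean]
      rw [Finset.sum_const, nsmul_eq_mul]
    rw [hI] at hvar
    have hvar' : ∫ ω, D S ω ^ 2 ∂P = ∑ y ∈ S', Var[fun ω => g (gwSize (subtree N y) l ω); P] := by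
      rw [← hvar]
      refine integral_congr_ae (Eventually.of_forall fun ω => ?_)
      simp [D, S']
    have hD2 : MemLp (D S) 2 P := by
      refine MemLp.sub (memLp_finsetSum _ fun y _ => hLp y) (memLp_const _)
    rw [← ofReal_integral_eq_lintegral_ofReal hD2.integrable_sq
      (Eventually.of_forall fun ω => sq_nonneg _), hvar', ← ENNReal.ofReal_natCast,
      ← ENNReal.ofReal_mul (by positivity)]
    refine ENNReal.ofReal_le_ofReal ?_
    calc ∑ y ∈ S', Var[fun ω => g (gwSize (subtree N y) l ω); P]
        ≤ ∑ y ∈ S', c ^ 2 := by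
          refine Finset.sum_le_sum fun y _ => ?_
          refine (variance_le_sq_of_bounded (a := 0) (b := c)
            (Eventually.of_forall fun ω => ⟨hg0 _, hgc _⟩) (hgm y).aemeasurable).trans ?_
          nlinarith
      _ = c ^ 2 * S'.card := by rw [Finset.sum_const, nsmul_eq_mul, mul_comm]
      _ ≤ c ^ 2 * S.card := by
          gcongr
          exact Finset.filter_subset _ _
  have key := lintegral_freeze (sigmaN_le hN _) (sigmaN_le hN _)
    (indep_sigmaN_length hN hB.iIndep_offspring k) (T := fun ω => treeGen N ω k)
    (fun S => measurableSet_treeGen_eq (mΩ := sigmaN N {u | u.length < k}) k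
      (fun u hu => measurable_sigmaN (S := {u | u.length < k}) hu) S)
    (F := fun S ω => ENNReal.ofReal (D S ω ^ 2))
    (fun S => ENNReal.measurable_ofReal.comp ((hDm S).pow_const 2))
  have hsec : ∫⁻ ω, ENNReal.ofReal (D (treeGen N ω k) ω ^ 2) ∂P ≤
      ENNReal.ofReal (c ^ 2 * m ^ k) := by
    rw [key]
    calc ∫⁻ ω, ∫⁻ ω', ENNReal.ofReal (D (treeGen N ω k) ω' ^ 2) ∂P ∂P
        ≤ ∫⁻ ω, ENNReal.ofReal (c ^ 2) * (gwSize N k ω : ℝ≥0∞) ∂P := by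
          refine lintegral_mono fun ω => ?_
          rw [gwSize_eq_card]
          exact hsq _
      _ = _ := by
          rw [lintegral_const_mul _ (hB.measurable_coe_gwSize k), hB.lintegral_gwSize hp, ← ENNReal.ofReal_mul (by positivity)]
  have hD : ∀ ω, ∑ y ∈ treeGen N ω k, g (gwSize (subtree N y) l ω) - gwSize N k ω * e =
      D (treeGen N ω k) ω := by
    intro ω
    simp only [D, hfil, gwSize_eq_card]
  simp_rw [hD]
  -- `|x| ≤ (s + x² / s) / 2` with `s = c m ^ (k / 2)`
  set s := c * √(m ^ k) with hs
  have hspos : 0 < s := by positivity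
  have hs2 : s ^ 2 = c ^ 2 * m ^ k := by
    rw [hs, mul_pow, Real.sq_sqrt (by positivity)]
  calc ∫⁻ ω, ENNReal.ofReal |D (treeGen N ω k) ω| ∂P
      ≤ ∫⁻ ω, (ENNReal.ofReal (s / 2) +
          ENNReal.ofReal (1 / (2 * s)) * ENNReal.ofReal (D (treeGen N ω k) ω ^ 2)) ∂P := by
        refine lintegral_mono fun ω => ?_
        simp only
        rw [← ENNReal.ofReal_mul (by positivity), ← ENNReal.ofReal_add (by positivity)
          (by positivity)]
        refine ENNReal.ofReal_le_ofReal ?_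
        have h1 := sq_nonneg (|D (treeGen N ω k) ω| - s)
        rw [sub_sq, sq_abs] at h1
        rw [div_mul_eq_mul_div, one_mul, div_add_div _ _ (by positivity) (by positivity),
          le_div_iff₀ (by positivity)]
        nlinarith
    _ ≤ ENNReal.ofReal (s / 2) + ENNReal.ofReal (1 / (2 * s)) * ENNReal.ofReal (c ^ 2 * m ^ k) := by
        rw [lintegral_add_left measurable_const, lintegral_const, measure_univ, mul_one,
          lintegral_const_mul' _ _ ENNReal.ofReal_ne_top]
        gcongr
    _ = ENNReal.ofReal s := by
        rw [← ENNReal.ofReal_mul (by positivity), ← ENNReal.ofReal_add (by positivity)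
          (by positivity), ← hs2]
        congr 1
        field_simp
        ring

end GaltonWatson

/-! ### Convergence of the cluster sums -/

/-- Dominated convergence for sums whose range grows. -/
lemma tendsto_sum_range_of_dominated {f : ℕ → ℕ → ℝ} {h bound : ℕ → ℝ} (hb : Summable bound)
    (hlim : ∀ l, Tendsto (fun n => f n l) atTop (𝓝 (h l)))
    (hle : ∀ᶠ n in atTop, ∀ l, l < n → |f n l| ≤ bound l) :
    Tendsto (fun n => ∑ l ∈ Finset.range n, f n l) atTop (𝓝 (∑' l, h l)) := by
  have hb0 : ∀ l, 0 ≤ bound l := by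
    intro l
    obtain ⟨n, hn, hn'⟩ := (hle.and (eventually_gt_atTop l)).exists
    exact (abs_nonneg _).trans (hn l hn')
  have e : ∀ n, ∑ l ∈ Finset.range n, f n l = ∑' l, if l < n then f n l else 0 := by
    intro n
    rw [tsum_eq_sum (s := Finset.range n)]
    · exact Finset.sum_congr rfl fun l hl => by simp [Finset.mem_range.1 hl]
    · intro l hl
      simp [Finset.mem_range.not.1 hl]
  simp_rw [e]
  refine tendsto_tsum_of_dominated_convergence hb (fun l => ?_) ?_
  · refine (hlim l).congr' ?_
    filter_upwards [eventually_gt_atTop l] with n hn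
    simp [hn]
  · filter_upwards [hle] with n hn l
    split_ifs with h
    · exact hn l h
    · simpa using hb0 l

lemma abs_exp_neg_sub_exp_neg_le {x y : ℝ} (hx : 0 ≤ x) (hy : 0 ≤ y) :
    |Real.exp (-x) - Real.exp (-y)| ≤ |x - y| := by
  wlog h : x ≤ y generalizing x y
  · rw [abs_sub_comm, abs_sub_comm x]
    exact this hy hx (not_le.1 h).le
  have h1 : Real.exp (-y) ≤ Real.exp (-x) := Real.exp_le_exp.2 (by linarith)
  rw [abs_of_nonneg (by linarith), abs_sub_comm, abs_of_nonneg (by linarith)]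
  have h2 : Real.exp (-y) = Real.exp (-x) * Real.exp (-(y - x)) := by
    rw [← Real.exp_add]
    ring_nf
  have h3 := Real.add_one_le_exp (-(y - x))
  have h4 : Real.exp (-x) ≤ 1 := Real.exp_le_one_iff.2 (by linarith)
  have h5 := Real.exp_pos (-x)
  rw [h2]
  nlinarith

section ClusterSum

variable {Ω : Type*} [mΩ : MeasurableSpace Ω] {P : Measure Ω} [IsProbabilityMeasure P]
  {p : Measure ℕ} {ν : Measure ℝ} {N : Label → Ω → ℕ} {X : NonRoot → Ω → ℝ}

/-- The sum `m^{-n} ∑_y G(Z^y)` over the particles `y ≠ ∅` of the first `n` generations, where `Z^y`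
is the number of descendants of `y` in generation `n`. The summation index `l` is the number of
generations from `y` to generation `n`. -/
noncomputable def clusterSum (N : Label → Ω → ℕ) (m : ℝ) (G : ℕ → ℝ) (n : ℕ) (ω : Ω) : ℝ :=
  ∑ l ∈ Finset.range n, ∑ y ∈ treeGen N ω (n - l), G (gwSize (subtree N y) l ω) / m ^ n

omit [IsProbabilityMeasure P] in
lemma IsBranchingRandomWalk.measurable_sum_treeGen (hB : IsBranchingRandomWalk p ν N X P) (k : ℕ)
    {F : Label → Ω → ℝ} (hF : ∀ y, Measurable (F y)) :
    Measurable fun ω => ∑ y ∈ treeGen N ω k, F y ω := by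
  let _ : MeasurableSpace (Finset Label) := ⊤
  have hT : Measurable fun ω => treeGen N ω k := measurable_to_countable' fun S =>
    measurableSet_treeGen_eq k (fun u _ => hB.measurable_offspring u) S
  have h2 : Measurable fun z : Finset Label × Ω => ∑ y ∈ z.1, F y z.2 :=
    measurable_from_prod_countable_right fun S => Finset.measurable_sum _ fun y _ => hF y
  exact h2.comp (hT.prodMk measurable_id)

lemma IsBranchingRandomWalk.measurable_clusterSum (hB : IsBranchingRandomWalk p ν N X P) (m : ℝ)
    (G : ℕ → ℝ) (n : ℕ) : Measurable (clusterSum N m G n) :=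
  Finset.measurable_sum _ fun l _ => hB.measurable_sum_treeGen (n - l) fun y =>
    (measurable_of_countable fun j => G j / m ^ n).comp (hB.measurable_gwSize_subtree y l)

/-- The law of large numbers for `clusterSum`: conditionally on the first generations the subtrees
average out, and the sizes of the generations are governed by the martingale limit. -/
theorem IsBranchingRandomWalk.tendsto_integral_exp_neg_clusterSum
    (hB : IsBranchingRandomWalk p ν N X P) (hp : OffspringAssumption p)
    {gs : ℕ → ℕ → ℝ} {g : ℕ → ℝ} {c : ℝ} (hgs0 : ∀ n j, 0 ≤ gs n j)
    (hgsc : ∀ᶠ n in atTop, ∀ j, gs n j ≤ c)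
    (hlim : ∀ j, Tendsto (fun n => gs n j) atTop (𝓝 (g j))) :
    Tendsto (fun n => ∫ ω, Real.exp (-clusterSum N (offspringMean p) (gs n) n ω) ∂P) atTop
      (𝓝 (∫ ω, Real.exp (-(gwLimit N (offspringMean p) ω *
        ∑' l : ℕ, (offspringMean p ^ l)⁻¹ * ∫ ω, g (gwSize N l ω) ∂P)) ∂P)) := by
  wlog hc : 0 < c generalizing c
  · exact this (c := max c 1) (hgsc.mono fun n hn j => (hn j).trans (le_max_left _ _))
      (lt_max_of_lt_right one_pos)
  set m := offspringMean p with hm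
  have hm1 : 1 < m := hp.one_lt_mean
  have hm0 : 0 < m := hp.mean_pos
  have hg0 : ∀ j, 0 ≤ g j := fun j => ge_of_tendsto' (hlim j) fun n => hgs0 n j
  have hgc : ∀ j, g j ≤ c := fun j => le_of_tendsto (hlim j) (hgsc.mono fun n hn => hn j)
  have hgm : ∀ l, Measurable fun ω => g (gwSize N l ω) := fun l =>
    (measurable_of_countable g).comp (hB.measurable_gwSize l)
  have hgsm : ∀ n l, Measurable fun ω => gs n (gwSize N l ω) := fun n l =>
    (measurable_of_countable (gs n)).comp (hB.measurable_gwSize l)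
  set E : ℕ → ℝ := fun l => ∫ ω, g (gwSize N l ω) ∂P with hE
  have hE0 : ∀ l, 0 ≤ E l := fun l => integral_nonneg fun ω => hg0 _
  have hEc : ∀ l, E l ≤ c := by
    intro l
    have := integral_mono_of_nonneg (μ := P) (f := fun ω => g (gwSize N l ω)) (g := fun _ => c)
      (Eventually.of_forall fun ω => hg0 _) (integrable_const c)
      (Eventually.of_forall fun ω => hgc _)
    simpa using this
  -- the sum in which the functionals of the subtrees are replaced by their means
  let R : ℕ → Ω → ℝ := fun n ω =>
    ∑ l ∈ Finset.range n, (gwSize N (n - l) ω : ℝ) * E l / m ^ n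
  set S : ℕ → Ω → ℝ := fun n => clusterSum N m (gs n) n with hS
  have hSm : ∀ n, Measurable (S n) := fun n => hB.measurable_clusterSum m (gs n) n
  have hRm : ∀ n, Measurable (R n) := fun n => Finset.measurable_sum _ fun l _ =>
    (measurable_of_countable fun j : ℕ => (j : ℝ) * E l / m ^ n).comp (hB.measurable_gwSize _)
  have hS0 : ∀ n ω, 0 ≤ S n ω := fun n ω => Finset.sum_nonneg fun l _ =>
    Finset.sum_nonneg fun y _ => div_nonneg (hgs0 _ _) (by positivity)
  have hR0 : ∀ n ω, 0 ≤ R n ω := fun n ω => Finset.sum_nonneg fun l _ =>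
    div_nonneg (mul_nonneg (Nat.cast_nonneg _) (hE0 l)) (by positivity)
  have hgeom : Summable fun l : ℕ => c * (m ^ l)⁻¹ := by
    simp_rw [← inv_pow]
    exact (summable_geometric_of_lt_one (by positivity) (inv_lt_one_of_one_lt₀ hm1)).mul_left c
  -- `R → W ∑_l m^{-l} E g(Z_l)` almost surely, as `m^{-n} Z_{n-l} = m^{-l} (m^{-(n-l)} Z_{n-l})`
  have hRlim : ∀ᵐ ω ∂P, Tendsto (fun n => R n ω) atTop
      (𝓝 (gwLimit N m ω * ∑' l : ℕ, (m ^ l)⁻¹ * E l)) := by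
    filter_upwards [hB.ae_tendsto_gwLimit hp] with ω hω
    obtain ⟨B, hB'⟩ := hω.bddAbove_range
    have hB1 : ∀ k : ℕ, (gwSize N k ω : ℝ) / m ^ k ≤ B := fun k => hB' ⟨k, rfl⟩
    have e : ∀ n, R n ω = ∑ l ∈ Finset.range n,
        (gwSize N (n - l) ω : ℝ) / m ^ (n - l) * ((m ^ l)⁻¹ * E l) := by
      intro n
      refine Finset.sum_congr rfl fun l hl => ?_
      have : m ^ n = m ^ (n - l) * m ^ l := by
        rw [← pow_add, Nat.sub_add_cancel (Finset.mem_range.1 hl).le]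
      rw [this]
      field_simp
    simp_rw [e]
    rw [← tsum_mul_left]
    refine tendsto_sum_range_of_dominated (hgeom.mul_left B) (fun l => ?_) ?_
    · exact (hω.comp (tendsto_sub_atTop_nat l)).mul_const _
    · refine Eventually.of_forall fun n l _ => ?_
      have h1 := hB1 (n - l)
      have h2 : 0 ≤ (gwSize N (n - l) ω : ℝ) / m ^ (n - l) := by positivity
      have h3 : (m ^ l)⁻¹ * E l ≤ c * (m ^ l)⁻¹ := by
        rw [mul_comm]
        exact mul_le_mul_of_nonneg_right (hEc l) (by positivity)
      have h4 : 0 ≤ (m ^ l)⁻¹ * E l := mul_nonneg (by positivity) (hE0 l)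
      rw [abs_of_nonneg (mul_nonneg h2 h4)]
      exact mul_le_mul h1 h3 h4 (h2.trans h1)
  -- `S - R` tends to zero in mean: replacing `gs n` by `g` costs `∑_l m^{-l} e n l`, and averaging
  -- the functionals of the subtrees costs `∑_l c m^{(n-l)/2} / m^n`
  let e : ℕ → ℕ → ℝ := fun n l => ∫ ω, |gs n (gwSize N l ω) - g (gwSize N l ω)| ∂P
  have hdiff : ∀ n, (∀ j, gs n j ≤ c) → ∀ j, |gs n j - g j| ≤ c := by
    intro n hn j
    rw [abs_le]
    constructor <;> linarith [hgs0 n j, hn j, hg0 j, hgc j]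
  have he0 : ∀ n l, 0 ≤ e n l := fun n l => integral_nonneg fun ω => abs_nonneg _
  have hec : ∀ᶠ n in atTop, ∀ l, e n l ≤ c := by
    filter_upwards [hgsc] with n hn l
    have := integral_mono_of_nonneg (μ := P)
      (f := fun ω => |gs n (gwSize N l ω) - g (gwSize N l ω)|) (g := fun _ => c)
      (Eventually.of_forall fun ω => abs_nonneg _) (integrable_const c)
      (Eventually.of_forall fun ω => hdiff n hn _)
    simpa using this
  have helim : ∀ l, Tendsto (fun n => e n l) atTop (𝓝 0) := by
    intro l
    have h0 : (0 : ℝ) = ∫ ω, (0 : ℝ) ∂P := by simp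
    rw [h0]
    refine tendsto_integral_filter_of_dominated_convergence (fun _ => c) ?_ ?_
      (integrable_const c) ?_
    · exact Eventually.of_forall fun n => ((hgsm n l).sub (hgm l)).abs.aestronglyMeasurable
    · filter_upwards [hgsc] with n hn
      refine Eventually.of_forall fun ω => ?_
      rw [Real.norm_eq_abs, abs_abs]
      exact hdiff n hn _
    · refine Eventually.of_forall fun ω => ?_
      have := ((hlim (gwSize N l ω)).sub_const (g (gwSize N l ω))).abs
      simpa using this
  let err : ℕ → ℝ := fun n =>
    ∑ l ∈ Finset.range n, ((m ^ l)⁻¹ * e n l + c * √(m ^ (n - l)) / m ^ n)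
  have hSR : ∀ᶠ n in atTop, ∫⁻ ω, ENNReal.ofReal |S n ω - R n ω| ∂P ≤ ENNReal.ofReal (err n) := by
    filter_upwards [hgsc] with n hn
    have hpt : ∀ ω, ENNReal.ofReal |S n ω - R n ω| ≤ ∑ l ∈ Finset.range n,
        (ENNReal.ofReal (m ^ n)⁻¹ * ∑ y ∈ treeGen N ω (n - l),
            ENNReal.ofReal |gs n (gwSize (subtree N y) l ω) - g (gwSize (subtree N y) l ω)| +
          ENNReal.ofReal (m ^ n)⁻¹ * ENNReal.ofReal
            |∑ y ∈ treeGen N ω (n - l), g (gwSize (subtree N y) l ω) -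
              gwSize N (n - l) ω * E l|) := by
      intro ω
      have hmn : 0 ≤ (m ^ n)⁻¹ := by positivity
      simp_rw [← ENNReal.ofReal_sum_of_nonneg fun i _ => abs_nonneg _, ← ENNReal.ofReal_mul hmn]
      have h0 : ∀ l ∈ Finset.range n, 0 ≤ (m ^ n)⁻¹ * ∑ y ∈ treeGen N ω (n - l),
          |gs n (gwSize (subtree N y) l ω) - g (gwSize (subtree N y) l ω)| := fun l _ =>
        mul_nonneg hmn (Finset.sum_nonneg fun i _ => abs_nonneg _)
      have h1 : ∀ l ∈ Finset.range n, 0 ≤ (m ^ n)⁻¹ *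
          |∑ y ∈ treeGen N ω (n - l), g (gwSize (subtree N y) l ω) - gwSize N (n - l) ω * E l| :=
        fun l _ => mul_nonneg hmn (abs_nonneg _)
      rw [Finset.sum_congr rfl fun l hl => (ENNReal.ofReal_add (h0 l hl) (h1 l hl)).symm,
        ← ENNReal.ofReal_sum_of_nonneg fun l hl => add_nonneg (h0 l hl) (h1 l hl)]
      refine ENNReal.ofReal_le_ofReal ?_
      simp only [hS, clusterSum, R]
      rw [← Finset.sum_sub_distrib]
      refine (Finset.abs_sum_le_sum_abs _ _).trans (Finset.sum_le_sum fun l hl => ?_)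
      rw [← Finset.sum_div, ← sub_div, abs_div, abs_of_pos (by positivity : 0 < m ^ n),
        div_eq_inv_mul, ← mul_add]
      refine mul_le_mul_of_nonneg_left ?_ hmn
      have h2 : ∑ y ∈ treeGen N ω (n - l), gs n (gwSize (subtree N y) l ω) -
          gwSize N (n - l) ω * E l = ∑ y ∈ treeGen N ω (n - l),
            (gs n (gwSize (subtree N y) l ω) - g (gwSize (subtree N y) l ω)) +
          (∑ y ∈ treeGen N ω (n - l), g (gwSize (subtree N y) l ω) -
            gwSize N (n - l) ω * E l) := by
        rw [Finset.sum_sub_distrib]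
        ring
      rw [h2]
      exact (abs_add_le _ _).trans (by gcongr; exact Finset.abs_sum_le_sum_abs _ _)
    have hmeas1 : ∀ l, Measurable fun ω => ∑ y ∈ treeGen N ω (n - l),
        ENNReal.ofReal |gs n (gwSize (subtree N y) l ω) - g (gwSize (subtree N y) l ω)| := by
      intro l
      simp_rw [← ENNReal.ofReal_sum_of_nonneg fun i _ => abs_nonneg _]
      refine (hB.measurable_sum_treeGen (n - l) fun y => ?_).ennreal_ofReal
      exact (measurable_of_countable fun j => |gs n j - g j|).comp
        (hB.measurable_gwSize_subtree y l)
    have hmeas2 : ∀ l, Measurable fun ω => ENNReal.ofReal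
        |∑ y ∈ treeGen N ω (n - l), g (gwSize (subtree N y) l ω) - gwSize N (n - l) ω * E l| := by
      intro l
      refine (Measurable.sub (hB.measurable_sum_treeGen (n - l) fun y => ?_) ?_).abs.ennreal_ofReal
      · exact (measurable_of_countable g).comp (hB.measurable_gwSize_subtree y l)
      · exact (measurable_of_countable fun j : ℕ => (j : ℝ) * E l).comp (hB.measurable_gwSize _)
    refine (lintegral_mono hpt).trans ?_
    rw [lintegral_finsetSum]
    swap
    · exact fun l _ => ((hmeas1 l).const_mul _).add ((hmeas2 l).const_mul _)
    rw [ENNReal.ofReal_sum_of_nonneg fun l _ => add_nonneg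
      (mul_nonneg (by positivity) (he0 n l)) (by positivity)]
    refine Finset.sum_le_sum fun l hl => ?_
    have hln := (Finset.mem_range.1 hl).le
    rw [lintegral_add_left ((hmeas1 l).const_mul _), lintegral_const_mul _ (hmeas1 l),
      lintegral_const_mul _ (hmeas2 l), hB.lintegral_sum_subtree hp (n - l) l
        (fun j => ENNReal.ofReal |gs n j - g j|),
      ENNReal.ofReal_add (mul_nonneg (by positivity) (he0 n l)) (by positivity)]
    refine add_le_add (le_of_eq ?_) ?_
    · have h1 : Integrable (fun ω => |gs n (gwSize N l ω) - g (gwSize N l ω)|) P :=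
        Integrable.of_bound ((hgsm n l).sub (hgm l)).abs.aestronglyMeasurable c
          (Eventually.of_forall fun ω => by
            rw [Real.norm_eq_abs, abs_abs]; exact hdiff n hn _)
      rw [← ofReal_integral_eq_lintegral_ofReal h1 (Eventually.of_forall fun ω => abs_nonneg _),
        ← ENNReal.ofReal_mul (by positivity), ← ENNReal.ofReal_mul (by positivity)]
      congr 1
      have : m ^ n = m ^ (n - l) * m ^ l := by rw [← pow_add, Nat.sub_add_cancel hln]
      have hx : (m ^ (n - l) * m ^ l)⁻¹ * m ^ (n - l) = (m ^ l)⁻¹ := by field_simp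
      rw [← mul_assoc, this, hx]
    · refine (mul_le_mul_right (hB.lintegral_abs_sum_subtree_le hp (n - l) l hc hg0 hgc) _).trans ?_
      rw [← ENNReal.ofReal_mul (by positivity)]
      refine ENNReal.ofReal_le_ofReal (le_of_eq ?_)
      rw [div_eq_inv_mul]
  have herr : Tendsto err atTop (𝓝 0) := by
    have h1 : Tendsto (fun n => ∑ l ∈ Finset.range n, (m ^ l)⁻¹ * e n l) atTop (𝓝 0) := by
      have := tendsto_sum_range_of_dominated (f := fun n l => (m ^ l)⁻¹ * e n l)
        (h := fun _ => 0) hgeom (fun l => by simpa using (helim l).const_mul (m ^ l)⁻¹) (by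
          filter_upwards [hec] with n hn l _
          rw [abs_of_nonneg (mul_nonneg (by positivity) (he0 n l)), mul_comm]
          exact mul_le_mul_of_nonneg_right (hn l) (by positivity))
      simpa using this
    have hr1 : 1 < √m := by
      rw [Real.lt_sqrt (by norm_num)]
      simpa using hm1
    have h2 : Tendsto (fun n : ℕ => c * ((n : ℝ) * (√m)⁻¹ ^ n)) atTop (𝓝 (c * 0)) := by
      refine Tendsto.const_mul c ?_
      have := tendsto_self_mul_const_pow_of_lt_one (r := (√m)⁻¹) (by positivity)
        (inv_lt_one_of_one_lt₀ hr1)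
      exact this
    have h3 := h1.add h2
    rw [mul_zero, add_zero] at h3
    refine squeeze_zero (fun n => Finset.sum_nonneg fun l _ => add_nonneg
      (mul_nonneg (by positivity) (he0 n l)) (by positivity)) (fun n => ?_) h3
    simp only [err]
    rw [Finset.sum_add_distrib]
    refine add_le_add le_rfl ?_
    calc ∑ l ∈ Finset.range n, c * √(m ^ (n - l)) / m ^ n
        ≤ ∑ l ∈ Finset.range n, c * (√m)⁻¹ ^ n := by
          refine Finset.sum_le_sum fun l _ => ?_
          have h4 : √(m ^ (n - l)) ≤ √m ^ n := by
            refine Real.sqrt_le_iff.2 ⟨by positivity, ?_⟩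
            rw [sq, ← mul_pow, Real.mul_self_sqrt hm0.le]
            exact pow_le_pow_right₀ hm1.le (Nat.sub_le _ _)
          rw [mul_div_assoc]
          refine mul_le_mul_of_nonneg_left ?_ hc.le
          rw [div_le_iff₀ (by positivity), inv_pow]
          have h5 : m ^ n = √m ^ n * √m ^ n := by rw [← mul_pow, Real.mul_self_sqrt hm0.le]
          rw [h5, inv_mul_cancel_left₀ (by positivity)]
          exact h4
      _ = c * ((n : ℝ) * (√m)⁻¹ ^ n) := by
          rw [Finset.sum_const, Finset.card_range, nsmul_eq_mul]
          ring
  have hRint : Tendsto (fun n => ∫ ω, Real.exp (-R n ω) ∂P) atTop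
      (𝓝 (∫ ω, Real.exp (-(gwLimit N m ω * ∑' l : ℕ, (m ^ l)⁻¹ * E l)) ∂P)) := by
    refine tendsto_integral_of_dominated_convergence (fun _ => 1)
      (fun n => (Real.measurable_exp.comp (hRm n).neg).aestronglyMeasurable) (integrable_const 1)
      (fun n => Eventually.of_forall fun ω => ?_) ?_
    · rw [Real.norm_eq_abs, Real.abs_exp]
      exact Real.exp_le_one_iff.2 (neg_nonpos.2 (hR0 n ω))
    · filter_upwards [hRlim] with ω hω
      exact (Real.continuous_exp.tendsto _).comp hω.neg
  have hiS : ∀ n, Integrable (fun ω => Real.exp (-S n ω)) P := fun n =>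
    Integrable.of_bound (Real.measurable_exp.comp (hSm n).neg).aestronglyMeasurable 1
      (Eventually.of_forall fun ω => by
        rw [Real.norm_eq_abs, Real.abs_exp]
        exact Real.exp_le_one_iff.2 (neg_nonpos.2 (hS0 n ω)))
  have hiR : ∀ n, Integrable (fun ω => Real.exp (-R n ω)) P := fun n =>
    Integrable.of_bound (Real.measurable_exp.comp (hRm n).neg).aestronglyMeasurable 1
      (Eventually.of_forall fun ω => by
        rw [Real.norm_eq_abs, Real.abs_exp]
        exact Real.exp_le_one_iff.2 (neg_nonpos.2 (hR0 n ω)))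
  have hz : Tendsto (fun n => ∫ ω, Real.exp (-S n ω) ∂P - ∫ ω, Real.exp (-R n ω) ∂P) atTop
      (𝓝 0) := by
    refine squeeze_zero_norm' ?_ herr
    filter_upwards [hSR] with n hn
    rw [← integral_sub (hiS n) (hiR n)]
    refine (norm_integral_le_integral_norm _).trans ?_
    have hi : Integrable (fun ω => ‖Real.exp (-S n ω) - Real.exp (-R n ω)‖) P :=
      ((hiS n).sub (hiR n)).norm
    rw [integral_eq_lintegral_of_nonneg_ae (Eventually.of_forall fun ω => norm_nonneg _)
      hi.aestronglyMeasurable]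
    refine ENNReal.toReal_le_of_le_ofReal (Finset.sum_nonneg fun l _ => add_nonneg
      (mul_nonneg (by positivity) (he0 n l)) (by positivity)) (le_trans ?_ hn)
    refine lintegral_mono fun ω => ENNReal.ofReal_le_ofReal ?_
    exact abs_exp_neg_sub_exp_neg_le (hS0 n ω) (hR0 n ω)
  have := hz.add hRint
  simpa using this

end ClusterSum

/-! ### The exponent `L` of the displacement tail -/

section Tail

variable {ν : Measure ℝ} [IsProbabilityMeasure ν] {a L : ℝ → ℝ}

lemma tendsto_real_Ioi_atTop (ν : Measure ℝ) [IsProbabilityMeasure ν] :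
    Tendsto (fun t => ν.real (Set.Ioi t)) atTop (𝓝 0) := by
  have h : Tendsto (fun t => 1 - cdf ν t) atTop (𝓝 (1 - 1)) := (tendsto_cdf_atTop ν).const_sub 1
  rw [sub_self] at h
  refine h.congr fun t => ?_
  rw [cdf_eq_real, ← probReal_compl_eq_one_sub measurableSet_Iic, Set.compl_Iic]

omit [IsProbabilityMeasure ν] in
lemma SuplogAssumption.differentiable (h : SuplogAssumption ν a L) : Differentiable ℝ L :=
  h.contDiff.differentiable two_ne_zero

omit [IsProbabilityMeasure ν] in
lemma SuplogAssumption.differentiable_deriv (h : SuplogAssumption ν a L) :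
    Differentiable ℝ (deriv L) := by
  have : ContDiff ℝ (1 + 1) L := by simpa [one_add_one_eq_two] using h.contDiff
  exact (contDiff_succ_iff_deriv.1 this).2.2.differentiable one_ne_zero

lemma SuplogAssumption.tendsto_exp_neg (h : SuplogAssumption ν a L) :
    Tendsto (fun t => Real.exp (-L t)) atTop (𝓝 0) := by
  obtain ⟨a₀, ha₀, hlim⟩ := h.prefactor
  have h1 := (tendsto_real_Ioi_atTop ν).div hlim ha₀.ne'
  rw [zero_div] at h1
  refine h1.congr' ?_
  filter_upwards [hlim.eventually (lt_mem_nhds ha₀)] with t ht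
  simp only [Pi.div_apply]
  rw [h.tail, mul_div_cancel_left₀ _ ht.ne']

lemma SuplogAssumption.tendsto_atTop (h : SuplogAssumption ν a L) : Tendsto L atTop atTop := by
  have := Real.tendsto_exp_comp_nhds_zero.1 h.tendsto_exp_neg
  exact tendsto_neg_atBot_iff.1 this

/-- `L' > 0` and `x L'(x) ≤ δ L(x)` eventually, for every `δ > 0`. -/
lemma SuplogAssumption.eventually_deriv (h : SuplogAssumption ν a L) {δ : ℝ} (hδ : 0 < δ) :
    ∀ᶠ x in atTop, 0 < deriv L x ∧ x * deriv L x ≤ δ * L x := by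
  have h1 : Tendsto (fun x => √(Real.log (Real.log (L x)))) atTop atTop :=
    Real.tendsto_sqrt_atTop.comp (Real.tendsto_log_atTop.comp
      (Real.tendsto_log_atTop.comp h.tendsto_atTop))
  filter_upwards [h.growth.eventually_ge_atTop (1 / δ), h1.eventually_ge_atTop 1,
    eventually_gt_atTop 0, h.tendsto_atTop.eventually_gt_atTop 0] with x hx hs hx0 hL
  have hq : 0 < L x / (x * deriv L x * √(Real.log (Real.log (L x)))) :=
    lt_of_lt_of_le (by positivity) hx
  have hden : 0 < x * deriv L x * √(Real.log (Real.log (L x))) := by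
    by_contra hcon
    exact absurd hq (not_lt.2 (div_nonpos_of_nonneg_of_nonpos hL.le (not_lt.1 hcon)))
  have hxd : 0 < x * deriv L x := by
    by_contra hcon
    exact absurd hden (not_lt.2 (mul_nonpos_of_nonpos_of_nonneg (not_lt.1 hcon)
      (zero_le_one.trans hs)))
  refine ⟨pos_of_mul_pos_right hxd hx0.le, ?_⟩
  rw [le_div_iff₀ hden] at hx
  have h2 : x * deriv L x ≤ x * deriv L x * √(Real.log (Real.log (L x))) :=
    le_mul_of_one_le_right hxd.le hs
  calc x * deriv L x ≤ x * deriv L x * √(Real.log (Real.log (L x))) := h2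
    _ = δ * (1 / δ * (x * deriv L x * √(Real.log (Real.log (L x))))) := by field_simp
    _ ≤ δ * L x := by gcongr

/-- A Potter bound: `x ^ (-δ) * L x` is eventually nonincreasing, for every `δ > 0`. -/
lemma SuplogAssumption.exists_antitoneOn (h : SuplogAssumption ν a L) {δ : ℝ} (hδ : 0 < δ) :
    ∃ x₀ : ℝ, 0 < x₀ ∧ AntitoneOn (fun x => x ^ (-δ) * L x) (Set.Ici x₀) := by
  obtain ⟨x₀, hx₀⟩ := eventually_atTop.1 ((h.eventually_deriv hδ).and (eventually_gt_atTop 0))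
  refine ⟨max x₀ 1, by positivity, ?_⟩
  have hder : ∀ x, 0 < x → HasDerivAt (fun x => x ^ (-δ) * L x)
      ((-δ) * x ^ (-δ - 1) * L x + x ^ (-δ) * deriv L x) x := fun x hx =>
    (Real.hasDerivAt_rpow_const (Or.inl hx.ne')).mul (h.differentiable x).hasDerivAt
  have hpos : ∀ x ∈ Set.Ici (max x₀ 1), 0 < x := fun x hx =>
    (hx₀ x ((le_max_left _ _).trans hx)).2
  refine antitoneOn_of_deriv_nonpos (convex_Ici _)
    (fun x hx => (hder x (hpos x hx)).continuousAt.continuousWithinAt)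
    (fun x hx => (hder x (hpos x (interior_subset hx))).differentiableAt.differentiableWithinAt)
    fun x hx => ?_
  have hx' := interior_subset hx
  have hx0 := hpos x hx'
  rw [(hder x hx0).deriv]
  have h1 := (hx₀ x ((le_max_left _ _).trans hx')).1.2
  have h2 : x ^ (-δ) = x ^ (-δ - 1) * x := by
    rw [Real.rpow_sub_one hx0.ne']
    field_simp
  have h3 : 0 < x ^ (-δ - 1) := Real.rpow_pos_of_pos hx0 _
  rw [h2]
  nlinarith

/-- `L` grows more slowly than every power. -/
lemma SuplogAssumption.eventually_le_rpow (h : SuplogAssumption ν a L) {δ : ℝ} (hδ : 0 < δ) :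
    ∀ᶠ x in atTop, L x ≤ x ^ δ := by
  obtain ⟨x₀, hx₀, hanti⟩ := h.exists_antitoneOn (half_pos hδ)
  have h1 : Tendsto (fun x : ℝ => x ^ (δ / 2)) atTop atTop := tendsto_rpow_atTop (half_pos hδ)
  filter_upwards [eventually_ge_atTop x₀, h1.eventually_ge_atTop (x₀ ^ (-(δ / 2)) * L x₀)]
    with x hx hx2
  have h2 := hanti (Set.mem_Ici.2 le_rfl) (Set.mem_Ici.2 hx) hx
  simp only at h2
  have hx0 : 0 < x := hx₀.trans_le hx
  have h3 : 0 < x ^ (δ / 2) := Real.rpow_pos_of_pos hx0 _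
  calc L x = x ^ (δ / 2) * (x ^ (-(δ / 2)) * L x) := by
        rw [← mul_assoc, ← Real.rpow_add hx0]
        simp
    _ ≤ x ^ (δ / 2) * x ^ (δ / 2) := by gcongr; exact h2.trans hx2
    _ = x ^ δ := by rw [← Real.rpow_add hx0]; simp

/-- A function whose derivative tends to zero moves slowly on long intervals. -/
lemma eventually_abs_sub_le {f : ℝ → ℝ} (hd : ∀ᶠ x in atTop, DifferentiableAt ℝ f x)
    (hf : Tendsto (deriv f) atTop (𝓝 0)) {ε : ℝ} (hε : 0 < ε) :
    ∃ x₀, ∀ x ≥ x₀, ∀ y ≥ x₀, |f y - f x| ≤ ε * |y - x| := by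
  have h1 : ∀ᶠ x in atTop, |deriv f x| < ε := by
    have := hf.eventually (Metric.ball_mem_nhds 0 hε)
    simpa using this
  obtain ⟨x₀, hx₀⟩ := eventually_atTop.1 (hd.and h1)
  exact ⟨x₀, fun x hx y hy => Convex.norm_image_sub_le_of_norm_deriv_le (s := Set.Ici x₀)
    (fun z hz => (hx₀ z hz).1) (fun z hz => (hx₀ z hz).2.le) (convex_Ici _) hx hy⟩

lemma SuplogAssumption.differentiableAt_inv (h : SuplogAssumption ν a L) :
    ∀ᶠ x in atTop, DifferentiableAt ℝ (fun x => 1 / deriv L x) x := by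
  filter_upwards [h.eventually_deriv one_pos] with x hx
  exact (differentiableAt_const _).div (h.differentiable_deriv x) hx.1.ne'

/-- The von Mises condition: `(1 / L')' = -L'' / L'^2 → 0`. -/
lemma SuplogAssumption.tendsto_deriv_inv (h : SuplogAssumption ν a L) :
    Tendsto (deriv fun x => 1 / deriv L x) atTop (𝓝 0) := by
  have h1 := h.vonMises.neg
  rw [neg_zero] at h1
  refine h1.congr' ?_
  filter_upwards [h.eventually_deriv one_pos] with x hx
  have h2 := (h.differentiable_deriv x).hasDerivAt.inv hx.1.ne'
  have h3 : (fun x => 1 / deriv L x) = (deriv L)⁻¹ := by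
    funext y; simp
  rw [h3, h2.deriv, neg_div]

/-- `1 / L'(x) = o(x)`. -/
lemma SuplogAssumption.eventually_inv_le (h : SuplogAssumption ν a L) {ε : ℝ} (hε : 0 < ε) :
    ∀ᶠ x in atTop, 1 / deriv L x ≤ ε * x := by
  obtain ⟨x₀, hx₀⟩ := eventually_abs_sub_le h.differentiableAt_inv h.tendsto_deriv_inv (half_pos hε)
  have h1 : Tendsto (fun x : ℝ => ε / 2 * x) atTop atTop :=
    tendsto_id.const_mul_atTop (half_pos hε)
  filter_upwards [eventually_ge_atTop x₀, eventually_ge_atTop 0,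
    h1.eventually_ge_atTop (1 / deriv L x₀ - ε / 2 * x₀)] with x hx hx0 hx2
  have h2 := (le_abs_self _).trans (hx₀ x₀ le_rfl x hx)
  rw [abs_of_nonneg (by linarith)] at h2
  linarith

/-- `L` grows faster than every multiple of the logarithm. -/
lemma SuplogAssumption.eventually_log_le (h : SuplogAssumption ν a L) {K : ℝ} (hK : 0 < K) :
    ∀ᶠ x in atTop, K * Real.log x ≤ L x := by
  obtain ⟨x₀, hx₀⟩ := eventually_atTop.1 (((h.eventually_inv_le (ε := 1 / (K + 1))
    (by positivity)).and (h.eventually_deriv one_pos)).and (eventually_gt_atTop 0))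
  have hmono : MonotoneOn (fun x => L x - (K + 1) * Real.log x) (Set.Ici x₀) := by
    have hder : ∀ x ∈ Set.Ici x₀, HasDerivAt (fun x => L x - (K + 1) * Real.log x)
        (deriv L x - (K + 1) * x⁻¹) x := fun x hx =>
      (h.differentiable x).hasDerivAt.sub
        ((Real.hasDerivAt_log (hx₀ x hx).2.ne').const_mul (K + 1))
    refine monotoneOn_of_deriv_nonneg (convex_Ici _)
      (fun x hx => (hder x hx).continuousAt.continuousWithinAt)
      (fun x hx => (hder x (interior_subset hx)).differentiableAt.differentiableWithinAt)
      fun x hx => ?_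
    have hx' := interior_subset hx
    rw [(hder x hx').deriv]
    obtain ⟨⟨h1, h2, -⟩, h3⟩ := hx₀ x hx'
    rw [div_le_iff₀ h2] at h1
    rw [sub_nonneg, ← div_eq_mul_inv, div_le_iff₀ h3]
    have h4 : 1 / (K + 1) * x * deriv L x = x * deriv L x / (K + 1) := by ring
    rw [h4, le_div_iff₀ (by positivity), one_mul] at h1
    linarith
  filter_upwards [eventually_ge_atTop x₀,
    Real.tendsto_log_atTop.eventually_ge_atTop (-(L x₀ - (K + 1) * Real.log x₀))] with x hx hx2
  have := hmono (Set.mem_Ici.2 le_rfl) (Set.mem_Ici.2 hx) hx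
  simp only at this
  linarith

lemma SuplogAssumption.exists_strictMonoOn (h : SuplogAssumption ν a L) :
    ∃ x₀ : ℝ, 0 < x₀ ∧ StrictMonoOn L (Set.Ici x₀) := by
  obtain ⟨x₀, hx₀⟩ := eventually_atTop.1 (h.eventually_deriv one_pos)
  refine ⟨max x₀ 1, by positivity, strictMonoOn_of_deriv_pos (convex_Ici _)
    h.differentiable.continuous.continuousOn fun x hx => ?_⟩
  exact (hx₀ x ((le_max_left _ _).trans (interior_subset hx))).1

lemma SuplogAssumption.tendsto_shift_atTop (h : SuplogAssumption ν a L) (t : ℝ) :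
    Tendsto (fun x => x + t * (1 / deriv L x)) atTop atTop := by
  refine tendsto_atTop_mono' _ ?_ (tendsto_id.const_mul_atTop (half_pos one_pos))
  filter_upwards [h.eventually_inv_le (ε := 1 / (2 * (|t| + 1))) (by positivity),
    h.eventually_deriv one_pos, eventually_gt_atTop 0] with x h1 h2 hx
  have h3 : 0 < 1 / deriv L x := one_div_pos.2 h2.1
  have h4 : |t| * (1 / deriv L x) ≤ 1 / 2 * x := by
    calc |t| * (1 / deriv L x) ≤ (|t| + 1) * (1 / (2 * (|t| + 1)) * x) := by
          gcongr
          linarith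
      _ = 1 / 2 * x := by field_simp
  have h5 : -|t| * (1 / deriv L x) ≤ t * (1 / deriv L x) :=
    mul_le_mul_of_nonneg_right (neg_abs_le t) h3.le
  simp only [id]
  linarith

/-- The tail is of Gumbel type: `L(x + t / L'(x)) - L(x) → t`. -/
lemma SuplogAssumption.tendsto_shift_sub (h : SuplogAssumption ν a L) (t : ℝ) :
    Tendsto (fun x => L (x + t * (1 / deriv L x)) - L x) atTop (𝓝 t) := by
  rcases eq_or_ne t 0 with rfl | ht
  · simp
  have ht' : 0 < |t| := abs_pos.2 ht
  -- By the mean value theorem the increment is `t L'(z) / L'(x)` with `z` between `x` and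
  -- `x + t / L'(x)`, and `1 / L'` changes little on this segment.
  have key : ∀ ε : ℝ, 0 < ε → ε < 1 → ∀ᶠ x in atTop,
      ∃ r : ℝ, |r - 1| ≤ ε ∧ L (x + t * (1 / deriv L x)) - L x = t / r := by
    intro ε hε hε1
    obtain ⟨x₀, hx₀⟩ := eventually_abs_sub_le h.differentiableAt_inv h.tendsto_deriv_inv
      (div_pos hε ht')
    obtain ⟨x₁, hx₁⟩ := eventually_atTop.1 (h.eventually_deriv one_pos)
    filter_upwards [eventually_ge_atTop (max x₀ x₁),
      (h.tendsto_shift_atTop t).eventually_ge_atTop (max x₀ x₁)] with x hx hxt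
    have hLx := (hx₁ x ((le_max_right _ _).trans hx)).1
    have hu : 0 < 1 / deriv L x := one_div_pos.2 hLx
    obtain ⟨z, hz, hzeq⟩ : ∃ z, (min x (x + t * (1 / deriv L x)) ≤ z ∧
        |z - x| ≤ |t| * (1 / deriv L x)) ∧
        L (x + t * (1 / deriv L x)) - L x = deriv L z * (t * (1 / deriv L x)) := by
      rcases lt_or_gt_of_ne ht with hneg | hpos
      · have hlt : x + t * (1 / deriv L x) < x := by
          have := mul_neg_of_neg_of_pos hneg hu
          linarith
        obtain ⟨z, hz, he⟩ := exists_deriv_eq_slope L hlt h.differentiable.continuous.continuousOn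
          h.differentiable.differentiableOn
        refine ⟨z, ⟨(min_le_right _ _).trans hz.1.le, ?_⟩, ?_⟩
        · rw [abs_of_neg (by linarith [hz.2]), abs_of_neg hneg]
          linarith [hz.1]
        · rw [he]
          have : x - (x + t * (1 / deriv L x)) ≠ 0 := by linarith
          rw [eq_comm, div_mul_eq_mul_div, div_eq_iff this]
          ring
      · have hlt : x < x + t * (1 / deriv L x) := by
          have := mul_pos hpos hu
          linarith
        obtain ⟨z, hz, he⟩ := exists_deriv_eq_slope L hlt h.differentiable.continuous.continuousOn
          h.differentiable.differentiableOn
        refine ⟨z, ⟨(min_le_left _ _).trans hz.1.le, ?_⟩, ?_⟩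
        · rw [abs_of_pos (by linarith [hz.1]), abs_of_pos hpos]
          linarith [hz.2]
        · rw [he]
          have : (x + t * (1 / deriv L x)) - x ≠ 0 := by linarith
          rw [eq_comm, div_mul_eq_mul_div, div_eq_iff this]
          ring
    have hzge : max x₀ x₁ ≤ z := (le_min hx hxt).trans hz.1
    have hLz := (hx₁ z ((le_max_right _ _).trans hzge)).1
    refine ⟨deriv L x / deriv L z, ?_, ?_⟩
    · have h1 := hx₀ x ((le_max_left _ _).trans hx) z ((le_max_left _ _).trans hzge)
      have h2 : |1 / deriv L z - 1 / deriv L x| ≤ ε * (1 / deriv L x) := by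
        refine h1.trans ?_
        calc ε / |t| * |z - x| ≤ ε / |t| * (|t| * (1 / deriv L x)) := by gcongr; exact hz.2
          _ = ε * (1 / deriv L x) := by field_simp
      have h3 : deriv L x / deriv L z - 1 = deriv L x * (1 / deriv L z - 1 / deriv L x) := by
        field_simp
      rw [h3, abs_mul, abs_of_pos hLx]
      calc deriv L x * |1 / deriv L z - 1 / deriv L x|
          ≤ deriv L x * (ε * (1 / deriv L x)) := by gcongr
        _ = ε := by field_simp
    · rw [hzeq]
      field_simp
  rw [Metric.tendsto_nhds]
  intro η hη
  have hη' : 0 < min (1 / 2) (η / (4 * |t|)) := by positivity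
  filter_upwards [key (min (1 / 2) (η / (4 * |t|))) hη'
    ((min_le_left _ _).trans_lt (by norm_num))] with x hx
  obtain ⟨r, hr, he⟩ := hx
  have hr1 := abs_le.1 (hr.trans (min_le_left _ _))
  have hr2 := hr.trans (min_le_right _ _)
  have hr0 : 0 < r := by linarith [hr1.1]
  rw [he, Real.dist_eq]
  have h1 : t / r - t = t * (1 - r) / r := by field_simp
  rw [h1, abs_div, abs_mul, abs_of_pos hr0, div_lt_iff₀ hr0, abs_sub_comm]
  calc |t| * |r - 1| ≤ |t| * (η / (4 * |t|)) := by gcongr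
    _ = η / 4 := by field_simp
    _ < η * r := by nlinarith [hr1.1]

/-! ### The centring and scaling sequences -/

omit [IsProbabilityMeasure ν] in
lemma bddBelow_centring_set (m : ℝ) (n : ℕ) :
    BddBelow {t : ℝ | 0 ≤ t ∧ ν.real (Set.Ioi t) ≤ (m ^ n)⁻¹} :=
  ⟨0, fun _ ht => ht.1⟩

lemma real_Ioi_le_of_centring_lt {m : ℝ} (hm : 1 < m) {n : ℕ} {t : ℝ}
    (ht : centring ν m n < t) : ν.real (Set.Ioi t) ≤ (m ^ n)⁻¹ := by
  have hne : {t : ℝ | 0 ≤ t ∧ ν.real (Set.Ioi t) ≤ (m ^ n)⁻¹}.Nonempty := by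
    have h1 : 0 < (m ^ n)⁻¹ := by positivity
    obtain ⟨t, h2, h3⟩ := (((tendsto_real_Ioi_atTop ν).eventually (gt_mem_nhds h1)).and
      (eventually_ge_atTop 0)).exists
    exact ⟨t, h3, h2.le⟩
  obtain ⟨s, hs, hst⟩ := exists_lt_of_csInf_lt hne ht
  exact (measureReal_mono (Set.Ioi_subset_Ioi hst.le)).trans hs.2

omit [IsProbabilityMeasure ν] in
lemma lt_real_Ioi_of_lt_centring {m : ℝ} {n : ℕ} {t : ℝ} (ht0 : 0 ≤ t)
    (ht : t < centring ν m n) : (m ^ n)⁻¹ < ν.real (Set.Ioi t) := by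
  by_contra hcon
  exact absurd ht (not_lt.2 (csInf_le (bddBelow_centring_set m n)
    ⟨ht0, not_lt.1 hcon⟩))

lemma SuplogAssumption.tendsto_centring (h : SuplogAssumption ν a L) {m : ℝ} (hm : 1 < m) :
    Tendsto (centring ν m) atTop atTop := by
  obtain ⟨a₀, ha₀, hlim⟩ := h.prefactor
  rw [Filter.tendsto_atTop]
  intro M
  obtain ⟨t, hta, htM⟩ := ((hlim.eventually (lt_mem_nhds ha₀)).and (eventually_ge_atTop M)).exists
  have hpos : 0 < ν.real (Set.Ioi t) := by
    rw [h.tail]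
    positivity
  have h1 : Tendsto (fun n : ℕ => (m ^ n)⁻¹) atTop (𝓝 0) :=
    tendsto_inv_atTop_zero.comp (tendsto_pow_atTop_atTop_of_one_lt hm)
  filter_upwards [h1.eventually (gt_mem_nhds hpos)] with n hn
  refine htM.trans ?_
  by_contra hcon
  exact absurd (real_Ioi_le_of_centring_lt hm (not_le.1 hcon)) (not_le.2 hn)

/-- `m ^ n e^{-L(b_n)} → 1 / a₀`. The tail need not be continuous, so `P(X > b_n)` itself is not used:
just below `b_n` the tail exceeds `m^{-n}`, just above it is at most `m^{-n}`, and the continuity of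
`L` carries both bounds to `b_n` once the prefactor is close to `a₀`. -/
lemma SuplogAssumption.tendsto_pow_mul_exp (h : SuplogAssumption ν a L) {m : ℝ} (hm : 1 < m)
    {a₀ : ℝ} (ha₀ : 0 < a₀) (hlim : Tendsto a atTop (𝓝 a₀)) :
    Tendsto (fun n => m ^ n * Real.exp (-L (centring ν m n))) atTop (𝓝 a₀⁻¹) := by
  have hmpos : ∀ n : ℕ, 0 < m ^ n := fun n => by positivity
  have hcont : Continuous fun t => Real.exp (-L t) :=
    Real.continuous_exp.comp h.differentiable.continuous.neg
  have key : Tendsto (fun n => a₀ * (m ^ n * Real.exp (-L (centring ν m n)))) atTop (𝓝 1) := by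
    rw [tendsto_order]
    constructor
    · intro c hc
      rcases le_or_gt c 0 with hc0 | hc0
      · exact Eventually.of_forall fun n => hc0.trans_lt (by have := hmpos n; positivity)
      obtain ⟨c', hc1, hc2⟩ := exists_between hc
      have hc'0 : 0 < c' := hc0.trans hc1
      have h1 : ∀ᶠ t in atTop, a t < a₀ / c' :=
        hlim.eventually (gt_mem_nhds ((lt_div_iff₀ hc'0).2 (by nlinarith)))
      obtain ⟨t₀, ht₀⟩ := eventually_atTop.1 (h1.and (eventually_ge_atTop 0))
      filter_upwards [(h.tendsto_centring hm).eventually_gt_atTop t₀] with n hn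
      have h2 : c' ≤ a₀ * (m ^ n * Real.exp (-L (centring ν m n))) := by
        have h3 : ∀ᶠ t in 𝓝[<] (centring ν m n), c' ≤ a₀ * (m ^ n * Real.exp (-L t)) := by
          have h4 : ∀ᶠ t in 𝓝[<] (centring ν m n), t₀ < t :=
            eventually_nhdsWithin_of_eventually_nhds (lt_mem_nhds hn)
          filter_upwards [h4, self_mem_nhdsWithin] with t ht ht'
          have h5 := lt_real_Ioi_of_lt_centring (ht₀ t ht.le).2 ht'
          rw [h.tail, inv_lt_iff_one_lt_mul₀ (hmpos n)] at h5
          have h6 := (ht₀ t ht.le).1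
          rw [lt_div_iff₀ hc'0] at h6
          have h7 : 0 < Real.exp (-L t) * m ^ n := by have := hmpos n; positivity
          nlinarith
        refine ge_of_tendsto ?_ h3
        exact ((hcont.const_mul _).const_mul _).continuousAt.tendsto.mono_left nhdsWithin_le_nhds
      linarith
    · intro c hc
      obtain ⟨c', hc1, hc2⟩ := exists_between hc
      have hc'0 : 0 < c' := one_pos.trans hc1
      have h1 : ∀ᶠ t in atTop, a₀ / c' < a t :=
        hlim.eventually (lt_mem_nhds ((div_lt_iff₀ hc'0).2 (by nlinarith)))
      obtain ⟨t₀, ht₀⟩ := eventually_atTop.1 h1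
      filter_upwards [(h.tendsto_centring hm).eventually_gt_atTop t₀] with n hn
      have h2 : a₀ * (m ^ n * Real.exp (-L (centring ν m n))) ≤ c' := by
        have h3 : ∀ᶠ t in 𝓝[>] (centring ν m n), a₀ * (m ^ n * Real.exp (-L t)) ≤ c' := by
          filter_upwards [self_mem_nhdsWithin] with t ht
          have h5 := real_Ioi_le_of_centring_lt hm ht
          rw [h.tail, le_inv_comm₀ (by
            have := ht₀ t (hn.trans ht).le
            have h0 : 0 < a t := (by positivity : 0 < a₀ / c').trans this
            positivity) (hmpos n), le_inv_comm₀ (hmpos n) (by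
            have := ht₀ t (hn.trans ht).le
            have h0 : 0 < a t := (by positivity : 0 < a₀ / c').trans this
            positivity), le_inv_comm₀ (by
            have := ht₀ t (hn.trans ht).le
            have h0 : 0 < a t := (by positivity : 0 < a₀ / c').trans this
            positivity) (hmpos n)] at h5
          have h6 := ht₀ t (hn.trans ht).le
          rw [div_lt_iff₀ hc'0] at h6
          have h0 : 0 < a t := (by positivity : 0 < a₀ / c').trans (ht₀ t (hn.trans ht).le)
          have h7 : m ^ n * (a t * Real.exp (-L t)) ≤ 1 := by
            calc m ^ n * (a t * Real.exp (-L t))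
                ≤ (a t * Real.exp (-L t))⁻¹ * (a t * Real.exp (-L t)) := by gcongr
              _ = 1 := inv_mul_cancel₀ (by positivity)
          have h8 : 0 < Real.exp (-L t) * m ^ n := by have := hmpos n; positivity
          nlinarith
        refine le_of_tendsto ?_ h3
        exact ((hcont.const_mul _).const_mul _).continuousAt.tendsto.mono_left nhdsWithin_le_nhds
      linarith
  have := key.const_mul a₀⁻¹
  simp_rw [← mul_assoc, inv_mul_cancel₀ ha₀.ne', one_mul, mul_one] at this
  exact this

/-- `m ^ n P(X > b_n + t a_n) → e^{-t}`. -/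
lemma SuplogAssumption.tendsto_pow_mul_tail (h : SuplogAssumption ν a L) {m : ℝ} (hm : 1 < m)
    (t : ℝ) :
    Tendsto (fun n => m ^ n * ν.real (Set.Ioi (centring ν m n + t * scaling ν L m n))) atTop
      (𝓝 (Real.exp (-t))) := by
  obtain ⟨a₀, ha₀, hlim⟩ := h.prefactor
  have hb := h.tendsto_centring hm
  have h1 := h.tendsto_pow_mul_exp hm ha₀ hlim
  have h2 := (h.tendsto_shift_sub t).comp hb
  have h3 := hlim.comp ((h.tendsto_shift_atTop t).comp hb)
  have h4 := (h3.mul h1).mul ((Real.continuous_exp.tendsto _).comp h2.neg)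
  rw [mul_inv_cancel₀ ha₀.ne', one_mul] at h4
  refine h4.congr fun n => ?_
  simp only [Function.comp, scaling]
  rw [h.tail]
  have : Real.exp (-L (centring ν m n + t * (1 / deriv L (centring ν m n)))) =
      Real.exp (-L (centring ν m n)) * Real.exp (-(L (centring ν m n + t * (1 / deriv L (centring ν m n))) - L (centring ν m n))) := by
    rw [← Real.exp_add]
    ring_nf
  rw [this]
  ring

lemma SuplogAssumption.eventually_scaling_pos (h : SuplogAssumption ν a L) {m : ℝ} (hm : 1 < m) :
    ∀ᶠ n in atTop, 0 < scaling ν L m n := by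
  filter_upwards [(h.tendsto_centring hm).eventually (h.eventually_deriv one_pos)] with n hn
  exact one_div_pos.2 hn.1

lemma SuplogAssumption.eventually_scaling_le (h : SuplogAssumption ν a L) {m : ℝ} (hm : 1 < m)
    {ε : ℝ} (hε : 0 < ε) : ∀ᶠ n in atTop, scaling ν L m n ≤ ε * centring ν m n :=
  (h.tendsto_centring hm).eventually (h.eventually_inv_le hε)

/-- `L(b_n)` is asymptotic to `n log m`; half of it is enough as a lower bound. -/
lemma SuplogAssumption.eventually_le_L_centring (h : SuplogAssumption ν a L) {m : ℝ}
    (hm : 1 < m) : ∀ᶠ n : ℕ in atTop, (n : ℝ) * (Real.log m / 2) ≤ L (centring ν m n) := by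
  obtain ⟨a₀, ha₀, hlim⟩ := h.prefactor
  have hlog : 0 < Real.log m := Real.log_pos hm
  have h1 := (h.tendsto_pow_mul_exp hm ha₀ hlim).eventually
    (gt_mem_nhds (lt_add_one a₀⁻¹))
  have h2 : Tendsto (fun n : ℕ => (n : ℝ) * (Real.log m / 2)) atTop atTop :=
    tendsto_natCast_atTop_atTop.atTop_mul_const (by positivity)
  filter_upwards [h1, h2.eventually_ge_atTop (Real.log (a₀⁻¹ + 1))] with n hn hn2
  have h3 : m ^ n = Real.exp (n * Real.log m) := by
    rw [Real.exp_nat_mul, Real.exp_log (by linarith)]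
  rw [h3, ← Real.exp_add] at hn
  have h4 := Real.log_lt_log (Real.exp_pos _) hn
  rw [Real.log_exp] at h4
  linarith

/-- The scaling sequence grows faster than any power of `n`. -/
lemma SuplogAssumption.eventually_pow_le_scaling (h : SuplogAssumption ν a L) {m : ℝ}
    (hm : 1 < m) (K : ℕ) : ∀ᶠ n : ℕ in atTop, (n : ℝ) ^ K ≤ scaling ν L m n := by
  have hb := h.tendsto_centring hm
  have hlog : 0 < Real.log m := Real.log_pos hm
  -- `n ≤ b ^ (2 δ)` and `1 / L'(b) ≥ b / L(b) ≥ b ^ (1 - δ)`, so `2 δ K = 1 - δ` is what is needed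
  set δ : ℝ := 1 / (2 * K + 1) with hδ
  have hδ0 : 0 < δ := by positivity
  have h1 : Tendsto (fun x : ℝ => x ^ δ) atTop atTop := tendsto_rpow_atTop hδ0
  filter_upwards [hb.eventually (h.eventually_le_rpow hδ0), hb.eventually_ge_atTop 1,
    hb.eventually (h1.eventually_ge_atTop (2 / Real.log m)), h.eventually_le_L_centring hm,
    hb.eventually (h.eventually_deriv one_pos)] with n hn1 hn2 hn3 hn4 hn5
  set b := centring ν m n with hbdef
  have hb0 : 0 < b := by linarith
  have hbδ : 0 < b ^ δ := Real.rpow_pos_of_pos hb0 _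
  have hnle : (n : ℝ) ≤ b ^ (2 * δ) := by
    have : (n : ℝ) = (n * (Real.log m / 2)) * (2 / Real.log m) := by field_simp
    rw [this, two_mul, Real.rpow_add hb0]
    exact mul_le_mul (hn4.trans hn1) hn3 (by positivity) hbδ.le
  have h2 : (n : ℝ) ^ K ≤ b ^ (1 - δ) := by
    calc (n : ℝ) ^ K ≤ (b ^ (2 * δ)) ^ K := by gcongr
      _ = b ^ (2 * δ * K) := by rw [← Real.rpow_natCast, ← Real.rpow_mul hb0.le]
      _ ≤ b ^ (1 - δ) := by
        refine Real.rpow_le_rpow_of_exponent_le hn2 (le_of_eq ?_)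
        rw [hδ]
        field_simp
        ring
  refine h2.trans ?_
  rw [scaling, ← hbdef, le_div_iff₀ hn5.1, Real.rpow_sub hb0, Real.rpow_one, div_mul_eq_mul_div,
    div_le_iff₀ hbδ, one_mul]
  have := hn5.2
  linarith

end Tail

/-! ### Vague convergence of the rescaled displacement law -/

/-- Weak convergence on the line follows from pointwise convergence of the tails. -/
lemma tendsto_integral_of_tendsto_Ioi {μs : ℕ → Measure ℝ} [∀ n, IsProbabilityMeasure (μs n)]
    {μ : Measure ℝ} [IsProbabilityMeasure μ]
    (h : ∀ t : ℝ, Tendsto (fun n => (μs n).real (Set.Ioi t)) atTop (𝓝 (μ.real (Set.Ioi t))))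
    (ψ : BoundedContinuousFunction ℝ ℝ) :
    Tendsto (fun n => ∫ x, ψ x ∂(μs n)) atTop (𝓝 (∫ x, ψ x ∂μ)) := by
  let ps : ℕ → ProbabilityMeasure ℝ := fun n => ⟨μs n, inferInstance⟩
  let q : ProbabilityMeasure ℝ := ⟨μ, inferInstance⟩
  have key : Tendsto ps atTop (𝓝 q) := by
    refine (isPiSystem_Ioc (id : ℝ → ℝ) id).tendsto_probabilityMeasure_of_tendsto_of_mem ?_ ?_ ?_
    · rintro s ⟨l, u, -, rfl⟩
      exact measurableSet_Ioc
    · intro u hu x hx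
      obtain ⟨ε, hε, hsub⟩ := Metric.isOpen_iff.1 hu x hx
      refine ⟨Set.Ioc (x - ε / 2) (x + ε / 2), ⟨_, _, by simp; linarith, rfl⟩,
        Ioc_mem_nhds (by linarith) (by linarith), fun y hy => hsub ?_⟩
      rw [Metric.mem_ball, Real.dist_eq, abs_lt]
      constructor <;> linarith [hy.1, hy.2]
    · rintro s ⟨l, u, hlu, rfl⟩
      simp only [id] at hlu
      have e : ∀ ρ : Measure ℝ, IsProbabilityMeasure ρ →
          ρ.real (Set.Ioc l u) = ρ.real (Set.Ioi l) - ρ.real (Set.Ioi u) := by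
        intro ρ hρ
        rw [← measureReal_sdiff (Set.Ioi_subset_Ioi hlu.le) measurableSet_Ioi]
        congr 1
        ext x
        simp
      rw [← NNReal.tendsto_coe]
      change Tendsto (fun n => (μs n).real (Set.Ioc (id l) (id u))) atTop
        (𝓝 (μ.real (Set.Ioc (id l) (id u))))
      simp only [id]
      rw [e μ inferInstance]
      exact ((h l).sub (h u)).congr fun n => (e (μs n) inferInstance).symm
  exact (ProbabilityMeasure.tendsto_iff_forall_integral_tendsto.1 key) ψ

section Vague

variable {ν : Measure ℝ} [IsProbabilityMeasure ν] {a L : ℝ → ℝ}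

/-- The exponential law on `(c, ∞)`. -/
lemma isProbabilityMeasure_gumbel_restrict (c : ℝ) :
    IsProbabilityMeasure (ENNReal.ofReal (Real.exp c) • gumbelIntensity.restrict (Set.Ioi c)) := by
  constructor
  rw [Measure.smul_apply, Measure.restrict_apply_univ, gumbelIntensity_Ioi, smul_eq_mul,
    ← ENNReal.ofReal_mul (Real.exp_pos _).le, ← Real.exp_add]
  simp

/-- Vague convergence of `m ^ n` times the law of `(X - b_n) / a_n` to `e^{-x} dx`, tested on a
function vanishing near `-∞`. -/
lemma SuplogAssumption.tendsto_pow_mul_integral (h : SuplogAssumption ν a L) {m : ℝ} (hm : 1 < m)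
    (ψ : BoundedContinuousFunction ℝ ℝ) {c : ℝ} (hψ : ∀ x ≤ c, ψ x = 0) :
    Tendsto (fun n => m ^ n * ∫ x, ψ ((x - centring ν m n) / scaling ν L m n) ∂ν) atTop
      (𝓝 (∫ x, ψ x ∂gumbelIntensity)) := by
  have hmpos : ∀ n : ℕ, 0 < m ^ n := fun n => by positivity
  set b := centring ν m with hb
  set s := scaling ν L m with hs
  have := isProbabilityMeasure_gumbel_restrict c
  set T : ℕ → ℝ → ℝ := fun n x => (x - b n) / s n with hT
  have hTm : ∀ n, Measurable (T n) := fun n => (measurable_id.sub_const _).div_const _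
  have htail := h.tendsto_pow_mul_tail hm
  obtain ⟨n₀, hn₀⟩ := eventually_atTop.1 ((h.eventually_scaling_pos hm).and
    ((htail c).eventually (lt_mem_nhds (Real.exp_pos (-c)))))
  have hpos : ∀ n, 0 < ν.real (Set.Ioi (b (n + n₀) + c * s (n + n₀))) := fun n =>
    pos_of_mul_pos_right (hn₀ (n + n₀) (by omega)).2 (hmpos _).le
  have hspos : ∀ n, 0 < s (n + n₀) := fun n => (hn₀ (n + n₀) (by omega)).1
  have hT_Ioi : ∀ n t, T (n + n₀) ⁻¹' Set.Ioi t = Set.Ioi (b (n + n₀) + t * s (n + n₀)) := by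
    intro n t
    ext x
    simp only [hT, Set.mem_preimage, Set.mem_Ioi, lt_div_iff₀ (hspos n)]
    constructor <;> intro h' <;> linarith
  -- Conditioned on exceeding `c`, the rescaled displacement has a law, and these laws converge to the
  -- exponential law on `(c, ∞)`. The indices are shifted by `n₀`, so that the conditioning event has
  -- positive probability.
  let μs : ℕ → Measure ℝ := fun n =>
    (ν[|Set.Ioi (b (n + n₀) + c * s (n + n₀))]).map (T (n + n₀))
  have hcp : ∀ n, IsProbabilityMeasure (ν[|Set.Ioi (b (n + n₀) + c * s (n + n₀))]) := fun n =>
    cond_isProbabilityMeasure ((measureReal_ne_zero_iff).1 (hpos n).ne')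
  have : ∀ n, IsProbabilityMeasure (μs n) := fun n => by
    have := hcp n
    exact Measure.isProbabilityMeasure_map (hTm _).aemeasurable
  have hμs : ∀ n t, (μs n).real (Set.Ioi t) =
      ν.real (Set.Ioi (b (n + n₀) + max t c * s (n + n₀))) /
        ν.real (Set.Ioi (b (n + n₀) + c * s (n + n₀))) := by
    intro n t
    rw [map_measureReal_apply (hTm _) measurableSet_Ioi, hT_Ioi, measureReal_def, cond_apply measurableSet_Ioi,
      Set.Ioi_inter_Ioi, ENNReal.toReal_mul, ENNReal.toReal_inv, div_eq_inv_mul]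
    congr 3
    rw [sup_comm, max_mul_of_nonneg _ _ (hspos n).le]
    exact congrArg Set.Ioi (max_add_add_left _ _ _)
  have hconv : ∀ t : ℝ, Tendsto (fun n => (μs n).real (Set.Ioi t)) atTop
      (𝓝 ((ENNReal.ofReal (Real.exp c) • gumbelIntensity.restrict (Set.Ioi c)).real
        (Set.Ioi t))) := by
    intro t
    have e : (ENNReal.ofReal (Real.exp c) • gumbelIntensity.restrict (Set.Ioi c)).real
        (Set.Ioi t) = Real.exp (-max t c) / Real.exp (-c) := by
      rw [measureReal_ennreal_smul_apply, measureReal_restrict_apply measurableSet_Ioi,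
        Set.Ioi_inter_Ioi, Measure.real, gumbelIntensity_Ioi,
        ENNReal.toReal_ofReal (Real.exp_pos _).le, ENNReal.toReal_ofReal (Real.exp_pos _).le,
        Real.exp_neg c]
      field_simp
    rw [e]
    refine (((htail (max t c)).comp (tendsto_add_atTop_nat n₀)).div
      ((htail c).comp (tendsto_add_atTop_nat n₀)) (Real.exp_pos _).ne').congr fun n => ?_
    rw [hμs]
    simp only [Pi.div_apply, Function.comp]
    rw [mul_div_mul_left _ _ (hmpos _).ne']
  have hlim := tendsto_integral_of_tendsto_Ioi hconv ψ
  rw [← tendsto_add_atTop_iff_nat n₀]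
  have h2 := ((htail c).comp (tendsto_add_atTop_nat n₀)).mul hlim
  have e2 : Real.exp (-c) * ∫ x, ψ x ∂(ENNReal.ofReal (Real.exp c) •
      gumbelIntensity.restrict (Set.Ioi c)) = ∫ x, ψ x ∂gumbelIntensity := by
    rw [integral_smul_measure, ENNReal.toReal_ofReal (Real.exp_pos _).le, smul_eq_mul, ← mul_assoc,
      ← Real.exp_add, neg_add_cancel, Real.exp_zero, one_mul]
    exact setIntegral_eq_integral_of_forall_compl_eq_zero fun x hx => hψ x (not_lt.1 hx)
  rw [e2] at h2
  refine h2.congr fun n => ?_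
  have e3 : ∫ x, ψ x ∂(μs n) = (ν.real (Set.Ioi (b (n + n₀) + c * s (n + n₀))))⁻¹ *
      ∫ x, ψ (T (n + n₀) x) ∂ν := by
    rw [integral_map (hTm _).aemeasurable ψ.continuous.measurable.aestronglyMeasurable,
      ProbabilityTheory.cond, integral_smul_measure, ENNReal.toReal_inv, smul_eq_mul]
    congr 1
    refine setIntegral_eq_integral_of_forall_compl_eq_zero fun x hx => hψ _ ?_
    rw [← hT_Ioi n c] at hx
    exact not_lt.1 hx
  rw [e3]
  simp only [Function.comp]
  have := (hpos n).ne'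
  field_simp
  rfl

end Vague

/-! ### Test functions on the real line -/

section TestFunctions

/-- The restriction to the real line of a test function on `(-∞, ∞]`. -/
noncomputable def realTest (f : C_c(RBar, ℝ≥0)) (x : ℝ) : ℝ := f (toRBar x)

lemma realTest_nonneg (f : C_c(RBar, ℝ≥0)) (x : ℝ) : 0 ≤ realTest f x := NNReal.coe_nonneg _

lemma continuous_realTest (f : C_c(RBar, ℝ≥0)) : Continuous (realTest f) :=
  NNReal.continuous_coe.comp (f.continuous.comp continuous_toRBar)

lemma exists_realTest_eq_zero (f : C_c(RBar, ℝ≥0)) : ∃ c : ℝ, ∀ x ≤ c, realTest f x = 0 := by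
  obtain ⟨c, hc⟩ := exists_eq_zero_of_lt f
  exact ⟨c, fun x hx => by simp [realTest, hc x hx]⟩

lemma exists_tendsto_realTest (f : C_c(RBar, ℝ≥0)) :
    ∃ d : ℝ, Tendsto (realTest f) atTop (𝓝 d) := by
  refine ⟨f ⟨⊤, by simp⟩, ?_⟩
  have h1 : Tendsto toRBar atTop (𝓝 (⟨⊤, by simp⟩ : RBar)) := by
    rw [tendsto_subtype_rng]
    exact EReal.tendsto_coe_nhds_top_iff.2 tendsto_id
  exact (NNReal.continuous_coe.tendsto _).comp ((f.continuous.tendsto _).comp h1)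

/-- Test functions are uniformly continuous on the real line: they vanish near `-∞` and have a limit
at `+∞`. -/
lemma uniformContinuous_realTest (f : C_c(RBar, ℝ≥0)) : UniformContinuous (realTest f) := by
  obtain ⟨c, hc⟩ := exists_realTest_eq_zero f
  obtain ⟨d, hd⟩ := exists_tendsto_realTest f
  rw [Metric.uniformContinuous_iff]
  intro ε hε
  obtain ⟨M, hM⟩ := eventually_atTop.1 (Metric.tendsto_nhds.1 hd (ε / 2) (half_pos hε))
  have hK : UniformContinuousOn (realTest f) (Set.Icc (c - 1) (M + 1)) :=
    isCompact_Icc.uniformContinuousOn_of_continuous (continuous_realTest f).continuousOn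
  obtain ⟨δ, hδ, h⟩ := Metric.uniformContinuousOn_iff.1 hK ε hε
  refine ⟨min δ 1, lt_min hδ one_pos, fun x y hxy => ?_⟩
  have h1 := abs_lt.1 ((Real.dist_eq x y ▸ hxy).trans_le (min_le_right _ _))
  by_cases hx : x ∈ Set.Icc (c - 1) (M + 1)
  · by_cases hy : y ∈ Set.Icc (c - 1) (M + 1)
    · exact h x hx y hy (hxy.trans_le (min_le_left _ _))
    · rw [Set.mem_Icc, not_and_or, not_le, not_le] at hy
      rcases hy with hy | hy
      · rw [hc x (by linarith), hc y (by linarith)]; simpa using hε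
      · calc dist (realTest f x) (realTest f y) ≤ dist (realTest f x) d + dist (realTest f y) d :=
              dist_triangle_right _ _ _
          _ < ε := by linarith [hM x (by linarith), hM y (by linarith)]
  · rw [Set.mem_Icc, not_and_or, not_le, not_le] at hx
    rcases hx with hx | hx
    · rw [hc x (by linarith), hc y (by linarith)]; simpa using hε
    · calc dist (realTest f x) (realTest f y) ≤ dist (realTest f x) d + dist (realTest f y) d :=
            dist_triangle_right _ _ _
        _ < ε := by linarith [hM x (by linarith), hM y (by linarith)]

/-- The function `1 - exp (-r φ)`, for a test function `φ`. -/
noncomputable def testDefect (f : C_c(RBar, ℝ≥0)) (r : ℝ≥0) : BoundedContinuousFunction ℝ ℝ :=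
  BoundedContinuousFunction.ofNormedAddCommGroup (fun x => 1 - Real.exp (-(r * realTest f x)))
    (continuous_const.sub (Real.continuous_exp.comp
      (continuous_const.mul (continuous_realTest f)).neg)) 1 fun x => by
    have h1 : Real.exp (-(r * realTest f x)) ≤ 1 :=
      Real.exp_le_one_iff.2 (neg_nonpos.2 (mul_nonneg r.2 (realTest_nonneg f x)))
    have h2 := Real.exp_pos (-(r * realTest f x))
    rw [Real.norm_eq_abs, abs_le]
    constructor <;> linarith

@[simp] lemma testDefect_apply (f : C_c(RBar, ℝ≥0)) (r : ℝ≥0) (x : ℝ) :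
    testDefect f r x = 1 - Real.exp (-(r * realTest f x)) := rfl

lemma testDefect_nonneg (f : C_c(RBar, ℝ≥0)) (r : ℝ≥0) (x : ℝ) : 0 ≤ testDefect f r x := by
  rw [testDefect_apply, sub_nonneg]
  exact Real.exp_le_one_iff.2 (neg_nonpos.2 (mul_nonneg r.2 (realTest_nonneg f x)))

lemma testDefect_le_one (f : C_c(RBar, ℝ≥0)) (r : ℝ≥0) (x : ℝ) : testDefect f r x ≤ 1 := by
  rw [testDefect_apply, sub_le_self_iff]
  exact (Real.exp_pos _).le

end TestFunctions

/-! ### Exponential moments of the truncated displacement -/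

section Moments

variable {ν : Measure ℝ} [IsProbabilityMeasure ν] {a L : ℝ → ℝ}

omit [IsProbabilityMeasure ν] in
lemma SuplogAssumption.exists_tail_le (h : SuplogAssumption ν a L) :
    ∃ A : ℝ, 0 < A ∧ ∀ᶠ t in atTop, ν.real (Set.Ioi t) ≤ A * Real.exp (-L t) := by
  obtain ⟨a₀, ha₀, hlim⟩ := h.prefactor
  refine ⟨2 * a₀, by positivity, ?_⟩
  filter_upwards [hlim.eventually (gt_mem_nhds (show a₀ < 2 * a₀ by linarith))] with t ht
  rw [h.tail]
  gcongr

/-- The tail `P(e^{L(X)} > r)` is `O(1 / r)`, so that `e^{L(X)}` has a moment of order `3 / 4`. The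
truncation `max x t₀` restricts `L` to a half-line where it is increasing. -/
lemma SuplogAssumption.lintegral_exp_lt_top (h : SuplogAssumption ν a L) {t₀ A : ℝ} (hA : 0 < A)
    (hmono : StrictMonoOn L (Set.Ici t₀))
    (htail : ∀ t ≥ t₀, ν.real (Set.Ioi t) ≤ A * Real.exp (-L t)) :
    ∫⁻ x, ENNReal.ofReal (Real.exp (L (max x t₀)) ^ (3 / 4 : ℝ)) ∂ν < ∞ := by
  have hLc : Continuous L := h.differentiable.continuous
  have hm : Measurable fun x => Real.exp (L (max x t₀)) := by fun_prop
  rw [lintegral_rpow_eq_lintegral_meas_lt_mul ν (Eventually.of_forall fun x => (Real.exp_pos _).le)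
    hm.aemeasurable (by norm_num)]
  refine ENNReal.mul_lt_top ENNReal.ofReal_lt_top ?_
  set r₀ := Real.exp (L t₀) with hr₀
  have hr₀pos : 0 < r₀ := Real.exp_pos _
  rw [← Set.Ioc_union_Ioi_eq_Ioi hr₀pos.le]
  refine (lintegral_union_le _ _ _).trans_lt (ENNReal.add_lt_top.2 ⟨?_, ?_⟩)
  · have hi : IntegrableOn (fun t : ℝ => t ^ (3 / 4 - 1 : ℝ)) (Set.Ioc 0 r₀) := by
      have := (intervalIntegral.intervalIntegrable_rpow' (a := 0) (b := r₀)
        (show (-1 : ℝ) < 3 / 4 - 1 by norm_num))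
      rwa [intervalIntegrable_iff_integrableOn_Ioc_of_le hr₀pos.le] at this
    refine lt_of_le_of_lt (lintegral_mono fun t => ?_) hi.lintegral_lt_top
    exact mul_le_of_le_one_left' prob_le_one
  · have hi : IntegrableOn (fun t : ℝ => A * t ^ (-(5 / 4) : ℝ)) (Set.Ioi r₀) :=
      (integrableOn_Ioi_rpow_of_lt (by norm_num) hr₀pos).const_mul A
    refine lt_of_le_of_lt (setLIntegral_mono' measurableSet_Ioi fun r hr => ?_) hi.lintegral_lt_top
    have hr : r₀ < r := hr
    have hrpos : 0 < r := hr₀pos.trans hr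
    have hlog : L t₀ < Real.log r := (Real.lt_log_iff_exp_lt hrpos).2 hr
    obtain ⟨t₁, ht₁, ht₁'⟩ := ((h.tendsto_atTop.eventually_ge_atTop (Real.log r)).and
      (eventually_ge_atTop t₀)).exists
    obtain ⟨t, ht, hLt⟩ := intermediate_value_Icc ht₁' hLc.continuousOn ⟨hlog.le, ht₁⟩
    have hset : {x | r < Real.exp (L (max x t₀))} ⊆ Set.Ioi t := by
      intro x hx
      by_contra hcon
      have h1 : L (max x t₀) ≤ L t :=
        hmono.monotoneOn (Set.mem_Ici.2 (le_max_right _ _)) (Set.mem_Ici.2 ht.1) (max_le (not_lt.1 hcon) ht.1)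
      have h2 : r < Real.exp (L (max x t₀)) := hx
      rw [← Real.log_lt_iff_lt_exp hrpos] at h2
      linarith
    have hbd : ν {x | r < Real.exp (L (max x t₀))} ≤ ENNReal.ofReal (A * r⁻¹) := by
      refine (measure_mono hset).trans ?_
      rw [← ofReal_measureReal]
      refine ENNReal.ofReal_le_ofReal ((htail t ht.1).trans_eq ?_)
      rw [hLt, Real.exp_neg, Real.exp_log hrpos]
    calc _ ≤ ENNReal.ofReal (A * r⁻¹) * ENNReal.ofReal (r ^ (3 / 4 - 1 : ℝ)) :=
          mul_le_mul_left hbd _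
      _ = ENNReal.ofReal (A * r ^ (-(5 / 4) : ℝ)) := by
          rw [← ENNReal.ofReal_mul (by positivity), mul_assoc, ← Real.rpow_neg_one r,
            ← Real.rpow_add hrpos]
          norm_num

/-- An exponential moment of the truncated displacement: `E exp(s min(X⁺, y)) ≤ e^{C s}` for
`s = L(y) / (2 y)`, with `C` independent of `y`. Since `L(x) / x` decreases, `s x ≤ L(x) / 2` for
`x ≤ y`, whence `e^{s x} ≤ 1 + s x e^{L(x) / 2}`, and `X e^{L(X) / 2}` is integrable. -/
lemma SuplogAssumption.exists_lintegral_exp_min_le (h : SuplogAssumption ν a L) :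
    ∃ C : ℝ, 0 ≤ C ∧ ∀ᶠ y in atTop,
      ∫⁻ x, ENNReal.ofReal (Real.exp (L y / (2 * y) * min (max x 0) y)) ∂ν ≤
        ENNReal.ofReal (Real.exp (C * (L y / (2 * y)))) := by
  have hLc : Continuous L := h.differentiable.continuous
  obtain ⟨A, hA, htail⟩ := h.exists_tail_le
  obtain ⟨x₁, hx₁, hmono⟩ := h.exists_strictMonoOn
  obtain ⟨x₂, hx₂, hanti⟩ := h.exists_antitoneOn one_pos
  obtain ⟨x₃, hx₃⟩ := eventually_atTop.1 (((htail.and (h.eventually_log_le (K := 4)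
    (by norm_num))).and (h.tendsto_atTop.eventually_gt_atTop 0)))
  set t₀ := max (max x₁ x₂) x₃ with ht₀
  have ht₀1 : x₁ ≤ t₀ := (le_max_left _ _).trans (le_max_left _ _)
  have ht₀2 : x₂ ≤ t₀ := (le_max_right _ _).trans (le_max_left _ _)
  have ht₀3 : x₃ ≤ t₀ := le_max_right _ _
  have ht₀pos : 0 < t₀ := hx₁.trans_le ht₀1
  have hmono' : StrictMonoOn L (Set.Ici t₀) := hmono.mono (Set.Ici_subset_Ici.2 ht₀1)
  have hfin := h.lintegral_exp_lt_top hA hmono' fun t ht => (hx₃ t (ht₀3.trans ht)).1.1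
  -- `Q = max(X, t₀) e^{L(max(X, t₀)) / 2}` is integrable
  set Q : ℝ → ℝ := fun x => max x t₀ * Real.exp (L (max x t₀) / 2) with hQ
  have hQ0 : ∀ x, 0 ≤ Q x := fun x =>
    mul_nonneg (ht₀pos.le.trans (le_max_right _ _)) (Real.exp_pos _).le
  have hQm : Measurable Q := by fun_prop
  have hQfin : ∫⁻ x, ENNReal.ofReal (Q x) ∂ν < ∞ := by
    refine lt_of_le_of_lt (lintegral_mono fun x => ENNReal.ofReal_le_ofReal ?_) hfin
    have hx := hx₃ (max x t₀) (ht₀3.trans (le_max_right _ _))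
    have hpos : 0 < max x t₀ := ht₀pos.trans_le (le_max_right _ _)
    -- `x ≤ e^{L(x) / 4}`, because `4 log x ≤ L(x)`
    calc Q x ≤ Real.exp (L (max x t₀) / 4) * Real.exp (L (max x t₀) / 2) := by
          refine mul_le_mul_of_nonneg_right ?_ (Real.exp_pos _).le
          rw [← Real.log_le_iff_le_exp hpos]
          linarith [hx.1.2]
      _ = Real.exp (L (max x t₀)) ^ (3 / 4 : ℝ) := by
          rw [← Real.exp_add, ← Real.exp_mul]
          ring_nf
  set I := (∫⁻ x, ENNReal.ofReal (Q x) ∂ν).toReal with hI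
  have hI' : ∫⁻ x, ENNReal.ofReal (Q x) ∂ν = ENNReal.ofReal I :=
    (ENNReal.ofReal_toReal hQfin.ne).symm
  refine ⟨I, ENNReal.toReal_nonneg, ?_⟩
  filter_upwards [eventually_ge_atTop t₀] with y hy
  have hy0 : 0 < y := ht₀pos.trans_le hy
  have hLy : 0 < L y := (hx₃ y (ht₀3.trans hy)).2
  set s := L y / (2 * y) with hs
  have hs0 : 0 ≤ s := by positivity
  have hpt : ∀ x, Real.exp (s * min (max x 0) y) ≤ 1 + s * Q x := by
    intro x
    set w := min (max x 0) y with hw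
    have hw0 : 0 ≤ w := le_min (le_max_right _ _) hy0.le
    have h1 : Real.exp (s * w) ≤ 1 + s * w * Real.exp (s * w) := by
      have := Real.add_one_le_exp (-(s * w))
      have h2 := mul_le_mul_of_nonneg_right this (Real.exp_pos (s * w)).le
      rw [← Real.exp_add] at h2
      simp only [neg_add_cancel, Real.exp_zero] at h2
      linarith
    have hle : w ≤ max x t₀ := (min_le_left _ _).trans (max_le_max le_rfl ht₀pos.le)
    set w₀ := max w t₀ with hw₀
    have hw₀y : w₀ ≤ y := max_le (min_le_right _ _) hy
    have hw₀pos : 0 < w₀ := ht₀pos.trans_le (le_max_right _ _)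
    have h3 : s * w ≤ L (max x t₀) / 2 := by
      have h4 := hanti (Set.mem_Ici.2 (ht₀2.trans (le_max_right w t₀)))
        (Set.mem_Ici.2 (ht₀2.trans hy)) hw₀y
      simp only [Real.rpow_neg_one] at h4
      have h5 : L w₀ ≤ L (max x t₀) := hmono'.monotoneOn (Set.mem_Ici.2 (le_max_right _ _))
        (Set.mem_Ici.2 (le_max_right _ _)) (max_le hle (le_max_right _ _))
      calc s * w ≤ s * w₀ := mul_le_mul_of_nonneg_left (le_max_left _ _) hs0
        _ = (y⁻¹ * L y) * w₀ / 2 := by rw [hs]; field_simp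
        _ ≤ (w₀⁻¹ * L w₀) * w₀ / 2 := by gcongr
        _ = L w₀ / 2 := by field_simp
        _ ≤ _ := by gcongr
    calc Real.exp (s * w) ≤ 1 + s * w * Real.exp (s * w) := h1
      _ ≤ 1 + s * (max x t₀) * Real.exp (L (max x t₀) / 2) := by gcongr
      _ = 1 + s * Q x := by rw [hQ]; ring
  calc ∫⁻ x, ENNReal.ofReal (Real.exp (s * min (max x 0) y)) ∂ν
      ≤ ∫⁻ x, (1 + ENNReal.ofReal s * ENNReal.ofReal (Q x)) ∂ν := by
        refine lintegral_mono fun x => ?_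
        rw [← ENNReal.ofReal_one, ← ENNReal.ofReal_mul hs0,
          ← ENNReal.ofReal_add zero_le_one (mul_nonneg hs0 (hQ0 x))]
        exact ENNReal.ofReal_le_ofReal (hpt x)
    _ = ENNReal.ofReal (1 + s * I) := by
        rw [lintegral_add_left measurable_const, lintegral_const_mul _ hQm.ennreal_ofReal, hI',
          lintegral_const, measure_univ, mul_one, ← ENNReal.ofReal_mul hs0, ← ENNReal.ofReal_one,
          ← ENNReal.ofReal_add zero_le_one (mul_nonneg hs0 ENNReal.toReal_nonneg)]
    _ ≤ _ := ENNReal.ofReal_le_ofReal (by linarith [Real.add_one_le_exp (I * s)])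

end Moments

/-! ### Deviation bounds for sums of independent displacements -/

section Walk

variable {ι Ω : Type*} [MeasurableSpace Ω] {P : Measure Ω} [IsProbabilityMeasure P]
  {ν : Measure ℝ} {X : ι → Ω → ℝ}

omit [IsProbabilityMeasure P] in
lemma lintegral_exp_sum_min_le (hX : ∀ i, Measurable (X i)) (hi : iIndepFun X P)
    (hlaw : ∀ i, P.map (X i) = ν) {s y c : ℝ}
    (hc : ∫⁻ x, ENNReal.ofReal (Real.exp (s * min (max x 0) y)) ∂ν ≤ ENNReal.ofReal (Real.exp c))
    (J : Finset ι) :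
    ∫⁻ ω, ENNReal.ofReal (Real.exp (s * ∑ j ∈ J, min (max (X j ω) 0) y)) ∂P ≤
      ENNReal.ofReal (Real.exp (J.card * c)) := by
  set g : ℝ → ℝ≥0∞ := fun x => ENNReal.ofReal (Real.exp (s * min (max x 0) y)) with hg
  have hgm : Measurable g := by fun_prop
  have e : ∀ ω, ENNReal.ofReal (Real.exp (s * ∑ j ∈ J, min (max (X j ω) 0) y)) =
      ∏ j ∈ J, g (X j ω) := fun ω => by
    rw [Finset.mul_sum, Real.exp_sum, ENNReal.ofReal_prod_of_nonneg fun _ _ => (Real.exp_pos _).le]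
  simp_rw [e]
  rw [lintegral_prod_eq_prod_lintegral_of_indepFun J (fun j ω => g (X j ω))
    (hi.comp (fun _ => g) fun _ => hgm) fun j => hgm.comp (hX j)]
  calc ∏ j ∈ J, ∫⁻ ω, g (X j ω) ∂P = ∏ _j ∈ J, ∫⁻ x, g x ∂ν := by
        refine Finset.prod_congr rfl fun j _ => ?_
        rw [← hlaw j, lintegral_map hgm (hX j)]
    _ ≤ ∏ _j ∈ J, ENNReal.ofReal (Real.exp c) := Finset.prod_le_prod' fun _ _ => hc
    _ = ENNReal.ofReal (Real.exp (J.card * c)) := by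
        rw [Finset.prod_const, ← ENNReal.ofReal_pow (Real.exp_pos _).le, Real.exp_nat_mul]

omit [IsProbabilityMeasure P] in
/-- A sum of at most `n` terms exceeds `u` only if one of them exceeds `u / n`. -/
lemma measure_lt_sum_le (hX : ∀ i, Measurable (X i)) (hlaw : ∀ i, P.map (X i) = ν)
    {g : ℝ → ℝ} (hg : Measurable g) {J : Finset ι} {n : ℕ} (hn : 0 < n) (hJ : J.card ≤ n) {u : ℝ}
    (hu : 0 ≤ u) :
    P {ω | u < ∑ j ∈ J, g (X j ω)} ≤ n * ν {x | u / n < g x} := by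
  have hn' : (0 : ℝ) < n := by exact_mod_cast hn
  calc P {ω | u < ∑ j ∈ J, g (X j ω)} ≤ P (⋃ j ∈ J, {ω | u / n < g (X j ω)}) := by
        refine measure_mono fun ω hω => ?_
        by_contra hcon
        simp only [Set.mem_iUnion, not_exists] at hcon
        have h1 : ∑ j ∈ J, g (X j ω) ≤ ∑ _j ∈ J, u / n :=
          Finset.sum_le_sum fun j hj => not_lt.1 (hcon j hj)
        rw [Finset.sum_const, nsmul_eq_mul] at h1
        have h2 : (J.card : ℝ) * (u / n) ≤ n * (u / n) :=
          mul_le_mul_of_nonneg_right (by exact_mod_cast hJ) (by positivity)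
        rw [mul_div_cancel₀ _ hn'.ne'] at h2
        exact absurd (hω : u < _) (not_lt.2 (h1.trans h2))
    _ ≤ ∑ j ∈ J, P {ω | u / n < g (X j ω)} := measure_biUnion_finset_le _ _
    _ = ∑ _j ∈ J, ν {x | u / n < g x} := by
        refine Finset.sum_congr rfl fun j _ => ?_
        rw [← hlaw j, Measure.map_apply (hX j) (measurableSet_lt measurable_const hg)]
        rfl
    _ ≤ n * ν {x | u / n < g x} := by
        rw [Finset.sum_const, nsmul_eq_mul]
        gcongr

omit [IsProbabilityMeasure P] in
/-- Chernoff's bound on the event that all the displacements are at most `y`. -/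
lemma measure_lt_sum_of_forall_le (hX : ∀ i, Measurable (X i)) (hi : iIndepFun X P)
    (hlaw : ∀ i, P.map (X i) = ν) {s y c : ℝ} (hs : 0 ≤ s)
    (hc : ∫⁻ x, ENNReal.ofReal (Real.exp (s * min (max x 0) y)) ∂ν ≤ ENNReal.ofReal (Real.exp c))
    (J : Finset ι) (u : ℝ) :
    P {ω | (∀ j ∈ J, X j ω ≤ y) ∧ u < ∑ j ∈ J, X j ω} ≤
      ENNReal.ofReal (Real.exp (J.card * c - s * u)) := by
  set F : Ω → ℝ≥0∞ := fun ω =>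
    ENNReal.ofReal (Real.exp (s * ∑ j ∈ J, min (max (X j ω) 0) y)) with hF
  calc P {ω | (∀ j ∈ J, X j ω ≤ y) ∧ u < ∑ j ∈ J, X j ω}
      ≤ P {ω | ENNReal.ofReal (Real.exp (s * u)) ≤ F ω} := by
        refine measure_mono fun ω hω => ENNReal.ofReal_le_ofReal (Real.exp_le_exp.2
          (mul_le_mul_of_nonneg_left (hω.2.le.trans (Finset.sum_le_sum fun j hj => ?_)) hs))
        exact le_min (le_max_left _ _) (hω.1 j hj)
    _ ≤ (∫⁻ ω, F ω ∂P) / ENNReal.ofReal (Real.exp (s * u)) := by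
        refine meas_ge_le_lintegral_div ?_ (by simp [Real.exp_pos]) ENNReal.ofReal_ne_top
        refine Measurable.aemeasurable (Measurable.ennreal_ofReal ?_)
        exact Real.measurable_exp.comp ((Finset.measurable_sum _ fun j _ =>
          ((hX j).max measurable_const).min measurable_const).const_mul s)
    _ ≤ ENNReal.ofReal (Real.exp (J.card * c)) / ENNReal.ofReal (Real.exp (s * u)) := by
        gcongr
        exact lintegral_exp_sum_min_le hX hi hlaw hc J
    _ = _ := by rw [← ENNReal.ofReal_div_of_pos (Real.exp_pos _), ← Real.exp_sub]

/-- Conditioning on one of two independent variables. -/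
lemma measure_indepFun_eq_lintegral {U V : Ω → ℝ} (hU : Measurable U) (hV : Measurable V)
    (h : IndepFun U V P) (hlaw : P.map V = ν) {S : Set (ℝ × ℝ)} (hS : MeasurableSet S) :
    P {ω | (U ω, V ω) ∈ S} = ∫⁻ ω, ν (Prod.mk (U ω) ⁻¹' S) ∂P := by
  have : IsProbabilityMeasure ν := hlaw ▸ Measure.isProbabilityMeasure_map hV.aemeasurable
  have h1 := (indepFun_iff_map_prod_eq_prod_map_map hU.aemeasurable hV.aemeasurable).1 h
  have h2 : P {ω | (U ω, V ω) ∈ S} = P.map (fun ω => (U ω, V ω)) S := by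
    rw [Measure.map_apply (hU.prodMk hV) hS]
    rfl
  rw [h2, h1, Measure.prod_apply hS, hlaw, lintegral_map (measurable_measure_prodMk_left hS) hU]

/-- Truncation at `b ≥ 0` is subadditive on nonnegative terms. -/
lemma min_sum_le_sum_min (J : Finset ι) {Y : ι → ℝ} (hY : ∀ i, 0 ≤ Y i) {b : ℝ} (hb : 0 ≤ b) :
    min (∑ j ∈ J, Y j) b ≤ ∑ j ∈ J, min (Y j) b := by
  have h0 : ∀ j ∈ J, 0 ≤ min (Y j) b := fun j _ => le_min (hY j) hb
  by_cases h : ∃ i ∈ J, b ≤ Y i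
  · obtain ⟨i, hi, hbi⟩ := h
    calc min (∑ j ∈ J, Y j) b ≤ min (Y i) b := by rw [min_eq_right hbi]; exact min_le_right _ _
      _ ≤ _ := Finset.single_le_sum h0 hi
  · push Not at h
    exact (min_le_left _ _).trans (Finset.sum_le_sum fun j hj => by
      rw [min_eq_left (h j hj).le])

omit [IsProbabilityMeasure P] in
lemma indepFun_sum_erase [DecidableEq ι] (hi : iIndepFun X P) (hX : ∀ i, Measurable (X i))
    {g : ℝ → ℝ} (hg : Measurable g) (J : Finset ι) (i : ι) :
    IndepFun (fun ω => ∑ j ∈ J.erase i, g (X j ω)) (X i) P := by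
  have h1 := hi.indepFun_finset (J.erase i) {i} (by simp) hX
  have hm2 : Measurable fun v : ({j // j ∈ ({i} : Finset ι)} → ℝ) => v ⟨i, by simp⟩ :=
    measurable_pi_apply _
  have h2 := h1.comp (φ := fun v : ({j // j ∈ J.erase i} → ℝ) => ∑ k, g (v k))
    (ψ := fun v : ({j // j ∈ ({i} : Finset ι)} → ℝ) => v ⟨i, by simp⟩)
    (Finset.measurable_sum _ fun k _ => hg.comp (measurable_pi_apply k)) hm2
  have e : (fun ω => ∑ j ∈ J.erase i, g (X j ω)) =
      (fun v : ({j // j ∈ J.erase i} → ℝ) => ∑ k, g (v k)) ∘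
        fun ω (k : {j // j ∈ J.erase i}) => X k ω := by
    funext ω
    exact (Finset.sum_coe_sort (J.erase i) fun j => g (X j ω)).symm
  rw [e]
  exact h2

/-- A walk which is large although none of its displacements comes close to the target: either all
the displacements are at most `b / 4`, or one of them is large and the sum of the others exceeds
`α`. In the second case the gain in the tail is compared with an exponential moment. -/
lemma measure_sum_lt_of_forall_le_sub (hX : ∀ i, Measurable (X i)) (hi : iIndepFun X P)
    (hlaw : ∀ i, P.map (X i) = ν) {b α C s₁ c₁ s₂ c₂ D : ℝ} (hb : 0 ≤ b) (hα : 0 ≤ α)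
    (hs₁ : 0 ≤ s₁) (hs₂ : 0 ≤ s₂) (hD : 0 ≤ D) (hc₂ : 0 ≤ c₂)
    (h₁ : ∫⁻ x, ENNReal.ofReal (Real.exp (s₁ * min (max x 0) (b / 4))) ∂ν ≤
      ENNReal.ofReal (Real.exp c₁))
    (h₂ : ∫⁻ x, ENNReal.ofReal (Real.exp (s₂ * min (max x 0) b)) ∂ν ≤
      ENNReal.ofReal (Real.exp c₂))
    (htail : ∀ r, α < r → ν (Set.Ioi (max (b / 4) (b - C * α - r))) ≤
      ENNReal.ofReal (D * Real.exp (s₂ / 2 * min r b)))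
    {J : Finset ι} {n : ℕ} (hn : 0 < n) (hJ : J.card = n) :
    P {ω | (∀ j ∈ J, X j ω ≤ b - (C + 1) * α) ∧ b - C * α < ∑ j ∈ J, X j ω} ≤
      ENNReal.ofReal (Real.exp (n * c₁ - s₁ * (b - C * α))) +
        n * (ENNReal.ofReal (D * n ^ 2) * (n * ν (Set.Ioi (α / n))) +
          ENNReal.ofReal (D / n ^ 2 * Real.exp (n * c₂))) := by
  classical
  have hn' : (0 : ℝ) < n := by exact_mod_cast hn
  -- `R i` bounds the sum of the displacements other than `X i`, and is independent of `X i`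
  set R : ι → Ω → ℝ := fun i ω => ∑ j ∈ J.erase i, max (X j ω) 0 with hR
  have hRm : ∀ i, Measurable (R i) := fun i =>
    Finset.measurable_sum _ fun j _ => (hX j).max measurable_const
  set S : Set (ℝ × ℝ) := {q | α < q.1 ∧ max (b / 4) (b - C * α - q.1) < q.2} with hS
  have hSm : MeasurableSet S := (measurableSet_lt measurable_const measurable_fst).inter
    (measurableSet_lt (measurable_const.max (measurable_const.sub measurable_fst)) measurable_snd)
  have hsub : {ω | (∀ j ∈ J, X j ω ≤ b - (C + 1) * α) ∧ b - C * α < ∑ j ∈ J, X j ω} ⊆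
      {ω | (∀ j ∈ J, X j ω ≤ b / 4) ∧ b - C * α < ∑ j ∈ J, X j ω} ∪
        ⋃ i ∈ J, {ω | (R i ω, X i ω) ∈ S} := by
    rintro ω ⟨h1, h2⟩
    by_cases hall : ∀ j ∈ J, X j ω ≤ b / 4
    · exact Or.inl ⟨hall, h2⟩
    · push Not at hall
      obtain ⟨i, hiJ, hbi⟩ := hall
      refine Or.inr (Set.mem_biUnion hiJ ?_)
      have h3 : ∑ j ∈ J, X j ω ≤ X i ω + R i ω := by
        rw [← Finset.add_sum_erase _ _ hiJ]
        exact add_le_add le_rfl (Finset.sum_le_sum fun j _ => le_max_left (X j ω) 0)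
      have h4 := h1 i hiJ
      have h5 : α < R i ω := by linarith
      have h6 : max (b / 4) (b - C * α - R i ω) < X i ω := max_lt hbi (by linarith)
      exact ⟨h5, h6⟩
  have hB : ∀ i ∈ J, P {ω | (R i ω, X i ω) ∈ S} ≤
      ENNReal.ofReal (D * n ^ 2) * (n * ν (Set.Ioi (α / n))) +
          ENNReal.ofReal (D / n ^ 2 * Real.exp (n * c₂)) := by
    intro i hiJ
    have hcard : (J.erase i).card ≤ n := hJ ▸ (Finset.card_erase_le)
    rw [measure_indepFun_eq_lintegral (hRm i) (hX i)
      (indepFun_sum_erase hi hX (measurable_id.max measurable_const) J i) (hlaw i) hSm]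
    have hset : MeasurableSet {ω | α < R i ω} := measurableSet_lt measurable_const (hRm i)
    -- Given `R i = r`, the displacement `X i` must exceed `max (b / 4) (b - C α - r)`, which has
    -- probability at most `D e^z` with `z = s₂ min(r, b) / 2`. The bound `e^z ≤ n² + e^{2z} / n²`
    -- trades it for the rare event `r > α` and the exponential moment of parameter `s₂`.
    have hpt : ∀ ω, ν (Prod.mk (R i ω) ⁻¹' S) ≤
        {ω | α < R i ω}.indicator (fun _ => ENNReal.ofReal (D * n ^ 2)) ω +
          ENNReal.ofReal (D / n ^ 2) * ENNReal.ofReal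
            (Real.exp (s₂ * ∑ j ∈ J.erase i, min (max (X j ω) 0) b)) := by
      intro ω
      by_cases hω : α < R i ω
      · rw [Set.indicator_of_mem (show ω ∈ {ω | α < R i ω} from hω),
          ← ENNReal.ofReal_mul (by positivity), ← ENNReal.ofReal_add (by positivity) (by positivity)]
        refine (measure_mono fun x hx => hx.2).trans ((htail _ hω).trans
          (ENNReal.ofReal_le_ofReal ?_))
        set z := s₂ / 2 * min (R i ω) b with hz
        have h1 : 2 * z ≤ s₂ * ∑ j ∈ J.erase i, min (max (X j ω) 0) b := by
          rw [hz]
          calc 2 * (s₂ / 2 * min (R i ω) b) = s₂ * min (R i ω) b := by ring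
            _ ≤ _ := mul_le_mul_of_nonneg_left
              (min_sum_le_sum_min _ (fun j => le_max_right _ _) hb) hs₂
        have h2 : Real.exp z ≤ n ^ 2 + Real.exp (2 * z) / n ^ 2 := by
          have h3 : Real.exp (2 * z) / n ^ 2 = (Real.exp z / n) ^ 2 := by
            rw [div_pow, ← Real.exp_nat_mul]
            norm_num
          have h4 : Real.exp z = n * (Real.exp z / n) := by field_simp
          rw [h3]
          nlinarith [sq_nonneg ((n : ℝ) - Real.exp z / n), sq_nonneg (n : ℝ),
            sq_nonneg (Real.exp z / n)]
        calc D * Real.exp z ≤ D * (n ^ 2 + Real.exp (2 * z) / n ^ 2) := by gcongr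
          _ = D * n ^ 2 + D / n ^ 2 * Real.exp (2 * z) := by ring
          _ ≤ _ := by gcongr
      · have : Prod.mk (R i ω) ⁻¹' S = ∅ := by
          ext x
          simp [hS, hω]
        rw [this, measure_empty]
        exact zero_le
    refine (lintegral_mono hpt).trans ?_
    rw [lintegral_add_left (measurable_const.indicator hset), lintegral_indicator_const hset]
    refine add_le_add ?_ ?_
    · gcongr
      exact measure_lt_sum_le hX hlaw (g := fun x => max x 0) (measurable_id.max measurable_const)
        hn hcard hα |>.trans (by
          gcongr
          intro x hx
          have hx : α / n < max x 0 := hx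
          rcases lt_max_iff.1 hx with h | h
          · exact h
          · exact absurd h (not_lt.2 (by positivity)))
    · rw [lintegral_const_mul' _ _ ENNReal.ofReal_ne_top, ENNReal.ofReal_mul (by positivity)]
      refine mul_le_mul_right ((lintegral_exp_sum_min_le hX hi hlaw h₂ _).trans ?_) _
      refine ENNReal.ofReal_le_ofReal (Real.exp_le_exp.2 ?_)
      gcongr
  calc _ ≤ P ({ω | (∀ j ∈ J, X j ω ≤ b / 4) ∧ b - C * α < ∑ j ∈ J, X j ω} ∪
        ⋃ i ∈ J, {ω | (R i ω, X i ω) ∈ S}) := measure_mono hsub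
    _ ≤ _ := measure_union_le _ _
    _ ≤ _ := by
      refine add_le_add ?_ ?_
      · have := measure_lt_sum_of_forall_le hX hi hlaw hs₁ h₁ J (b - C * α)
        rwa [hJ] at this
      · refine (measure_biUnion_finset_le _ _).trans ((Finset.sum_le_sum hB).trans_eq ?_)
        rw [Finset.sum_const, nsmul_eq_mul, hJ]

end Walk

section Deviations

variable {ν : Measure ℝ} [IsProbabilityMeasure ν] {a L : ℝ → ℝ}

/-- The bound `x L'(x) ≤ δ L(x)`, integrated over an interval `[u, b]` with `u ≥ b / 4`. -/
lemma SuplogAssumption.eventually_sub_le (h : SuplogAssumption ν a L) {δ : ℝ} (hδ : 0 < δ) :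
    ∀ᶠ b in atTop, ∀ u ∈ Set.Icc (b / 4) b, L b - L u ≤ 4 * δ * (L b / b) * (b - u) := by
  obtain ⟨x₁, hx₁, hmono⟩ := h.exists_strictMonoOn
  obtain ⟨x₂, hx₂⟩ := eventually_atTop.1 (h.eventually_deriv hδ)
  filter_upwards [eventually_ge_atTop (4 * max x₁ x₂), eventually_gt_atTop 0,
    h.tendsto_atTop.eventually_gt_atTop 0] with b hb hb0 hLb u hu
  have hux : max x₁ x₂ ≤ u := by linarith [hu.1]
  refine Convex.image_sub_le_mul_sub_of_deriv_le (convex_Icc u b)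
    h.differentiable.continuous.continuousOn h.differentiable.differentiableOn ?_ u
    (Set.left_mem_Icc.2 hu.2) b (Set.right_mem_Icc.2 hu.2) hu.2
  intro x hx
  rw [interior_Icc] at hx
  have hx0 : b / 4 < x := hu.1.trans_lt hx.1
  have hxpos : 0 < x := by linarith
  have h1 := (hx₂ x ((le_max_right _ _).trans (hux.trans hx.1.le))).2
  have h2 : L x ≤ L b := hmono.monotoneOn
    (Set.mem_Ici.2 ((le_max_left _ _).trans (hux.trans hx.1.le)))
    (Set.mem_Ici.2 ((le_max_left _ _).trans (hux.trans hu.2))) hx.2.le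
  calc deriv L x ≤ δ * L b / x := by
        rw [le_div_iff₀ hxpos]
        nlinarith
    _ ≤ δ * L b / (b / 4) := by gcongr
    _ = 4 * δ * (L b / b) := by field_simp

end Deviations

/-! ### The deviation events along a single ancestral line -/

section Asymptotics

variable {ν : Measure ℝ} [IsProbabilityMeasure ν] {a L : ℝ → ℝ}

/-- The right tail is lighter than every power, as `L` dominates the logarithm. -/
lemma SuplogAssumption.eventually_real_Ioi_le (h : SuplogAssumption ν a L) {K : ℝ} (hK : 0 < K) :
    ∀ᶠ t in atTop, ν.real (Set.Ioi t) ≤ t ^ (-K) := by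
  obtain ⟨A, hA, htail⟩ := h.exists_tail_le
  filter_upwards [htail, h.eventually_log_le (K := K + 1) (by positivity), eventually_gt_atTop 0,
    eventually_ge_atTop A] with t h1 h2 h3 h4
  calc ν.real (Set.Ioi t) ≤ A * Real.exp (-L t) := h1
    _ ≤ t * Real.exp (Real.log t * (-(K + 1))) := by
        gcongr
        linarith
    _ = t ^ (-K) := by
        rw [← Real.rpow_def_of_pos h3, mul_comm, ← Real.rpow_add_one h3.ne']
        ring_nf

/-- Both tails of the displacement are bounded by a power; the left one decides the exponent. -/
lemma SuplogAssumption.exists_abs_tail_le (h : SuplogAssumption ν a L) :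
    ∃ ε : ℝ, 0 < ε ∧ ∀ᶠ t in atTop, ν {x | t < |x|} ≤ ENNReal.ofReal (2 * t ^ (-ε)) := by
  obtain ⟨ε, hε, hleft⟩ := h.leftTail
  refine ⟨ε, hε, ?_⟩
  filter_upwards [hleft, h.eventually_real_Ioi_le hε] with t h1 h2
  calc ν {x | t < |x|} ≤ ν (Set.Iio (-t) ∪ Set.Ioi t) := by
        refine measure_mono fun x hx => ?_
        rcases lt_abs.1 (show t < |x| from hx) with h | h
        · exact Or.inr h
        · exact Or.inl (by rw [Set.mem_Iio]; linarith)
    _ ≤ ν (Set.Iio (-t)) + ν (Set.Ioi t) := measure_union_le _ _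
    _ = ENNReal.ofReal (ν.real (Set.Iio (-t)) + ν.real (Set.Ioi t)) := by
        rw [ENNReal.ofReal_add measureReal_nonneg measureReal_nonneg, ofReal_measureReal,
          ofReal_measureReal]
    _ ≤ _ := ENNReal.ofReal_le_ofReal (by linarith)

/-- `n L(b_n) = o(b_n)`, because `n = O(L(b_n))` and `L(b)^2 = o(b)`. -/
lemma SuplogAssumption.eventually_mul_L_le (h : SuplogAssumption ν a L) {m : ℝ} (hm : 1 < m)
    {K : ℝ} (hK : 0 ≤ K) :
    ∀ᶠ n : ℕ in atTop, K * n * L (centring ν m n) ≤ centring ν m n := by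
  have hlog : 0 < Real.log m := Real.log_pos hm
  have hb := h.tendsto_centring hm
  have h1 : Tendsto (fun x : ℝ => x ^ (1 / 2 : ℝ)) atTop atTop := tendsto_rpow_atTop (by norm_num)
  filter_upwards [h.eventually_le_L_centring hm, hb.eventually (h.eventually_le_rpow
    (δ := 1 / 4) (by norm_num)), hb.eventually_gt_atTop 0,
    (h1.comp hb).eventually_ge_atTop (K * (2 / Real.log m)),
    hb.eventually (h.tendsto_atTop.eventually_ge_atTop 0)] with n h2 h3 h4 h5 h6
  set b := centring ν m n
  have h7 : (n : ℝ) ≤ 2 / Real.log m * L b := by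
    rw [div_mul_eq_mul_div, le_div_iff₀ hlog]
    linarith
  have h5 : K * (2 / Real.log m) ≤ b ^ (1 / 2 : ℝ) := h5
  have h8 : L b * L b ≤ b ^ (1 / 2 : ℝ) := by
    calc L b * L b ≤ b ^ (1 / 4 : ℝ) * b ^ (1 / 4 : ℝ) := by gcongr
      _ = b ^ (1 / 2 : ℝ) := by rw [← Real.rpow_add h4]; norm_num
  calc K * n * L b ≤ K * (2 / Real.log m * L b) * L b := by gcongr
    _ = K * (2 / Real.log m) * (L b * L b) := by ring
    _ ≤ b ^ (1 / 2 : ℝ) * b ^ (1 / 2 : ℝ) := by gcongr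
    _ = b := by rw [← Real.rpow_add h4]; norm_num

variable {ι Ω : Type*} [MeasurableSpace Ω] {P : Measure Ω} [IsProbabilityMeasure P]
  {X : ι → Ω → ℝ}

omit [IsProbabilityMeasure P] [IsProbabilityMeasure ν] in
/-- A displacement may stop short of `b - C α` by `r`: this raises the tail by a factor
`e^{s min(r, b) / 2}` at most, where `s = L(b) / (2 b)`. -/
lemma measure_Ioi_max_le [IsFiniteMeasure ν] {A C α b δ r : ℝ} (hA : 0 ≤ A) (hC : 0 ≤ C)
    (hb : 0 < b) (hα : 0 ≤ α) (hL : 0 ≤ L b) (hδ : 0 ≤ δ) (hδC : δ * (C + 1) ≤ 1 / 16)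
    (hsub : ∀ u ∈ Set.Icc (b / 4) b, L b - L u ≤ 4 * δ * (L b / b) * (b - u))
    (htail : ∀ t ≥ b / 4, ν.real (Set.Ioi t) ≤ A * Real.exp (-L t)) (hr : α < r) :
    ν (Set.Ioi (max (b / 4) (b - C * α - r))) ≤
      ENNReal.ofReal (A * Real.exp (-L b) * Real.exp (L b / (2 * b) / 2 * min r b)) := by
  set u := max (b / 4) (b - C * α - r) with hu
  have hCα : 0 ≤ C * α := mul_nonneg hC hα
  have hu1 : b / 4 ≤ u := le_max_left _ _
  have hu2 : b - C * α - r ≤ u := le_max_right _ _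
  have hub : u ≤ b := max_le (by linarith) (by linarith)
  have h1 := hsub u ⟨hu1, hub⟩
  have h2 : b - u ≤ (C + 1) * min r b := by
    rcases le_total r b with hrb | hrb
    · rw [min_eq_left hrb]
      have : C * α ≤ C * r := by gcongr
      linarith
    · rw [min_eq_right hrb]
      have : 0 ≤ C * b := by positivity
      linarith
  have hmin0 : 0 ≤ min r b := le_min (by linarith) hb.le
  rw [← ofReal_measureReal]
  refine ENNReal.ofReal_le_ofReal ((htail u hu1).trans ?_)
  rw [mul_assoc, ← Real.exp_add]
  have h3 : 4 * δ * (L b / b) * (b - u) ≤ 4 * δ * (L b / b) * ((C + 1) * min r b) := by gcongr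
  have h4 : 4 * δ * (L b / b) * ((C + 1) * min r b) = 4 * (δ * (C + 1)) * (L b / b * min r b) := by
    ring
  have h5 : L b / (2 * b) / 2 * min r b = 1 / 4 * (L b / b * min r b) := by field_simp; ring
  have h6 : 0 ≤ L b / b * min r b := by positivity
  have h7 : 4 * (δ * (C + 1)) * (L b / b * min r b) ≤ 4 * (1 / 16) * (L b / b * min r b) := by gcongr
  gcongr
  linarith

/-- A walk of length `n` reaches the level `b_n - C a_n` without a single displacement above
`b_n - (C + 1) a_n` with probability `o(m^{-n})`. -/
lemma SuplogAssumption.eventually_measure_sum_le (h : SuplogAssumption ν a L)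
    (hX : ∀ i, Measurable (X i)) (hi : iIndepFun X P) (hlaw : ∀ i, P.map (X i) = ν) {m : ℝ}
    (hm : 1 < m) {C : ℝ} (hC : 0 ≤ C) {ε : ℝ} (hε : 0 < ε) :
    ∀ᶠ n : ℕ in atTop, ∀ J : Finset ι, J.card = n →
      P {ω | (∀ j ∈ J, X j ω ≤ centring ν m n - (C + 1) * scaling ν L m n) ∧
        centring ν m n - C * scaling ν L m n < ∑ j ∈ J, X j ω} ≤
        ENNReal.ofReal (ε * (m ^ n)⁻¹) := by
  obtain ⟨a₀, ha₀, hlim⟩ := h.prefactor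
  obtain ⟨A, hA, htail⟩ := h.exists_tail_le
  obtain ⟨C₀, hC₀, hmin⟩ := h.exists_lintegral_exp_min_le
  set M := a₀⁻¹ + 1 with hM
  have hMpos : 0 < M := by positivity
  have hb := h.tendsto_centring hm
  have hb4 : Tendsto (fun n => centring ν m n / 4) atTop atTop :=
    hb.atTop_div_const (by norm_num)
  -- `δ` is small enough for `L(b / 4) ≥ 9 L(b) / 10` and for `measure_Ioi_max_le`
  set δ := 1 / (30 * (C + 1)) with hδ
  have hδpos : 0 < δ := by positivity
  have hδ30 : δ ≤ 1 / 30 := by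
    rw [hδ]
    exact one_div_le_one_div_of_le (by norm_num) (by linarith)
  have hδC : δ * (C + 1) = 1 / 30 := by rw [hδ]; field_simp
  obtain ⟨x₁, hx₁, hmono⟩ := h.exists_strictMonoOn
  obtain ⟨t₁, ht₁⟩ := eventually_atTop.1 htail
  have hcube : Tendsto (fun n : ℕ => (n : ℝ) ^ 3) atTop atTop :=
    (tendsto_pow_atTop (by norm_num)).comp tendsto_natCast_atTop_atTop
  have hexp : Tendsto (fun n => M * Real.exp (1 - L (centring ν m n) / 4)) atTop (𝓝 0) := by
    have h1 : Tendsto (fun n => 1 - L (centring ν m n) / 4) atTop atBot := by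
      refine tendsto_const_nhds.add_atBot (tendsto_neg_atTop_atBot.comp ?_)
      exact (h.tendsto_atTop.comp hb).atTop_div_const (by norm_num)
    simpa using (Real.tendsto_exp_atBot.comp h1).const_mul M
  have hinv : Tendsto (fun n : ℕ => A * M * (4 / (n : ℝ))) atTop (𝓝 0) := by
    simpa using (tendsto_const_div_atTop_nhds_zero_nat (4 : ℝ)).const_mul (A * M)
  filter_upwards [(h.tendsto_pow_mul_exp hm ha₀ hlim).eventually (gt_mem_nhds (lt_add_one a₀⁻¹)),
    hb.eventually (h.eventually_sub_le hδpos), hb.eventually hmin, hb4.eventually hmin,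
    hb4.eventually_ge_atTop (max x₁ t₁), h.eventually_mul_L_le hm (K := 2 * C₀) (by positivity),
    h.eventually_scaling_pos hm, h.eventually_scaling_le hm (ε := 1 / (10 * (C + 1)))
      (by positivity), hb.eventually (h.tendsto_atTop.eventually_gt_atTop 0),
    h.eventually_pow_le_scaling hm 4, hcube.eventually (h.eventually_real_Ioi_le (K := 2)
      (by norm_num)), hexp.eventually (gt_mem_nhds (half_pos hε)),
    hinv.eventually (gt_mem_nhds (half_pos hε)), eventually_gt_atTop 0] with n e1 e2 e3 e4 e5 e6 e7
      e8 e9 e10 e11 e12 e13 hn J hJ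
  set b := centring ν m n with hbdef
  set α := scaling ν L m n with hαdef
  have hmn : 0 < m ^ n := by positivity
  have hn' : (0 : ℝ) < n := by exact_mod_cast hn
  have hn1 : (1 : ℝ) ≤ n := by exact_mod_cast hn
  have hx₁b : x₁ ≤ b / 4 := (le_max_left _ _).trans e5
  have ht₁b : t₁ ≤ b / 4 := (le_max_right _ _).trans e5
  have hb0 : 0 < b := by linarith
  have hexpM : Real.exp (-L b) ≤ M * (m ^ n)⁻¹ := by
    rw [← div_eq_mul_inv, le_div_iff₀ hmn]
    linarith
  have hL4 : 9 / 10 * L b ≤ L (b / 4) := by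
    have := e2 (b / 4) ⟨le_rfl, by linarith⟩
    have h2 : 4 * δ * (L b / b) * (b - b / 4) = 3 * δ * L b := by field_simp; ring
    rw [h2] at this
    nlinarith
  have hL4' : L (b / 4) ≤ L b :=
    hmono.monotoneOn (Set.mem_Ici.2 hx₁b) (Set.mem_Ici.2 (by linarith)) (by linarith)
  have hCα : C * α ≤ b / 10 := by
    calc C * α ≤ (C + 1) * (1 / (10 * (C + 1)) * b) := by gcongr; linarith
      _ = b / 10 := by field_simp
  set s₁ := L (b / 4) / (2 * (b / 4)) with hs₁
  set s₂ := L b / (2 * b) with hs₂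
  have hs₁0 : 0 ≤ s₁ := by
    have : 0 ≤ L (b / 4) := by linarith
    positivity
  have hs₂0 : 0 ≤ s₂ := by positivity
  have htail' : ∀ r, α < r → ν (Set.Ioi (max (b / 4) (b - C * α - r))) ≤
      ENNReal.ofReal (A * Real.exp (-L b) * Real.exp (s₂ / 2 * min r b)) := fun r hr =>
    measure_Ioi_max_le hA.le hC hb0 e7.le e9.le hδpos.le (by rw [hδC]; norm_num) e2
      (fun t ht => ht₁ t (ht₁b.trans ht)) hr
  have key := measure_sum_lt_of_forall_le_sub hX hi hlaw (C := C) hb0.le e7.le hs₁0 hs₂0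
    (mul_nonneg hA.le (Real.exp_pos (-L b)).le) (mul_nonneg hC₀ hs₂0) e4 e3 htail' hn hJ
  refine key.trans ?_
  have hν : ν (Set.Ioi (α / n)) ≤ ENNReal.ofReal (1 / (n : ℝ) ^ 6) := by
    calc ν (Set.Ioi (α / n)) ≤ ν (Set.Ioi ((n : ℝ) ^ 3)) := by
          refine measure_mono (Set.Ioi_subset_Ioi ?_)
          rw [le_div_iff₀ hn']
          linarith [e10, pow_succ (n : ℝ) 3]
      _ = ENNReal.ofReal (ν.real (Set.Ioi ((n : ℝ) ^ 3))) := (ofReal_measureReal).symm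
      _ ≤ _ := by
          refine ENNReal.ofReal_le_ofReal (e11.trans_eq ?_)
          rw [Real.rpow_neg (by positivity), one_div]
          norm_cast
          ring_nf
  have hsmall : n * (C₀ * s₂) ≤ 1 := by
    rw [hs₂]
    have : n * (C₀ * (L b / (2 * b))) = (2 * C₀ * n * L b) / (4 * b) := by field_simp; ring
    rw [this, div_le_one (by positivity)]
    linarith
  -- all displacements at most `b / 4`: as `s₁ b = 2 L(b / 4)`, Chernoff's bound is at most
  -- `e^{1 - 5 L(b) / 4}`, which is `o(m^{-n})`
  have hT1 : Real.exp (n * (C₀ * s₁) - s₁ * (b - C * α)) ≤ ε / 2 * (m ^ n)⁻¹ := by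
    have h1 : n * (C₀ * s₁) ≤ 1 := by
      have : n * (C₀ * s₁) = (2 * C₀ * n * L (b / 4)) / b := by rw [hs₁]; field_simp; ring
      rw [this, div_le_one hb0]
      refine le_trans ?_ e6
      gcongr
    have h2 : 5 / 4 * L b ≤ s₁ * (b - C * α) := by
      calc 5 / 4 * L b ≤ (2 * (9 / 10 * L b) / b) * (9 / 10 * b) := by
            have : (2 * (9 / 10 * L b) / b) * (9 / 10 * b) = 162 / 100 * L b := by
              field_simp; ring
            rw [this]
            nlinarith
        _ ≤ (2 * L (b / 4) / b) * (b - C * α) := by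
            have h3 : 0 ≤ L (b / 4) := by linarith
            gcongr
            linarith
        _ = s₁ * (b - C * α) := by rw [hs₁]; field_simp; ring
    calc Real.exp (n * (C₀ * s₁) - s₁ * (b - C * α)) ≤
          Real.exp (1 - L b / 4) * Real.exp (-L b) := by
          rw [← Real.exp_add]
          gcongr
          linarith
      _ ≤ Real.exp (1 - L b / 4) * (M * (m ^ n)⁻¹) := by gcongr
      _ = M * Real.exp (1 - L b / 4) * (m ^ n)⁻¹ := by ring
      _ ≤ _ := by gcongr
  -- one displacement above `b / 4`: the bound is `O(1 / n)` times `e^{-L(b)} = O(m^{-n})`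
  have hT2 : (n : ℝ≥0∞) * (ENNReal.ofReal (A * Real.exp (-L b) * n ^ 2) *
      (n * ν (Set.Ioi (α / n))) + ENNReal.ofReal (A * Real.exp (-L b) / n ^ 2 *
        Real.exp (n * (C₀ * s₂)))) ≤ ENNReal.ofReal (ε / 2 * (m ^ n)⁻¹) := by
    calc _ ≤ (n : ℝ≥0∞) * (ENNReal.ofReal (A * Real.exp (-L b) * n ^ 2) *
          (n * ENNReal.ofReal (1 / (n : ℝ) ^ 6)) + ENNReal.ofReal (A * Real.exp (-L b) / n ^ 2 *
            Real.exp 1)) := by gcongr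
      _ = ENNReal.ofReal (n * (A * Real.exp (-L b) * n ^ 2 * (n * (1 / n ^ 6)) +
            A * Real.exp (-L b) / n ^ 2 * Real.exp 1)) := by
          rw [← ENNReal.ofReal_natCast, ← ENNReal.ofReal_mul (by positivity),
            ← ENNReal.ofReal_mul (by positivity), ← ENNReal.ofReal_add (by positivity)
            (by positivity), ← ENNReal.ofReal_mul (by positivity)]
      _ ≤ _ := by
          refine ENNReal.ofReal_le_ofReal ?_
          have h1 : (n : ℝ) * (A * Real.exp (-L b) * n ^ 2 * (n * (1 / n ^ 6)) +
            A * Real.exp (-L b) / n ^ 2 * Real.exp 1) =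
              A * Real.exp (-L b) * ((1 / n + Real.exp 1) / n) := by
            field_simp
          have h2 : (1 / (n : ℝ) + Real.exp 1) ≤ 4 := by
            have h3 : 1 / (n : ℝ) ≤ 1 := (div_le_one hn').2 hn1
            linarith [Real.exp_one_lt_d9]
          rw [h1]
          calc A * Real.exp (-L b) * ((1 / n + Real.exp 1) / n) ≤
                A * (M * (m ^ n)⁻¹) * (4 / n) := by gcongr
            _ = A * M * (4 / n) * (m ^ n)⁻¹ := by ring
            _ ≤ _ := by gcongr
  calc _ ≤ ENNReal.ofReal (ε / 2 * (m ^ n)⁻¹) + ENNReal.ofReal (ε / 2 * (m ^ n)⁻¹) :=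
        add_le_add (ENNReal.ofReal_le_ofReal hT1) hT2
    _ = _ := by
        rw [← ENNReal.ofReal_add (by positivity) (by positivity)]
        ring_nf

omit [IsProbabilityMeasure P] in
/-- A walk of length `n` has a displacement above `b_n - C a_n` while its other displacements sum up
to more than `η a_n` with probability `o(m^{-n})`: the large displacement costs `O(m^{-n})`, and the
rest is independent of it and small compared with `a_n`, which outgrows all powers of `n`. -/
lemma SuplogAssumption.eventually_measure_sum_erase_le [DecidableEq ι] (h : SuplogAssumption ν a L)
    (hX : ∀ i, Measurable (X i)) (hi : iIndepFun X P) (hlaw : ∀ i, P.map (X i) = ν) {m : ℝ}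
    (hm : 1 < m) (C : ℝ) {η : ℝ} (hη : 0 < η) {ε : ℝ} (hε : 0 < ε) :
    ∀ᶠ n : ℕ in atTop, ∀ J : Finset ι, J.card = n →
      P {ω | ∃ i ∈ J, centring ν m n - C * scaling ν L m n < X i ω ∧
        η * scaling ν L m n < ∑ j ∈ J.erase i, |X j ω|} ≤ ENNReal.ofReal (ε * (m ^ n)⁻¹) := by
  obtain ⟨κ, hκ, htail⟩ := h.exists_abs_tail_le
  -- `P(|X| > n ^ K) = O(n^{-3})` leaves room for two union bounds over `n` steps
  obtain ⟨K, hK⟩ := exists_nat_ge (3 / κ)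
  have hK0 : 0 < K := by
    rcases Nat.eq_zero_or_pos K with rfl | h0
    · have : 0 < 3 / κ := by positivity
      simp only [Nat.cast_zero] at hK
      linarith
    · exact h0
  have hKκ : 3 ≤ K * κ := by rwa [div_le_iff₀ hκ] at hK
  have hpow : Tendsto (fun n : ℕ => (n : ℝ) ^ K) atTop atTop :=
    (tendsto_pow_atTop hK0.ne').comp tendsto_natCast_atTop_atTop
  have hinv : Tendsto (fun n : ℕ => (Real.exp C + 1) * (2 / (n : ℝ))) atTop (𝓝 0) := by
    simpa using (tendsto_const_div_atTop_nhds_zero_nat (2 : ℝ)).const_mul (Real.exp C + 1)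
  have htl := h.tendsto_pow_mul_tail hm (-C)
  rw [neg_neg] at htl
  filter_upwards [htl.eventually (gt_mem_nhds (lt_add_one _)), hpow.eventually htail,
    h.eventually_pow_le_scaling hm (K + 2), hinv.eventually (gt_mem_nhds hε),
    eventually_gt_atTop 0, tendsto_natCast_atTop_atTop.eventually_ge_atTop (1 / η)] with n e1 e2 e3
      e4 hn e5 J hJ
  set b := centring ν m n with hbdef
  set α := scaling ν L m n with hαdef
  have hmn : 0 < m ^ n := by positivity
  have hn' : (0 : ℝ) < n := by exact_mod_cast hn
  have hn1 : (1 : ℝ) ≤ n := by exact_mod_cast hn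
  have hα : 0 ≤ α := (by positivity : (0 : ℝ) ≤ (n : ℝ) ^ (K + 2)).trans e3
  have hηα : (n : ℝ) ^ K ≤ η * α / n := by
    rw [le_div_iff₀ hn']
    have h1 : 1 ≤ η * n := by rwa [div_le_iff₀ hη, mul_comm] at e5
    calc (n : ℝ) ^ K * n = (n : ℝ) ^ (K + 1) * 1 := by ring
      _ ≤ (n : ℝ) ^ (K + 1) * (η * n) := by gcongr
      _ = η * (n : ℝ) ^ (K + 2) := by ring
      _ ≤ η * α := by gcongr
  have hν1 : ν (Set.Ioi (b - C * α)) ≤ ENNReal.ofReal ((Real.exp C + 1) * (m ^ n)⁻¹) := by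
    rw [← ofReal_measureReal]
    refine ENNReal.ofReal_le_ofReal ?_
    rw [← div_eq_mul_inv, le_div_iff₀ hmn]
    have : b + -C * α = b - C * α := by ring
    rw [this] at e1
    linarith
  have hν2 : ν {x | η * α / n < |x|} ≤ ENNReal.ofReal (2 / (n : ℝ) ^ 3) := by
    refine (measure_mono fun x hx => ?_).trans (e2.trans (ENNReal.ofReal_le_ofReal ?_))
    · exact lt_of_le_of_lt hηα hx
    · rw [Real.rpow_neg (by positivity), ← div_eq_mul_inv, ← Real.rpow_natCast_mul hn'.le]
      gcongr
      calc (n : ℝ) ^ 3 = (n : ℝ) ^ (3 : ℝ) := by norm_cast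
        _ ≤ _ := Real.rpow_le_rpow_of_exponent_le hn1 hKκ
  have hone : ∀ i ∈ J, P {ω | b - C * α < X i ω ∧ η * α < ∑ j ∈ J.erase i, |X j ω|} ≤
      ENNReal.ofReal ((Real.exp C + 1) * (m ^ n)⁻¹) * (n * ENNReal.ofReal (2 / (n : ℝ) ^ 3)) := by
    intro i hiJ
    have hind := (indepFun_sum_erase hi hX (g := fun x => |x|) measurable_abs J i).symm
    have h1 := hind.measure_inter_preimage_eq_mul (Set.Ioi (b - C * α)) (Set.Ioi (η * α))
      measurableSet_Ioi measurableSet_Ioi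
    have h2 : P (X i ⁻¹' Set.Ioi (b - C * α)) = ν (Set.Ioi (b - C * α)) := by
      rw [← hlaw i, Measure.map_apply (hX i) measurableSet_Ioi]
    have hcard : (J.erase i).card ≤ n := hJ ▸ Finset.card_erase_le
    refine h1.le.trans ?_
    rw [h2]
    refine mul_le_mul' hν1 ?_
    refine (measure_lt_sum_le hX hlaw (g := fun x => |x|) measurable_abs hn hcard
      (by positivity)).trans ?_
    gcongr
  calc _ ≤ P (⋃ i ∈ J, {ω | b - C * α < X i ω ∧ η * α < ∑ j ∈ J.erase i, |X j ω|}) := by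
        refine measure_mono fun ω hω => ?_
        obtain ⟨i, hiJ, hω⟩ := hω
        exact Set.mem_biUnion hiJ hω
    _ ≤ n * (ENNReal.ofReal ((Real.exp C + 1) * (m ^ n)⁻¹) *
          (n * ENNReal.ofReal (2 / (n : ℝ) ^ 3))) := by
        refine (measure_biUnion_finset_le _ _).trans ((Finset.sum_le_sum hone).trans_eq ?_)
        rw [Finset.sum_const, nsmul_eq_mul, hJ]
    _ = ENNReal.ofReal ((Real.exp C + 1) * (2 / n) * (m ^ n)⁻¹) := by
        rw [← ENNReal.ofReal_natCast, ← ENNReal.ofReal_mul (by positivity),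
          ← ENNReal.ofReal_mul (by positivity), ← ENNReal.ofReal_mul (by positivity)]
        congr 1
        field_simp
    _ ≤ _ := ENNReal.ofReal_le_ofReal (by gcongr)

end Asymptotics

/-! ### Ancestral lines and the many-to-one bound -/

section Path

/-- The ancestral line of a particle, without the root. -/
def path : Label → Finset NonRoot
  | [] => ∅
  | i :: x => insert ⟨i :: x, List.cons_ne_nil i x⟩ (path x)

lemma length_le_of_mem_path {x : Label} {y : NonRoot} (hy : y ∈ path x) :
    y.1.length ≤ x.length := by
  induction x with
  | nil => simp [path] at hy
  | cons i x ih =>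
    rcases Finset.mem_insert.1 hy with rfl | hy
    · rfl
    · exact (ih hy).trans (by simp)

lemma cons_notMem_path (i : ℕ) (x : Label) : ⟨i :: x, List.cons_ne_nil i x⟩ ∉ path x := fun h => by
  have := length_le_of_mem_path h
  simp at this

lemma card_path (x : Label) : (path x).card = x.length := by
  induction x with
  | nil => rfl
  | cons i x ih => rw [path, Finset.card_insert_of_notMem (cons_notMem_path i x), ih]; rfl

/-- The ancestors of `x` are its tails `x.drop l`. -/
lemma exists_drop_of_mem_path {x : Label} {y : NonRoot} (hy : y ∈ path x) :
    ∃ l < x.length, x.drop l = y.1 := by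
  induction x with
  | nil => simp [path] at hy
  | cons i x ih =>
    rcases Finset.mem_insert.1 hy with rfl | hy
    · exact ⟨0, by simp, rfl⟩
    · obtain ⟨l, hl, h⟩ := ih hy
      exact ⟨l + 1, by simpa using hl, h⟩

variable {Ω : Type*} {N : Label → Ω → ℕ} {X : NonRoot → Ω → ℝ} {ω : Ω}

variable (X ω) in
/-- The displacement of a particle, with the value `0` for the root. -/
def disp : Label → ℝ
  | [] => 0
  | i :: x => X ⟨i :: x, List.cons_ne_nil i x⟩ ω

lemma disp_coe (y : NonRoot) : disp X ω y.1 = X y ω := by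
  obtain ⟨y, hy⟩ := y
  cases y with
  | nil => exact absurd rfl hy
  | cons i x => rfl

lemma position_eq_sum (x : Label) : position X ω x = ∑ y ∈ path x, X y ω := by
  induction x with
  | nil => rfl
  | cons i x ih =>
    rw [path, Finset.sum_insert (cons_notMem_path i x), ← ih, position, add_comm]

lemma drop_mem_treeGen {n l : ℕ} {x : Label} (hx : x ∈ treeGen N ω n) :
    x.drop l ∈ treeGen N ω (n - l) := by
  rw [mem_treeGen] at hx ⊢
  refine ⟨by rw [List.length_drop, hx.1], ?_⟩
  have h := (inTree_append (N := N) (ω := ω) (x.take l) (x.drop l)).1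
  rw [List.take_append_drop] at h
  exact (h hx.2).1

end Path

section ManyToOne

variable {Ω : Type*} [mΩ : MeasurableSpace Ω] {P : Measure Ω} [IsProbabilityMeasure P]
  {p : Measure ℕ} {ν : Measure ℝ} {N : Label → Ω → ℕ} {X : NonRoot → Ω → ℝ}

/-- The information carried by the displacements. -/
@[reducible] def sigmaX (X : NonRoot → Ω → ℝ) : MeasurableSpace Ω :=
  MeasurableSpace.comap (fun ω y => X y ω) inferInstance

/-- The information carried by the tree. -/
@[reducible] def sigmaTree (N : Label → Ω → ℕ) : MeasurableSpace Ω :=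
  MeasurableSpace.comap (fun ω u => N u ω) inferInstance

omit mΩ in
lemma measurable_sigmaX (y : NonRoot) : Measurable[sigmaX X] (X y) :=
  (measurable_pi_apply y).comp (comap_measurable (fun ω y => X y ω))

omit mΩ in
lemma measurable_sigmaTree (u : Label) : Measurable[sigmaTree N] (N u) :=
  (measurable_pi_apply u).comp (comap_measurable (fun ω u => N u ω))

omit mΩ in
lemma measurable_disp (y : Label) : Measurable[sigmaX X] fun ω => disp X ω y := by
  cases y with
  | nil => exact measurable_const
  | cons i x => exact measurable_sigmaX _

omit [IsProbabilityMeasure P] in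
lemma IsBranchingRandomWalk.sigmaX_le (hB : IsBranchingRandomWalk p ν N X P) : sigmaX X ≤ mΩ :=
  (measurable_pi_lambda _ hB.measurable_displacement).comap_le

omit [IsProbabilityMeasure P] in
lemma IsBranchingRandomWalk.sigmaTree_le (hB : IsBranchingRandomWalk p ν N X P) :
    sigmaTree N ≤ mΩ :=
  (measurable_pi_lambda _ hB.measurable_offspring).comap_le

omit [IsProbabilityMeasure P] in
lemma IsBranchingRandomWalk.indep_sigmaTree_sigmaX (hB : IsBranchingRandomWalk p ν N X P) :
    Indep (sigmaTree N) (sigmaX X) P :=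
  (IndepFun_iff_Indep _ _ _).1 hB.indep

omit mΩ in
lemma measurableSet_inTree_sigmaTree (x : Label) :
    MeasurableSet[sigmaTree N] {ω | InTree N ω x} :=
  measurableSet_inTree (mΩ := sigmaTree N) x.length (fun u _ => measurable_sigmaTree u) x le_rfl

omit [IsProbabilityMeasure P] in
lemma IsBranchingRandomWalk.measure_lt_disp (hB : IsBranchingRandomWalk p ν N X P) {y : Label}
    (hy : y ≠ []) (u : ℝ) : P {ω | u < disp X ω y} = ν (Set.Ioi u) := by
  rw [← hB.law_displacement ⟨y, hy⟩, Measure.map_apply (hB.measurable_displacement _)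
    measurableSet_Ioi]
  congr 1
  ext ω
  simp [← disp_coe (X := X) (ω := ω) ⟨y, hy⟩]

omit [IsProbabilityMeasure P] in
lemma IsBranchingRandomWalk.measurable_sum_treeGen_ennreal (hB : IsBranchingRandomWalk p ν N X P)
    (n : ℕ) {F : Label → Ω → ℝ≥0∞} (hF : ∀ x, Measurable[sigmaX X] (F x)) :
    Measurable fun ω => ∑ x ∈ treeGen N ω n, F x ω := by
  classical
  simp_rw [coe_sum_treeGen]
  refine Measurable.tsum fun x => Measurable.ite ?_ ((hF x).mono hB.sigmaX_le le_rfl)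
    measurable_const
  exact hB.sigmaTree_le _ (measurableSet_inTree_sigmaTree x.1)

/-- The many-to-one bound: a sum over generation `n` of functionals of the displacements has mean at
most `m ^ n` times the bound for a single label. -/
lemma IsBranchingRandomWalk.lintegral_sum_treeGen_le (hB : IsBranchingRandomWalk p ν N X P)
    (hp : OffspringAssumption p) (n : ℕ) {F : Label → Ω → ℝ≥0∞}
    (hF : ∀ x, Measurable[sigmaX X] (F x)) {q : ℝ≥0∞}
    (hq : ∀ x : Label, x.length = n → ∫⁻ ω, F x ω ∂P ≤ q) :
    ∫⁻ ω, ∑ x ∈ treeGen N ω n, F x ω ∂P ≤ ENNReal.ofReal (offspringMean p ^ n) * q := by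
  classical
  have hin : ∀ x : Label, MeasurableSet {ω | InTree N ω x} := fun x =>
    hB.sigmaTree_le _ (measurableSet_inTree_sigmaTree x)
  have e1 : ∀ x : {x : Label // x.length = n},
      ∫⁻ ω, (if InTree N ω x then F x ω else 0) ∂P =
        P {ω | InTree N ω x} * ∫⁻ ω, F x ω ∂P := by
    intro x
    have h1 := lintegral_mul_eq_lintegral_mul_lintegral_of_independent_measurableSpace
      hB.sigmaTree_le hB.sigmaX_le hB.indep_sigmaTree_sigmaX
      (f := {ω | InTree N ω x}.indicator fun _ => 1) (g := F x)
      (measurable_const.indicator (measurableSet_inTree_sigmaTree x.1)) (hF x)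
    rw [lintegral_indicator_const (hin x), one_mul] at h1
    rw [← h1]
    refine lintegral_congr fun ω => ?_
    by_cases hω : InTree N ω x <;> simp [Set.indicator, hω]
  have e2 : ∑' x : {x : Label // x.length = n}, P {ω | InTree N ω x} =
      ENNReal.ofReal (offspringMean p ^ n) := by
    rw [← hB.lintegral_gwSize hp n]
    simp_rw [gwSize_eq_card, Finset.card_eq_sum_ones]
    push_cast
    simp_rw [coe_sum_treeGen n fun _ => 1]
    have hm : ∀ x : {x : Label // x.length = n},
        Measurable fun ω => if InTree N ω x.1 then (1 : ℝ≥0∞) else 0 := fun x =>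
      Measurable.ite (hin x.1) measurable_const measurable_const
    rw [lintegral_tsum fun x => (hm x).aemeasurable]
    refine tsum_congr fun x => ?_
    rw [← lintegral_indicator_one (hin x)]
    refine lintegral_congr fun ω => ?_
    by_cases hω : InTree N ω x <;> simp [Set.indicator, hω]
  simp_rw [coe_sum_treeGen]
  have hm : ∀ x : {x : Label // x.length = n},
      Measurable fun ω => if InTree N ω x.1 then F x.1 ω else 0 := fun x =>
    Measurable.ite (hin x.1) ((hF x.1).mono hB.sigmaX_le le_rfl) measurable_const
  rw [lintegral_tsum fun x => (hm x).aemeasurable]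
  simp_rw [e1]
  rw [← e2, ← ENNReal.tsum_mul_right]
  exact ENNReal.tsum_le_tsum fun x => mul_le_mul_right (hq x x.2) _

end ManyToOne

/-! ### One large displacement decides the position of a particle -/

section Deterministic

variable {ι : Type*} {φ : ℝ → ℝ} {C η w b α : ℝ} {J : Finset ι} {Y : ι → ℝ}

/-- Without a large displacement, and with the position below `b - C α`, the test function sees neither
the position nor any displacement. -/
lemma sub_sum_eq_zero_of_small (hφ : ∀ t ≤ -C, φ t = 0) (hα : 0 < α)
    (h1 : ∀ j ∈ J, Y j ≤ b - (C + 1) * α) (h2 : ∑ j ∈ J, Y j ≤ b - C * α) :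
    φ ((∑ j ∈ J, Y j - b) / α) - ∑ j ∈ J, φ ((Y j - b) / α) = 0 := by
  rw [hφ _ (by rw [div_le_iff₀ hα]; linarith), Finset.sum_eq_zero, sub_zero]
  intro j hj
  refine hφ _ ?_
  rw [div_le_iff₀ hα]
  linarith [h1 j hj]

/-- If a single displacement `Y i` dominates, the position is close to it and the test function does not
see the other displacements. -/
lemma abs_sub_sum_le_of_large [DecidableEq ι] (hφ : ∀ t ≤ -C, φ t = 0)
    (hw : ∀ s t, |s - t| ≤ η → |φ s - φ t| ≤ w) (hα : 0 < α) (hη : η * α ≤ b - C * α) {i : ι}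
    (hi : i ∈ J) (hsum : ∑ j ∈ J.erase i, |Y j| ≤ η * α) :
    |φ ((∑ j ∈ J, Y j - b) / α) - ∑ j ∈ J, φ ((Y j - b) / α)| ≤ w := by
  have h1 : ∑ j ∈ J.erase i, φ ((Y j - b) / α) = 0 := by
    refine Finset.sum_eq_zero fun j hj => hφ _ ?_
    rw [div_le_iff₀ hα]
    have := (le_abs_self (Y j)).trans (Finset.single_le_sum (f := fun j => |Y j|)
      (fun j _ => abs_nonneg _) hj)
    linarith
  rw [← Finset.add_sum_erase J (fun j => φ ((Y j - b) / α)) hi, h1, add_zero]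
  refine hw _ _ ?_
  rw [← sub_div, abs_div, abs_of_pos hα, div_le_iff₀ hα, ← Finset.add_sum_erase J Y hi]
  have e : Y i + ∑ j ∈ J.erase i, Y j - b - (Y i - b) = ∑ j ∈ J.erase i, Y j := by ring
  rw [e]
  exact (Finset.abs_sum_le_sum_abs _ _).trans hsum

/-- The event that the position reached along the family `J` is not decided by a single large
displacement: either the position is above `b - C α` with all displacements below `b - (C + 1) α`,
or there is a displacement above `b - (C + 1) α` and the others do not sum up to at most `η α`. -/
def badSet [DecidableEq ι] {Ω : Type*} (X : ι → Ω → ℝ) (b α C η : ℝ) (J : Finset ι) : Set Ω :=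
  {ω | (∀ j ∈ J, X j ω ≤ b - (C + 1) * α) ∧ b - C * α < ∑ j ∈ J, X j ω} ∪
    {ω | ∃ i ∈ J, b - (C + 1) * α < X i ω ∧ η * α < ∑ j ∈ J.erase i, |X j ω|}

lemma measurableSet_badSet [DecidableEq ι] {Ω : Type*} [MeasurableSpace Ω] {X : ι → Ω → ℝ}
    (hX : ∀ i, Measurable (X i)) (b α C η : ℝ) (J : Finset ι) :
    MeasurableSet (badSet X b α C η J) := by
  have e1 : {ω | (∀ j ∈ J, X j ω ≤ b - (C + 1) * α) ∧ b - C * α < ∑ j ∈ J, X j ω} =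
      (⋂ j ∈ J, {ω | X j ω ≤ b - (C + 1) * α}) ∩ {ω | b - C * α < ∑ j ∈ J, X j ω} := by
    ext ω; simp
  have e2 : {ω | ∃ i ∈ J, b - (C + 1) * α < X i ω ∧ η * α < ∑ j ∈ J.erase i, |X j ω|} =
      ⋃ i ∈ J, ({ω | b - (C + 1) * α < X i ω} ∩ {ω | η * α < ∑ j ∈ J.erase i, |X j ω|}) := by
    ext ω
    simp only [Set.mem_ofPred_eq, Set.mem_iUnion, Set.mem_inter_iff, exists_prop]
  unfold badSet
  rw [e1, e2]
  refine MeasurableSet.union (MeasurableSet.inter (Finset.measurableSet_biInter _ fun j _ =>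
    measurableSet_le (hX j) measurable_const) (measurableSet_lt measurable_const
      (Finset.measurable_sum _ fun j _ => hX j))) (Finset.measurableSet_biUnion _ fun i _ =>
    (measurableSet_lt measurable_const (hX i)).inter (measurableSet_lt measurable_const
      (Finset.measurable_sum _ fun j _ => measurable_abs.comp (hX j))))

end Deterministic

section Comparison

variable {Ω : Type*} [mΩ : MeasurableSpace Ω] {P : Measure Ω} [IsProbabilityMeasure P]
  {p : Measure ℕ} {ν : Measure ℝ} {N : Label → Ω → ℕ} {X : NonRoot → Ω → ℝ}

/-- The sum of `φ` over the positions of the particles of generation `n`. -/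
noncomputable def walkSum (N : Label → Ω → ℕ) (X : NonRoot → Ω → ℝ) (φ : ℝ → ℝ) (n : ℕ) (ω : Ω) :
    ℝ :=
  ∑ x ∈ treeGen N ω n, φ (position X ω x)

/-- The sum of `φ` over the displacements on the ancestral lines of the particles of
generation `n`. -/
noncomputable def jumpSum (N : Label → Ω → ℕ) (X : NonRoot → Ω → ℝ) (φ : ℝ → ℝ) (n : ℕ) (ω : Ω) :
    ℝ :=
  ∑ x ∈ treeGen N ω n, ∑ y ∈ path x, φ (X y ω)

omit mΩ in
/-- The two functionals differ by at most `1` in any case. If no ancestral line is bad and no particle of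
the first `n - K` generations has a large displacement, they differ by at most `w` for each pair of a
particle of generation `n` and one of its last `K` ancestors having a large displacement. -/
lemma ofReal_abs_exp_walkSum_sub_le {φ : ℝ → ℝ} (hφ0 : ∀ t, 0 ≤ φ t) {C η w b α : ℝ}
    (hφ : ∀ t ≤ -C, φ t = 0) (hw : ∀ s t, |s - t| ≤ η → |φ s - φ t| ≤ w) (hα : 0 < α)
    (hη : η * α ≤ b - C * α) {n K : ℕ} (hK : K ≤ n) (ω : Ω) :
    ENNReal.ofReal |Real.exp (-walkSum N X (fun t => φ ((t - b) / α)) n ω) -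
        Real.exp (-jumpSum N X (fun t => φ ((t - b) / α)) n ω)| ≤
      (∑ x ∈ treeGen N ω n, (badSet X b α C η (path x)).indicator 1 ω) +
      (∑ k ∈ Finset.range (n - K), ∑ y ∈ treeGen N ω (k + 1),
        {ω | b - (C + 1) * α < disp X ω y}.indicator 1 ω) +
      ∑ x ∈ treeGen N ω n, ∑ l ∈ Finset.range K,
        {ω | b - (C + 1) * α < disp X ω (x.drop l)}.indicator (fun _ => ENNReal.ofReal w) ω := by
  set V := walkSum N X (fun t => φ ((t - b) / α)) n ω with hV
  set VF := jumpSum N X (fun t => φ ((t - b) / α)) n ω with hVF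
  have hV0 : 0 ≤ V := Finset.sum_nonneg fun _ _ => hφ0 _
  have hVF0 : 0 ≤ VF := Finset.sum_nonneg fun _ _ => Finset.sum_nonneg fun _ _ => hφ0 _
  have hone : ENNReal.ofReal |Real.exp (-V) - Real.exp (-VF)| ≤ 1 := by
    rw [← ENNReal.ofReal_one]
    refine ENNReal.ofReal_le_ofReal (abs_le.2 ⟨?_, ?_⟩)
    · linarith [Real.exp_pos (-V), Real.exp_le_one_iff.2 (neg_nonpos.2 hVF0)]
    · linarith [Real.exp_pos (-VF), Real.exp_le_one_iff.2 (neg_nonpos.2 hV0)]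
  by_cases hbad : ∃ x ∈ treeGen N ω n, ω ∈ badSet X b α C η (path x)
  · obtain ⟨x, hx, hxb⟩ := hbad
    refine hone.trans ?_
    have h1 := Finset.single_le_sum (f := fun x => (badSet X b α C η (path x)).indicator
      (1 : Ω → ℝ≥0∞) ω) (fun _ _ => zero_le) hx
    simp only [Set.indicator_of_mem hxb, Pi.one_apply] at h1
    exact h1.trans (le_add_right (le_add_right le_rfl))
  by_cases hearly : ∃ k < n - K, ∃ y ∈ treeGen N ω (k + 1), b - (C + 1) * α < disp X ω y
  · obtain ⟨k, hk, y, hy, hyu⟩ := hearly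
    refine hone.trans ?_
    have h1 := Finset.single_le_sum (f := fun y => {ω | b - (C + 1) * α < disp X ω y}.indicator
      (1 : Ω → ℝ≥0∞) ω) (fun _ _ => zero_le) hy
    have h2 := Finset.single_le_sum (f := fun k => ∑ y ∈ treeGen N ω (k + 1),
      {ω | b - (C + 1) * α < disp X ω y}.indicator (1 : Ω → ℝ≥0∞) ω) (fun _ _ => zero_le)
      (Finset.mem_range.2 hk)
    simp only [Set.indicator_of_mem (show ω ∈ {ω | b - (C + 1) * α < disp X ω y} from hyu),
      Pi.one_apply] at h1
    exact (h1.trans h2).trans (le_add_right (le_add_left le_rfl))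
  push Not at hbad hearly
  refine le_add_left ?_
  have hdiff : |Real.exp (-V) - Real.exp (-VF)| ≤ ∑ x ∈ treeGen N ω n,
      |φ ((position X ω x - b) / α) - ∑ y ∈ path x, φ ((X y ω - b) / α)| := by
    refine (abs_exp_neg_sub_exp_neg_le hV0 hVF0).trans ?_
    rw [hV, hVF, walkSum, jumpSum, ← Finset.sum_sub_distrib]
    exact Finset.abs_sum_le_sum_abs _ _
  refine (ENNReal.ofReal_le_ofReal hdiff).trans ?_
  rw [ENNReal.ofReal_sum_of_nonneg fun _ _ => abs_nonneg _]
  refine Finset.sum_le_sum fun x hx => ?_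
  have hxb := hbad x hx
  simp only [badSet, Set.mem_union, not_or] at hxb
  rw [position_eq_sum]
  by_cases hlarge : ∃ i ∈ path x, b - (C + 1) * α < X i ω
  · obtain ⟨i, hi, hiu⟩ := hlarge
    have hsum : ∑ j ∈ (path x).erase i, |X j ω| ≤ η * α := by
      by_contra hcon
      exact hxb.2 ⟨i, hi, hiu, not_le.1 hcon⟩
    have h1 := abs_sub_sum_le_of_large (Y := fun y => X y ω) hφ hw hα hη hi hsum
    obtain ⟨l, hl, hli⟩ := exists_drop_of_mem_path hi
    rw [(mem_treeGen.1 hx).1] at hl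
    have hdl : b - (C + 1) * α < disp X ω (x.drop l) := by rw [hli, disp_coe]; exact hiu
    have hlK : l < K := by
      by_contra hcon
      refine absurd hdl (not_lt.2 (hearly (n - l - 1) (by omega) _ ?_))
      have : n - l - 1 + 1 = n - l := by omega
      rw [this]
      exact drop_mem_treeGen hx
    have h2 := Finset.single_le_sum (f := fun l => {ω | b - (C + 1) * α <
      disp X ω (x.drop l)}.indicator (fun _ => ENNReal.ofReal w) ω) (fun _ _ => zero_le)
      (Finset.mem_range.2 hlK)
    simp only [Set.indicator_of_mem
      (show ω ∈ {ω | b - (C + 1) * α < disp X ω (x.drop l)} from hdl)] at h2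
    exact (ENNReal.ofReal_le_ofReal h1).trans h2
  · push Not at hlarge
    have hsum : ∑ j ∈ path x, X j ω ≤ b - C * α := by
      by_contra hcon
      exact hxb.1 ⟨hlarge, not_le.1 hcon⟩
    rw [sub_sum_eq_zero_of_small (Y := fun y => X y ω) hφ hα hlarge hsum, abs_zero,
      ENNReal.ofReal_zero]
    exact zero_le

/-- The comparison of the positions with the large displacements, in mean. -/
lemma IsBranchingRandomWalk.lintegral_abs_exp_walkSum_sub_le (hB : IsBranchingRandomWalk p ν N X P)
    (hp : OffspringAssumption p) {φ : ℝ → ℝ} (hφ0 : ∀ t, 0 ≤ φ t) {C η w b α : ℝ}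
    (hφ : ∀ t ≤ -C, φ t = 0) (hw : ∀ s t, |s - t| ≤ η → |φ s - φ t| ≤ w) (hα : 0 < α)
    (hη : η * α ≤ b - C * α) {n K : ℕ} (hK : K ≤ n) {q : ℝ≥0∞}
    (hq : ∀ x : Label, x.length = n → P (badSet X b α C η (path x)) ≤ q) :
    ∫⁻ ω, ENNReal.ofReal |Real.exp (-walkSum N X (fun t => φ ((t - b) / α)) n ω) -
        Real.exp (-jumpSum N X (fun t => φ ((t - b) / α)) n ω)| ∂P ≤
      ENNReal.ofReal (offspringMean p ^ n) * q +
      (∑ k ∈ Finset.range (n - K), ENNReal.ofReal (offspringMean p ^ (k + 1)) *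
        ν (Set.Ioi (b - (C + 1) * α))) +
      ENNReal.ofReal (offspringMean p ^ n) *
        (K * (ENNReal.ofReal w * ν (Set.Ioi (b - (C + 1) * α)))) := by
  set u := b - (C + 1) * α with hu
  have hset : ∀ y : Label, MeasurableSet[sigmaX X] {ω | u < disp X ω y} := fun y =>
    measurableSet_lt (mα := inferInstance) measurable_const (measurable_disp y)
  have hbset : ∀ x : Label, MeasurableSet[sigmaX X] (badSet X b α C η (path x)) := fun x =>
    letI := sigmaX X
    measurableSet_badSet measurable_sigmaX _ _ _ _ _
  have hF1 : ∀ x : Label, Measurable[sigmaX X]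
      ((badSet X b α C η (path x)).indicator (1 : Ω → ℝ≥0∞)) := fun x =>
    Measurable.indicator measurable_const (hbset x)
  have hF2 : ∀ y : Label, Measurable[sigmaX X]
      ({ω | u < disp X ω y}.indicator (1 : Ω → ℝ≥0∞)) := fun y =>
    Measurable.indicator measurable_const (hset y)
  have hF3 : ∀ x : Label, Measurable[sigmaX X] fun ω => ∑ l ∈ Finset.range K,
      {ω | u < disp X ω (x.drop l)}.indicator (fun _ => ENNReal.ofReal w) ω := fun x =>
    Finset.measurable_sum _ fun l _ => Measurable.indicator measurable_const (hset _)
  refine (lintegral_mono fun ω => ofReal_abs_exp_walkSum_sub_le hφ0 hφ hw hα hη hK ω).trans ?_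
  rw [lintegral_add_right _ (hB.measurable_sum_treeGen_ennreal n hF3),
    lintegral_add_left (hB.measurable_sum_treeGen_ennreal n hF1),
    lintegral_finsetSum _ fun k _ => hB.measurable_sum_treeGen_ennreal (k + 1) hF2]
  refine add_le_add (add_le_add ?_ (Finset.sum_le_sum fun k _ => ?_)) ?_
  · refine hB.lintegral_sum_treeGen_le hp n hF1 fun x hx => ?_
    rw [lintegral_indicator_one (hB.sigmaX_le _ (hbset x))]
    exact hq x hx
  · refine hB.lintegral_sum_treeGen_le hp (k + 1) hF2 fun y hy => ?_
    rw [lintegral_indicator_one (hB.sigmaX_le _ (hset y)),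
      hB.measure_lt_disp (List.ne_nil_of_length_pos (by omega))]
  · refine hB.lintegral_sum_treeGen_le hp n hF3 fun x hx => ?_
    rw [lintegral_finsetSum _ fun l _ =>
      (Measurable.indicator measurable_const (hB.sigmaX_le _ (hset (x.drop l))))]
    calc _ = ∑ l ∈ Finset.range K, ENNReal.ofReal w * ν (Set.Ioi u) := by
          refine Finset.sum_congr rfl fun l hl => ?_
          rw [lintegral_indicator_const (hB.sigmaX_le _ (hset _)), hB.measure_lt_disp]
          have := Finset.mem_range.1 hl
          exact List.ne_nil_of_length_pos (by rw [List.length_drop]; omega)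
      _ ≤ _ := by rw [Finset.sum_const, nsmul_eq_mul, Finset.card_range]

/-- The positions of the particles may be replaced by the large displacements on their ancestral
lines. -/
theorem IsBranchingRandomWalk.tendsto_lintegral_abs_exp_walkSum_sub
    (hB : IsBranchingRandomWalk p ν N X P) (hp : OffspringAssumption p) {a L : ℝ → ℝ}
    (hν : SuplogAssumption ν a L) (f : C_c(RBar, ℝ≥0)) :
    Tendsto (fun n => ∫⁻ ω, ENNReal.ofReal
      |Real.exp (-walkSum N X (fun t => realTest f ((t - centring ν (offspringMean p) n) /
          scaling ν L (offspringMean p) n)) n ω) -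
        Real.exp (-jumpSum N X (fun t => realTest f ((t - centring ν (offspringMean p) n) /
          scaling ν L (offspringMean p) n)) n ω)| ∂P) atTop (𝓝 0) := by
  have := hB.isProbabilityMeasure_displacement
  set m := offspringMean p with hm
  have hm1 : 1 < m := hp.one_lt_mean
  have hm0 : 0 < m := hp.mean_pos
  obtain ⟨c₀, hc₀⟩ := exists_realTest_eq_zero f
  set C := max (-c₀) 0 with hC
  have hC0 : 0 ≤ C := le_max_right _ _
  have hφ : ∀ t ≤ -C, realTest f t = 0 := fun t ht =>
    hc₀ t (by linarith [le_max_left (-c₀) 0])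
  set c := Real.exp (C + 1) + 1 with hc
  have hcpos : 0 < c := by positivity
  have main : ∀ ε : ℝ, 0 < ε → ∀ᶠ n in atTop, ∫⁻ ω, ENNReal.ofReal
      |Real.exp (-walkSum N X (fun t => realTest f ((t - centring ν m n) / scaling ν L m n)) n ω) -
        Real.exp (-jumpSum N X (fun t => realTest f ((t - centring ν m n) / scaling ν L m n)) n ω)|
      ∂P ≤ ENNReal.ofReal ε := by
    intro ε hε
    -- `K` is chosen such that with high probability no particle born more than `K` generations before
    -- generation `n` has a large displacement; `w` is the oscillation allowed to the test function
    have hgeom : Tendsto (fun K : ℕ => c * (m / (m - 1)) * (m⁻¹) ^ K) atTop (𝓝 0) := by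
      simpa using (tendsto_pow_atTop_nhds_zero_of_lt_one (by positivity)
        (inv_lt_one_of_one_lt₀ hm1)).const_mul (c * (m / (m - 1)))
    obtain ⟨K, hK⟩ := (hgeom.eventually (gt_mem_nhds (show 0 < ε / 4 by positivity))).exists
    set w := ε / (4 * c * (K + 1)) with hw
    have hwpos : 0 < w := by positivity
    obtain ⟨η₀, hη₀, hη⟩ := Metric.uniformContinuous_iff.1 (uniformContinuous_realTest f) w hwpos
    set η := η₀ / 2 with hηdef
    have hηpos : 0 < η := by positivity
    have hunif : ∀ s t, |s - t| ≤ η → |realTest f s - realTest f t| ≤ w := by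
      intro s t hst
      have := hη (a := s) (b := t) (by rw [Real.dist_eq]; linarith)
      rw [Real.dist_eq] at this
      exact this.le
    have htl := hν.tendsto_pow_mul_tail hm1 (-(C + 1))
    rw [neg_neg] at htl
    filter_upwards [hν.eventually_measure_sum_le hB.measurable_displacement hB.iIndep_displacement
      hB.law_displacement hm1 hC0 (show 0 < ε / 4 by positivity),
      hν.eventually_measure_sum_erase_le hB.measurable_displacement hB.iIndep_displacement
      hB.law_displacement hm1 (C + 1) hηpos (show 0 < ε / 4 by positivity),
      hν.eventually_scaling_pos hm1, hν.eventually_scaling_le hm1 (ε := 1 / (η + C))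
        (by positivity), htl.eventually (gt_mem_nhds (lt_add_one _)), eventually_ge_atTop K]
      with n e1 e2 e3 e4 e5 hKn
    set b := centring ν m n
    set α := scaling ν L m n
    have hmn : 0 < m ^ n := by positivity
    have hηα : η * α ≤ b - C * α := by
      have h1 : (η + C) * α ≤ b := by
        rw [one_div_mul_eq_div, le_div_iff₀ (by positivity)] at e4
        linarith
      linarith
    have hq : ∀ x : Label, x.length = n →
        P (badSet X b α C η (path x)) ≤ ENNReal.ofReal (ε / 2 * (m ^ n)⁻¹) := by
      intro x hx
      have hcard : (path x).card = n := by rw [card_path, hx]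
      refine (measure_union_le _ _).trans ((add_le_add (e1 _ hcard) (e2 _ hcard)).trans_eq ?_)
      rw [← ENNReal.ofReal_add (by positivity) (by positivity)]
      ring_nf
    have hu : ν (Set.Ioi (b - (C + 1) * α)) ≤ ENNReal.ofReal (c * (m ^ n)⁻¹) := by
      rw [← ofReal_measureReal]
      refine ENNReal.ofReal_le_ofReal ?_
      rw [← div_eq_mul_inv, le_div_iff₀ hmn]
      have h1 : b + -(C + 1) * α = b - (C + 1) * α := by ring
      rw [h1] at e5
      linarith
    refine (hB.lintegral_abs_exp_walkSum_sub_le hp (realTest_nonneg f) hφ hunif e3 hηα hKn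
      hq).trans ?_
    rw [← hm]
    have hT1 : ENNReal.ofReal (m ^ n) * ENNReal.ofReal (ε / 2 * (m ^ n)⁻¹) =
        ENNReal.ofReal (ε / 2) := by
      rw [← ENNReal.ofReal_mul hmn.le]
      congr 1
      field_simp
    have hT2 : ∑ k ∈ Finset.range (n - K), ENNReal.ofReal (m ^ (k + 1)) *
        ν (Set.Ioi (b - (C + 1) * α)) ≤ ENNReal.ofReal (ε / 4) := by
      calc _ ≤ ∑ k ∈ Finset.range (n - K), ENNReal.ofReal (m ^ (k + 1)) *
            ENNReal.ofReal (c * (m ^ n)⁻¹) := by gcongr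
        _ = ENNReal.ofReal (∑ k ∈ Finset.range (n - K), m ^ (k + 1) * (c * (m ^ n)⁻¹)) := by
            rw [ENNReal.ofReal_sum_of_nonneg fun k _ => by positivity]
            exact Finset.sum_congr rfl fun k _ => (ENNReal.ofReal_mul (by positivity)).symm
        _ ≤ _ := by
            refine ENNReal.ofReal_le_ofReal (le_trans ?_ hK.le)
            rw [← Finset.sum_mul]
            simp_rw [pow_succ]
            rw [← Finset.sum_mul, geom_sum_eq hm1.ne']
            have h1 : m ^ n = m ^ (n - K) * m ^ K := by rw [← pow_add, Nat.sub_add_cancel hKn]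
            have h2 : 0 < m - 1 := by linarith
            rw [h1, inv_pow]
            calc (m ^ (n - K) - 1) / (m - 1) * m * (c * (m ^ (n - K) * m ^ K)⁻¹) ≤
                  m ^ (n - K) / (m - 1) * m * (c * (m ^ (n - K) * m ^ K)⁻¹) := by
                  gcongr
                  linarith
              _ = c * (m / (m - 1)) * (m ^ K)⁻¹ := by field_simp
    have hT3 : ENNReal.ofReal (m ^ n) * (K * (ENNReal.ofReal w *
        ν (Set.Ioi (b - (C + 1) * α)))) ≤ ENNReal.ofReal (ε / 4) := by
      calc _ ≤ ENNReal.ofReal (m ^ n) * (K * (ENNReal.ofReal w *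
            ENNReal.ofReal (c * (m ^ n)⁻¹))) := by gcongr
        _ = ENNReal.ofReal (m ^ n * (K * (w * (c * (m ^ n)⁻¹)))) := by
            rw [← ENNReal.ofReal_natCast, ← ENNReal.ofReal_mul (by positivity),
              ← ENNReal.ofReal_mul (by positivity), ← ENNReal.ofReal_mul (by positivity)]
        _ ≤ _ := by
            refine ENNReal.ofReal_le_ofReal ?_
            have h1 : m ^ n * (K * (w * (c * (m ^ n)⁻¹))) = ε / 4 * (K / (K + 1)) := by
              rw [hw]; field_simp
            rw [h1]
            refine mul_le_of_le_one_right (by positivity) ?_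
            rw [div_le_one (by positivity)]
            linarith
    calc _ ≤ ENNReal.ofReal (ε / 2) + ENNReal.ofReal (ε / 4) + ENNReal.ofReal (ε / 4) :=
          add_le_add (add_le_add hT1.le hT2) hT3
      _ = ENNReal.ofReal ε := by
          rw [← ENNReal.ofReal_add (by positivity) (by positivity),
            ← ENNReal.ofReal_add (by positivity) (by positivity)]
          ring_nf
  rw [ENNReal.tendsto_nhds_zero]
  intro ε hε
  rcases eq_or_ne ε ∞ with rfl | hε'
  · exact Eventually.of_forall fun _ => le_top
  · have := main ε.toReal (ENNReal.toReal_pos hε.ne' hε')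
    rwa [ENNReal.ofReal_toReal hε'] at this

end Comparison

/-! ### The Laplace functional of the large displacements -/

/-- `∏ (1 - q_y)` and `exp (-∑ q_y)` differ by at most `∑ q_y ^ 2`. -/
lemma abs_prod_sub_exp_neg_sum_le {κ : Type*} (U : Finset κ) {q : κ → ℝ} (h0 : ∀ y, 0 ≤ q y)
    (h1 : ∀ y, q y ≤ 1) :
    |∏ y ∈ U, (1 - q y) - Real.exp (-∑ y ∈ U, q y)| ≤ ∑ y ∈ U, q y ^ 2 := by
  classical
  induction U using Finset.induction_on with
  | empty => simp
  | insert y U hy ih =>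
    rw [Finset.prod_insert hy, Finset.sum_insert hy, Finset.sum_insert hy, neg_add, Real.exp_add]
    have h2 : |1 - q y - Real.exp (-q y)| ≤ q y ^ 2 := by
      have := Real.abs_exp_sub_one_sub_id_le (x := -q y) (by rw [abs_neg, abs_of_nonneg (h0 y)]
                                                             exact h1 y)
      rw [neg_sq] at this
      rw [abs_sub_comm]
      convert this using 2
      ring
    have h3 : |Real.exp (-∑ y ∈ U, q y)| ≤ 1 := by
      rw [Real.abs_exp, Real.exp_le_one_iff, neg_nonpos]
      exact Finset.sum_nonneg fun y _ => h0 y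
    have h4 : |1 - q y| ≤ 1 := abs_le.2 ⟨by linarith [h1 y], by linarith [h0 y]⟩
    set A := ∏ y ∈ U, (1 - q y)
    set B := Real.exp (-∑ y ∈ U, q y)
    calc |(1 - q y) * A - Real.exp (-q y) * B|
        = |(1 - q y) * (A - B) + (1 - q y - Real.exp (-q y)) * B| := by ring_nf
      _ ≤ |1 - q y| * |A - B| + |1 - q y - Real.exp (-q y)| * |B| := by
          rw [← abs_mul, ← abs_mul]; exact abs_add_le _ _
      _ ≤ 1 * (∑ y ∈ U, q y ^ 2) + q y ^ 2 * 1 := by gcongr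
      _ = _ := by ring

lemma abs_integral_sub_integral_le {Ω : Type*} [MeasurableSpace Ω] {P : Measure Ω} {A B D : Ω → ℝ}
    (hA : Integrable A P) (hB : Integrable B P) (hD : Integrable D P)
    (h : ∀ ω, |A ω - B ω| ≤ D ω) : |∫ ω, A ω ∂P - ∫ ω, B ω ∂P| ≤ ∫ ω, D ω ∂P := by
  rw [← integral_sub hA hB]
  exact abs_integral_le_integral_abs.trans (integral_mono (hA.sub hB).abs hD h)

section Lines

variable {Ω : Type*} {N : Label → Ω → ℕ} {ω : Ω}

/-- The particles on the ancestral lines of the particles in `S`. -/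
noncomputable def lines (S : Finset Label) : Finset NonRoot := S.biUnion path

open Classical in
/-- The number of descendants of `y` in `S`. -/
noncomputable def descCount (S : Finset Label) (y : Label) : ℕ := (S.filter fun x => y <:+ x).card

lemma mem_path {x : Label} {y : NonRoot} : y ∈ path x ↔ y.1 <:+ x := by
  induction x with
  | nil =>
    simp only [path, Finset.notMem_empty, List.suffix_nil, false_iff]
    exact y.2
  | cons i x ih =>
    rw [path, Finset.mem_insert, ih, List.suffix_cons_iff, Subtype.ext_iff]

/-- Summing over ancestral lines counts each ancestor with its number of descendants. -/
lemma sum_lines {M : Type*} [AddCommMonoid M] (S : Finset Label) (h : NonRoot → M) :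
    ∑ x ∈ S, ∑ y ∈ path x, h y = ∑ y ∈ lines S, descCount S y.1 • h y := by
  classical
  have e : ∀ y ∈ lines S, descCount S y.1 • h y = ∑ x ∈ S with y.1 <:+ x, h y := fun y _ => by
    rw [Finset.sum_const, descCount]
  rw [Finset.sum_congr rfl e]
  refine Finset.sum_comm' fun x y => ?_
  simp only [lines, Finset.mem_biUnion, Finset.mem_filter, ← mem_path]
  constructor
  · rintro ⟨hx, hy⟩
    exact ⟨⟨hx, hy⟩, x, hx, hy⟩
  · rintro ⟨⟨hx, hy⟩, -⟩
    exact ⟨hx, hy⟩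

lemma card_lines_le {n : ℕ} : (lines (treeGen N ω n)).card ≤ n * gwSize N n ω := by
  rw [gwSize_eq_card, mul_comm]
  exact Finset.card_biUnion_le_card_mul _ _ _ fun x hx => by
    rw [card_path, (mem_treeGen.1 hx).1]

/-- The descendants of `y` in a later generation are a generation of the subtree of `y`. -/
lemma descCount_treeGen {k l : ℕ} {y : Label} (hy : y ∈ treeGen N ω k) :
    descCount (treeGen N ω (k + l)) y = gwSize (subtree N y) l ω := by
  classical
  rw [descCount, Finset.card_filter, sum_treeGen_add, gwSize_eq_card, Finset.card_eq_sum_ones]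
  have e : ∀ y' ∈ treeGen N ω k, y' ≠ y → ∑ z ∈ treeGen (subtree N y') ω l,
      (if y <:+ z ++ y' then 1 else 0) = 0 := by
    intro y' hy' hne
    refine Finset.sum_eq_zero fun z _ => if_neg fun h => hne ?_
    have hlen : y.length = y'.length := (mem_treeGen.1 hy).1.trans (mem_treeGen.1 hy').1.symm
    exact ((List.suffix_of_suffix_length_le h (List.suffix_append z y') hlen.le).eq_of_length
      hlen).symm
  rw [Finset.sum_eq_single_of_mem y hy e]
  exact Finset.sum_congr rfl fun z _ => if_pos (List.suffix_append z y)

/-- A functional of the numbers of descendants, as a sum over the generations. The condition `G 0 = 0`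
discards the particles without descendants in generation `n`. -/
lemma sum_lines_treeGen {G : ℕ → ℝ} (hG : G 0 = 0) (n : ℕ) :
    ∑ y ∈ lines (treeGen N ω n), G (descCount (treeGen N ω n) y.1) =
      ∑ l ∈ Finset.range n, ∑ y ∈ treeGen N ω (n - l), G (gwSize (subtree N y) l ω) := by
  classical
  have e1 : ∀ l ∈ Finset.range n, ∑ y ∈ treeGen N ω (n - l), G (gwSize (subtree N y) l ω) =
      ∑ y ∈ treeGen N ω (n - l), G (descCount (treeGen N ω n) y) := by
    intro l hl
    refine Finset.sum_congr rfl fun y hy => ?_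
    have hn : n - l + l = n := Nat.sub_add_cancel (Finset.mem_range.1 hl).le
    rw [← descCount_treeGen (l := l) hy, hn]
  rw [Finset.sum_congr rfl e1, ← Finset.sum_biUnion]
  · have e2 : ∑ y ∈ lines (treeGen N ω n), G (descCount (treeGen N ω n) y.1) =
        ∑ y ∈ (lines (treeGen N ω n)).map (Function.Embedding.subtype _),
          G (descCount (treeGen N ω n) y) := by
      rw [Finset.sum_map]; rfl
    rw [e2]
    refine Finset.sum_subset ?_ ?_
    · intro y hy
      rw [Finset.mem_map] at hy
      obtain ⟨y, hy, rfl⟩ := hy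
      obtain ⟨x, hx, hyx⟩ := Finset.mem_biUnion.1 hy
      obtain ⟨l, hl, hly⟩ := exists_drop_of_mem_path hyx
      rw [(mem_treeGen.1 hx).1] at hl
      refine Finset.mem_biUnion.2 ⟨l, Finset.mem_range.2 hl, ?_⟩
      change y.1 ∈ _
      rw [← hly]
      exact drop_mem_treeGen hx
    · intro y hy hy'
      obtain ⟨l, hl, hyl⟩ := Finset.mem_biUnion.1 hy
      have hne : y ≠ [] := by
        have := (mem_treeGen.1 hyl).1
        have := Finset.mem_range.1 hl
        exact List.ne_nil_of_length_pos (by omega)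
      have h0 : descCount (treeGen N ω n) y = 0 := by
        rw [descCount, Finset.card_eq_zero, Finset.filter_eq_empty_iff]
        intro x hx hyx
        exact hy' (Finset.mem_map.2 ⟨⟨y, hne⟩,
          Finset.mem_biUnion.2 ⟨x, hx, mem_path.2 hyx⟩, rfl⟩)
      rw [h0, hG]
  · intro l hl l' hl' hne
    refine Finset.disjoint_left.2 fun y hy hy' => hne ?_
    have h1 := (mem_treeGen.1 hy).1
    have h2 := (mem_treeGen.1 hy').1
    have h3 := Finset.mem_range.1 (Finset.mem_coe.1 hl)
    have h4 := Finset.mem_range.1 (Finset.mem_coe.1 hl')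
    omega

end Lines

section JumpLaplace

variable {Ω : Type*} [mΩ : MeasurableSpace Ω] {P : Measure Ω} [IsProbabilityMeasure P]
  {p : Measure ℕ} {ν : Measure ℝ} {N : Label → Ω → ℕ} {X : NonRoot → Ω → ℝ}

omit mΩ in
lemma jumpSum_eq (φ : ℝ → ℝ) (n : ℕ) (ω : Ω) :
    jumpSum N X φ n ω = ∑ y ∈ lines (treeGen N ω n),
      (descCount (treeGen N ω n) y.1 : ℝ) * φ (X y ω) := by
  rw [jumpSum, sum_lines]
  simp_rw [nsmul_eq_mul]

/-- Conditionally on the tree, the displacements are independent and that of `y` enters `jumpSum` with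
the multiplicity `descCount`; hence the Laplace functional is a product over the ancestral lines. -/
lemma IsBranchingRandomWalk.integral_exp_neg_jumpSum (hB : IsBranchingRandomWalk p ν N X P)
    {φ : ℝ → ℝ} (hφ0 : ∀ t, 0 ≤ φ t) (hφm : Measurable φ) (n : ℕ) :
    ∫ ω, Real.exp (-jumpSum N X φ n ω) ∂P =
      ∫ ω, ∏ y ∈ lines (treeGen N ω n),
        (1 - ∫ x, (1 - Real.exp (-(descCount (treeGen N ω n) y.1 * φ x))) ∂ν) ∂P := by
  classical
  have := hB.isProbabilityMeasure_displacement
  have hint : ∀ j : ℕ, Integrable (fun x => Real.exp (-(j * φ x))) ν := fun j =>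
    Integrable.of_bound (by fun_prop) 1 (Eventually.of_forall fun x => by
      rw [Real.norm_eq_abs, Real.abs_exp, Real.exp_le_one_iff, neg_nonpos]
      exact mul_nonneg (Nat.cast_nonneg _) (hφ0 x))
  have hone : ∀ j : ℕ, 1 - ∫ x, (1 - Real.exp (-(j * φ x))) ∂ν = ∫ x, Real.exp (-(j * φ x)) ∂ν := by
    intro j
    rw [integral_sub (integrable_const _) (hint j)]
    simp
  simp_rw [hone]
  have hlin : ∀ j : ℕ, ENNReal.ofReal (∫ x, Real.exp (-(j * φ x)) ∂ν) =
      ∫⁻ x, ENNReal.ofReal (Real.exp (-(j * φ x))) ∂ν := fun j =>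
    ofReal_integral_eq_lintegral_ofReal (hint j) (Eventually.of_forall fun x => (Real.exp_pos _).le)
  let F : Finset Label → Ω → ℝ≥0∞ := fun S ω =>
    ∏ y ∈ lines S, ENNReal.ofReal (Real.exp (-(descCount S y.1 * φ (X y ω))))
  have hFm : ∀ S, Measurable[sigmaX X] (F S) := fun S =>
    Finset.measurable_prod _ fun y _ => by
      have h1 : Measurable fun x => ENNReal.ofReal (Real.exp (-(descCount S y.1 * φ x))) := by
        fun_prop
      exact h1.comp (measurable_sigmaX y)
  have hF : ∀ S, ∫⁻ ω, F S ω ∂P =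
      ENNReal.ofReal (∏ y ∈ lines S, ∫ x, Real.exp (-(descCount S y.1 * φ x)) ∂ν) := by
    intro S
    have h1 : ∀ y : NonRoot,
        Measurable fun x => ENNReal.ofReal (Real.exp (-(descCount S y.1 * φ x))) := fun y => by
      fun_prop
    rw [lintegral_prod_eq_prod_lintegral_of_indepFun (lines S)
      (fun y ω => ENNReal.ofReal (Real.exp (-(descCount S y.1 * φ (X y ω)))))
      (hB.iIndep_displacement.comp _ h1) fun y => (h1 y).comp (hB.measurable_displacement y),
      ENNReal.ofReal_prod_of_nonneg fun y _ => integral_nonneg fun x => (Real.exp_pos _).le]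
    refine Finset.prod_congr rfl fun y _ => ?_
    rw [hlin, ← hB.law_displacement y, lintegral_map (h1 y) (hB.measurable_displacement y)]
  have hfreeze := lintegral_freeze hB.sigmaTree_le hB.sigmaX_le hB.indep_sigmaTree_sigmaX
    (T := fun ω => treeGen N ω n) (F := F)
    (fun S => measurableSet_treeGen_eq (mΩ := sigmaTree N) n (fun u _ => measurable_sigmaTree u) S)
    hFm
  simp_rw [hF] at hfreeze
  let _ : MeasurableSpace (Finset Label) := ⊤
  have hT : Measurable fun ω => treeGen N ω n := measurable_to_countable' fun S =>
    measurableSet_treeGen_eq n (fun u _ => hB.measurable_offspring u) S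
  have hjm : Measurable fun ω => jumpSum N X φ n ω :=
    hB.measurable_sum_treeGen n fun x => Finset.measurable_sum _ fun y _ =>
      hφm.comp (hB.measurable_displacement y)
  have hAm : Measurable fun ω => ∏ y ∈ lines (treeGen N ω n),
      ∫ x, Real.exp (-(descCount (treeGen N ω n) y.1 * φ x)) ∂ν :=
    (measurable_of_countable fun S : Finset Label => ∏ y ∈ lines S,
      ∫ x, Real.exp (-(descCount S y.1 * φ x)) ∂ν).comp hT
  have hjem : Measurable fun ω => Real.exp (-jumpSum N X φ n ω) := Real.measurable_exp.comp hjm.neg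
  rw [integral_eq_lintegral_of_nonneg_ae (Eventually.of_forall fun ω => (Real.exp_pos _).le)
    hjem.aestronglyMeasurable,
    integral_eq_lintegral_of_nonneg_ae (Eventually.of_forall fun ω => Finset.prod_nonneg fun y _ =>
      integral_nonneg fun x => (Real.exp_pos _).le) hAm.aestronglyMeasurable, ← hfreeze]
  congr 1
  refine lintegral_congr fun ω => ?_
  rw [jumpSum_eq, ← Finset.sum_neg_distrib, Real.exp_sum,
    ENNReal.ofReal_prod_of_nonneg fun y _ => (Real.exp_pos _).le]

/-- The product over the ancestral lines is close to the exponential of `clusterSum`: there are at most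
`n Z_n` factors, each at distance `O(m^{-n})` from `1`. -/
lemma IsBranchingRandomWalk.abs_integral_jumpSum_sub_le (hB : IsBranchingRandomWalk p ν N X P)
    (hp : OffspringAssumption p) {φ : ℝ → ℝ} (hφ0 : ∀ t, 0 ≤ φ t) (hφm : Measurable φ) {n : ℕ}
    {c : ℝ} {gs : ℕ → ℝ} (hc : ∀ j, gs j ≤ c)
    (hgs : ∀ j : ℕ, gs j = offspringMean p ^ n * ∫ x, (1 - Real.exp (-(j * φ x))) ∂ν) :
    |∫ ω, Real.exp (-jumpSum N X φ n ω) ∂P -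
      ∫ ω, Real.exp (-clusterSum N (offspringMean p) gs n ω) ∂P| ≤
      c ^ 2 * (n / offspringMean p ^ n) := by
  classical
  have := hB.isProbabilityMeasure_displacement
  set m := offspringMean p with hm
  have hm0 : 0 < m := hp.mean_pos
  have hmn : 0 < m ^ n := by positivity
  set q : ℕ → ℝ := fun j => ∫ x, (1 - Real.exp (-(j * φ x))) ∂ν with hq
  have hle : ∀ (j : ℕ) x, Real.exp (-(j * φ x)) ≤ 1 := fun j x => by
    rw [Real.exp_le_one_iff, neg_nonpos]
    exact mul_nonneg (Nat.cast_nonneg _) (hφ0 x)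
  have hq0 : ∀ j, 0 ≤ q j := fun j => integral_nonneg fun x => sub_nonneg.2 (hle j x)
  have hq1 : ∀ j, q j ≤ 1 := fun j => by
    have h1 : q j ≤ ∫ _x, (1 : ℝ) ∂ν := integral_mono_of_nonneg
      (Eventually.of_forall fun x => sub_nonneg.2 (hle j x)) (integrable_const _)
      (Eventually.of_forall fun x => by
        have := Real.exp_pos (-((j : ℝ) * φ x))
        simp only
        linarith)
    simpa using h1
  have hqgs : ∀ j, q j = gs j / m ^ n := fun j => by rw [hgs]; field_simp; rfl
  have hqc : ∀ j, q j ≤ c / m ^ n := fun j => by rw [hqgs]; gcongr; exact hc j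
  have hgs00 : gs 0 / m ^ n = 0 := by rw [← hqgs]; simp [hq]
  have hcl : ∀ ω, clusterSum N m gs n ω = ∑ y ∈ lines (treeGen N ω n),
      q (descCount (treeGen N ω n) y.1) := by
    intro ω
    simp_rw [hqgs]
    exact (sum_lines_treeGen (G := fun j => gs j / m ^ n) hgs00 n).symm
  rw [hB.integral_exp_neg_jumpSum hφ0 hφm]
  let _ : MeasurableSpace (Finset Label) := ⊤
  have hT : Measurable fun ω => treeGen N ω n := measurable_to_countable' fun S =>
    measurableSet_treeGen_eq n (fun u _ => hB.measurable_offspring u) S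
  have hAm : Measurable fun ω => ∏ y ∈ lines (treeGen N ω n),
      (1 - q (descCount (treeGen N ω n) y.1)) :=
    (measurable_of_countable fun S : Finset Label => ∏ y ∈ lines S,
      (1 - q (descCount S y.1))).comp hT
  have hA1 : Integrable (fun ω => ∏ y ∈ lines (treeGen N ω n),
      (1 - q (descCount (treeGen N ω n) y.1))) P := by
    refine Integrable.of_bound hAm.aestronglyMeasurable 1 (Eventually.of_forall fun ω => ?_)
    rw [Real.norm_eq_abs, abs_of_nonneg (Finset.prod_nonneg fun y _ => sub_nonneg.2 (hq1 _))]
    exact Finset.prod_le_one (fun y _ => sub_nonneg.2 (hq1 _)) fun y _ =>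
      sub_le_self _ (hq0 _)
  have hB1 : Integrable (fun ω => Real.exp (-clusterSum N m gs n ω)) P := by
    refine Integrable.of_bound (Real.measurable_exp.comp
      (hB.measurable_clusterSum m gs n).neg).aestronglyMeasurable 1 (Eventually.of_forall fun ω => ?_)
    rw [Real.norm_eq_abs, Real.abs_exp, Real.exp_le_one_iff, neg_nonpos, hcl]
    exact Finset.sum_nonneg fun y _ => hq0 _
  have hpt : ∀ ω, |∏ y ∈ lines (treeGen N ω n), (1 - q (descCount (treeGen N ω n) y.1)) -
      Real.exp (-clusterSum N m gs n ω)| ≤ n * (c / m ^ n) ^ 2 * gwSize N n ω := by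
    intro ω
    rw [hcl]
    refine (abs_prod_sub_exp_neg_sum_le _ (fun y => hq0 _) fun y => hq1 _).trans ?_
    calc ∑ y ∈ lines (treeGen N ω n), q (descCount (treeGen N ω n) y.1) ^ 2
        ≤ ∑ _y ∈ lines (treeGen N ω n), (c / m ^ n) ^ 2 :=
          Finset.sum_le_sum fun y _ => pow_le_pow_left₀ (hq0 _) (hqc _) 2
      _ = (lines (treeGen N ω n)).card * (c / m ^ n) ^ 2 := by rw [Finset.sum_const, nsmul_eq_mul]
      _ ≤ (n * gwSize N n ω : ℝ) * (c / m ^ n) ^ 2 := by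
          refine mul_le_mul_of_nonneg_right ?_ (sq_nonneg _)
          have := card_lines_le (N := N) (ω := ω) (n := n)
          exact_mod_cast this
      _ = _ := by ring
  have hEZ : ∫ ω, (gwSize N n ω : ℝ) ∂P = m ^ n := by
    rw [integral_eq_lintegral_of_nonneg_ae (Eventually.of_forall fun ω => Nat.cast_nonneg _)
      (hB.integrable_gwSize hp n).aestronglyMeasurable]
    simp_rw [ENNReal.ofReal_natCast]
    rw [hB.lintegral_gwSize hp, ENNReal.toReal_ofReal hmn.le]
  refine (abs_integral_sub_integral_le hA1 hB1 ((hB.integrable_gwSize hp n).const_mul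
    (n * (c / m ^ n) ^ 2)) hpt).trans_eq ?_
  calc _ = n * (c / m ^ n) ^ 2 * m ^ n := by rw [integral_const_mul, hEZ]
    _ = c ^ 2 * (n / m ^ n) := by field_simp

/-- The Laplace functional of the large displacements converges. -/
theorem IsBranchingRandomWalk.tendsto_integral_exp_neg_jumpSum
    (hB : IsBranchingRandomWalk p ν N X P) (hp : OffspringAssumption p) {a L : ℝ → ℝ}
    (hν : SuplogAssumption ν a L) (f : C_c(RBar, ℝ≥0)) :
    Tendsto (fun n => ∫ ω, Real.exp (-jumpSum N X (fun t => realTest f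
        ((t - centring ν (offspringMean p) n) / scaling ν L (offspringMean p) n)) n ω) ∂P) atTop
      (𝓝 (∫ ω, Real.exp (-(gwLimit N (offspringMean p) ω * ∑' l : ℕ, (offspringMean p ^ l)⁻¹ *
        ∫ ω, (∫ x, testDefect f (gwSize N l ω) x ∂gumbelIntensity) ∂P)) ∂P)) := by
  have := hB.isProbabilityMeasure_displacement
  set m := offspringMean p with hm
  have hm1 : 1 < m := hp.one_lt_mean
  have hm0 : 0 < m := hp.mean_pos
  set T : ℕ → ℝ → ℝ := fun n t => (t - centring ν m n) / scaling ν L m n with hT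
  have hTm : ∀ n, Measurable (T n) := fun n => (measurable_id.sub_const _).div_const _
  obtain ⟨c₀, hc₀⟩ := exists_realTest_eq_zero f
  have hψ : ∀ (r : ℝ≥0) (x : ℝ), x ≤ c₀ → testDefect f r x = 0 := fun r x hx => by
    simp [hc₀ x hx]
  let gs : ℕ → ℕ → ℝ := fun n j => m ^ n * ∫ x, testDefect f j (T n x) ∂ν
  have hgs0 : ∀ n j, 0 ≤ gs n j := fun n j =>
    mul_nonneg (by positivity) (integral_nonneg fun x => testDefect_nonneg f _ _)
  set c := Real.exp (-c₀) + 1 with hc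
  have hgsc : ∀ᶠ n in atTop, ∀ j, gs n j ≤ c := by
    filter_upwards [(hν.tendsto_pow_mul_tail hm1 c₀).eventually (gt_mem_nhds (lt_add_one _)),
      hν.eventually_scaling_pos hm1] with n h1 h2 j
    refine le_trans (mul_le_mul_of_nonneg_left ?_ (by positivity)) h1.le
    rw [← integral_indicator_one measurableSet_Ioi]
    refine integral_mono_of_nonneg (Eventually.of_forall fun x => testDefect_nonneg f _ _)
      ((integrable_const (1 : ℝ)).indicator measurableSet_Ioi) (Eventually.of_forall fun x => ?_)
    by_cases hx : x ∈ Set.Ioi (centring ν m n + c₀ * scaling ν L m n)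
    · simp only [Set.indicator_of_mem hx]
      exact testDefect_le_one f _ _
    · simp only [Set.indicator_of_notMem hx]
      refine (hψ _ _ ?_).le
      rw [hT]
      simp only
      rw [div_le_iff₀ h2]
      rw [Set.mem_Ioi, not_lt] at hx
      linarith
  have hlim : ∀ j : ℕ, Tendsto (fun n => gs n j) atTop
      (𝓝 (∫ x, testDefect f j x ∂gumbelIntensity)) := fun j =>
    hν.tendsto_pow_mul_integral hm1 (testDefect f j) (hψ j)
  have key := hB.tendsto_integral_exp_neg_clusterSum hp hgs0 hgsc hlim
  have hdiff : Tendsto (fun n => ∫ ω, Real.exp (-jumpSum N X (fun t => realTest f (T n t)) n ω) ∂P -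
      ∫ ω, Real.exp (-clusterSum N m (gs n) n ω) ∂P) atTop (𝓝 0) := by
    have h1 : Tendsto (fun n : ℕ => c ^ 2 * (n / m ^ n)) atTop (𝓝 0) := by
      have := tendsto_pow_const_div_const_pow_of_one_lt 1 hm1
      simpa using this.const_mul (c ^ 2)
    refine squeeze_zero_norm' ?_ h1
    filter_upwards [hgsc] with n hn
    rw [Real.norm_eq_abs]
    refine hB.abs_integral_jumpSum_sub_le hp (φ := fun t => realTest f (T n t))
      (fun t => realTest_nonneg f _) ((continuous_realTest f).measurable.comp (hTm n)) hn fun j => ?_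
    simp [gs, hm]
  have := hdiff.add key
  rw [zero_add] at this
  refine this.congr fun n => ?_
  exact sub_add_cancel _ _

end JumpLaplace

/-! ### The Laplace functional of the positions -/

section Positions

variable {Ω : Type*} [mΩ : MeasurableSpace Ω] {P : Measure Ω} [IsProbabilityMeasure P]
  {p : Measure ℕ} {ν : Measure ℝ} {N : Label → Ω → ℕ} {X : NonRoot → Ω → ℝ}

omit mΩ in
lemma tsum_generation (n : ℕ) (ω : Ω) (h : Label → ℝ≥0∞) :
    ∑' x : generation N n ω, h x = ∑ x ∈ treeGen N ω n, h x := by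
  have e : generation N n ω = ((treeGen N ω n : Finset Label) : Set Label) :=
    (Set.Finite.coe_toFinset (finite_generation n)).symm
  rw [tsum_congr_set_coe h e]
  exact Finset.tsum_subtype _ h

omit mΩ in
lemma lintegral_rescaledProcess (a b : ℝ) (n : ℕ) (ω : Ω) {F : RBar → ℝ≥0∞} (hF : Measurable F) :
    ∫⁻ x, F x ∂(rescaledProcess N X a b n ω) =
      ∑ x ∈ treeGen N ω n, F (toRBar ((position X ω x - b) / a)) := by
  rw [rescaledProcess, lintegral_sum_measure]
  simp_rw [lintegral_dirac' _ hF]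
  exact tsum_generation n ω fun x => F (toRBar ((position X ω x - b) / a))

omit mΩ in
lemma isFiniteMeasureOnCompacts_rescaledProcess (a b : ℝ) (n : ℕ) (ω : Ω) :
    IsFiniteMeasureOnCompacts (rescaledProcess N X a b n ω) := by
  have : IsFiniteMeasure (rescaledProcess N X a b n ω) := ⟨by
    rw [← lintegral_one, lintegral_rescaledProcess a b n ω measurable_const]
    simp⟩
  infer_instance

omit mΩ in
lemma testInt_rescaledProcess (f : C_c(RBar, ℝ≥0)) (a b : ℝ) (n : ℕ) (ω : Ω) :
    testInt f (toRadonM (rescaledProcess N X a b n ω)) =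
      walkSum N X (fun t => realTest f ((t - b) / a)) n ω := by
  rw [testInt_toRadonM f (isFiniteMeasureOnCompacts_rescaledProcess a b n ω),
    lintegral_rescaledProcess a b n ω (measurable_testFun f),
    ENNReal.toReal_sum fun _ _ => ENNReal.coe_ne_top]
  rfl

omit [IsProbabilityMeasure P] in
lemma IsBranchingRandomWalk.measurable_position (hB : IsBranchingRandomWalk p ν N X P)
    (x : Label) : Measurable fun ω => position X ω x := by
  simp_rw [position_eq_sum]
  exact Finset.measurable_sum _ fun y _ => hB.measurable_displacement y

omit [IsProbabilityMeasure P] in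
lemma IsBranchingRandomWalk.measurable_rescaledProcess (hB : IsBranchingRandomWalk p ν N X P)
    (a b : ℝ) (n : ℕ) : Measurable (rescaledProcess N X a b n) := by
  refine Measure.measurable_of_measurable_coe _ fun s hs => ?_
  have e : ∀ ω, rescaledProcess N X a b n ω s = ∑ x ∈ treeGen N ω n,
      s.indicator 1 (toRBar ((position X ω x - b) / a)) := fun ω => by
    rw [← lintegral_indicator_one hs, lintegral_rescaledProcess a b n ω
      (measurable_one.indicator hs)]
  simp_rw [e]
  refine hB.measurable_sum_treeGen_ennreal n fun x => ?_
  have hpos : Measurable[sigmaX X] fun ω => position X ω x := by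
    simp_rw [position_eq_sum]
    exact Finset.measurable_sum _ fun y _ => measurable_sigmaX y
  have hg : Measurable fun t : ℝ => s.indicator (1 : RBar → ℝ≥0∞) (toRBar ((t - b) / a)) :=
    (measurable_one.indicator hs).comp
      (measurable_toRBar.comp ((measurable_id.sub_const b).div_const a))
  exact hg.comp hpos

lemma IsBranchingRandomWalk.measurable_walkSum (hB : IsBranchingRandomWalk p ν N X P)
    {φ : ℝ → ℝ} (hφ : Measurable φ) (n : ℕ) : Measurable (walkSum N X φ n) :=
  hB.measurable_sum_treeGen n fun x => hφ.comp (hB.measurable_position x)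

lemma IsBranchingRandomWalk.measurable_jumpSum (hB : IsBranchingRandomWalk p ν N X P)
    {φ : ℝ → ℝ} (hφ : Measurable φ) (n : ℕ) : Measurable (jumpSum N X φ n) :=
  hB.measurable_sum_treeGen n fun _ => Finset.measurable_sum _ fun y _ =>
    hφ.comp (hB.measurable_displacement y)

/-- The exponent of the limiting Laplace functional: `∑_l m^{-l} E g(Z_l)` with
`g(j) = ∫ (1 - e^{-j f(x)}) e^{-x} dx`. -/
noncomputable def limitExponent (P : Measure Ω) (N : Label → Ω → ℕ) (m : ℝ) (f : C_c(RBar, ℝ≥0)) :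
    ℝ :=
  ∑' l : ℕ, (m ^ l)⁻¹ * ∫ ω, (∫ x, testDefect f (gwSize N l ω) x ∂gumbelIntensity) ∂P

/-- The Laplace functional of the rescaled positions converges, by comparison with that of the large
displacements. -/
theorem IsBranchingRandomWalk.tendsto_integral_exp_neg_testInt
    (hB : IsBranchingRandomWalk p ν N X P) (hp : OffspringAssumption p) {a L : ℝ → ℝ}
    (hν : SuplogAssumption ν a L) (f : C_c(RBar, ℝ≥0)) :
    Tendsto (fun n => ∫ ω, Real.exp (-testInt f (toRadonM (rescaledProcess N X
        (scaling ν L (offspringMean p) n) (centring ν (offspringMean p) n) n ω))) ∂P) atTop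
      (𝓝 (∫ ω, Real.exp (-(gwLimit N (offspringMean p) ω *
        limitExponent P N (offspringMean p) f)) ∂P)) := by
  simp_rw [testInt_rescaledProcess]
  set φ : ℕ → ℝ → ℝ := fun n t => realTest f ((t - centring ν (offspringMean p) n) /
    scaling ν L (offspringMean p) n) with hφ
  have hφm : ∀ n, Measurable (φ n) := fun n =>
    (continuous_realTest f).measurable.comp ((measurable_id.sub_const _).div_const _)
  have hbd : ∀ {V : Ω → ℝ}, Measurable V → (∀ ω, 0 ≤ V ω) →
      Integrable (fun ω => Real.exp (-V ω)) P := fun hV h0 =>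
    Integrable.of_bound (Real.measurable_exp.comp hV.neg).aestronglyMeasurable 1
      (Eventually.of_forall fun ω => by
        rw [Real.norm_eq_abs, Real.abs_exp, Real.exp_le_one_iff, neg_nonpos]; exact h0 ω)
  have h1 : ∀ n, Integrable (fun ω => Real.exp (-walkSum N X (φ n) n ω)) P := fun n =>
    hbd (hB.measurable_walkSum (hφm n) n) fun ω => Finset.sum_nonneg fun _ _ =>
      realTest_nonneg f _
  have h2 : ∀ n, Integrable (fun ω => Real.exp (-jumpSum N X (φ n) n ω)) P := fun n =>
    hbd (hB.measurable_jumpSum (hφm n) n) fun ω => Finset.sum_nonneg fun _ _ =>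
      Finset.sum_nonneg fun _ _ => realTest_nonneg f _
  have hdiff : Tendsto (fun n => ∫ ω, Real.exp (-walkSum N X (φ n) n ω) ∂P -
      ∫ ω, Real.exp (-jumpSum N X (φ n) n ω) ∂P) atTop (𝓝 0) := by
    have h3 := (ENNReal.tendsto_toReal ENNReal.zero_ne_top).comp
      (hB.tendsto_lintegral_abs_exp_walkSum_sub hp hν f)
    rw [ENNReal.toReal_zero] at h3
    refine squeeze_zero_norm (fun n => ?_) h3
    have h4 : Integrable (fun ω => Real.exp (-walkSum N X (φ n) n ω) -
        Real.exp (-jumpSum N X (φ n) n ω)) P := (h1 n).sub (h2 n)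
    rw [Real.norm_eq_abs, ← integral_sub (h1 n) (h2 n)]
    refine abs_integral_le_integral_abs.trans_eq ?_
    rw [integral_eq_lintegral_of_nonneg_ae (Eventually.of_forall fun ω => abs_nonneg _)
      h4.abs.aestronglyMeasurable]
    rfl
  have := hdiff.add (hB.tendsto_integral_exp_neg_jumpSum hp hν f)
  rw [zero_add] at this
  exact this.congr fun n => sub_add_cancel _ _

end Positions

/-! ### The Laplace functional of the limit -/

section Limit

variable {Ω Ω' : Type*} [mΩ : MeasurableSpace Ω] [MeasurableSpace Ω'] {P : Measure Ω}
  [IsProbabilityMeasure P] {P' : Measure Ω'} [IsProbabilityMeasure P'] {p : Measure ℕ}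
  {ν : Measure ℝ} {N : Label → Ω → ℕ} {X : NonRoot → Ω → ℝ} {m : ℝ}

lemma summable_inv_pow_mul (hm : 1 < m) {u : ℕ → ℝ} {c : ℝ} (h0 : ∀ l, 0 ≤ u l)
    (hc : ∀ l, u l ≤ c) : Summable fun l : ℕ => (m ^ l)⁻¹ * u l := by
  have hm0 : 0 < m := zero_lt_one.trans hm
  have hgeom : Summable fun l : ℕ => (m ^ l)⁻¹ * c := by
    simp_rw [← inv_pow]
    exact (summable_geometric_of_lt_one (by positivity) (inv_lt_one_of_one_lt₀ hm)).mul_right c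
  exact hgeom.of_nonneg_of_le (fun l => mul_nonneg (by positivity) (h0 l)) fun l =>
    mul_le_mul_of_nonneg_left (hc l) (by positivity)

lemma clusterConst_pos (hm : 1 < m) : 0 < clusterConst P N m := by
  have hm0 : 0 < m := zero_lt_one.trans hm
  have hs : Summable fun l : ℕ => (m ^ l)⁻¹ * P.real {ω | 0 < gwSize N l ω} :=
    summable_inv_pow_mul hm (fun _ => measureReal_nonneg) fun _ => measureReal_le_one
  refine hs.tsum_pos (fun l => mul_nonneg (by positivity) measureReal_nonneg) 0 ?_
  simp

lemma ofReal_testDefect (f : C_c(RBar, ℝ≥0)) (j : ℕ) (x : ℝ) :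
    ENNReal.ofReal (testDefect f j x) = 1 - expNeg (j * f (toRBar x)) := by
  have h1 : (j : ℝ≥0∞) * f (toRBar x) = ENNReal.ofReal (j * realTest f x) := by
    rw [ENNReal.ofReal_mul (Nat.cast_nonneg _), ENNReal.ofReal_natCast, realTest,
      ENNReal.ofReal_coe_nnreal]
  rw [h1, expNeg_ofReal (mul_nonneg (Nat.cast_nonneg _) (realTest_nonneg f x)), testDefect_apply,
    ENNReal.ofReal_sub _ (Real.exp_pos _).le, ENNReal.ofReal_one]
  rfl

/-- The functions `1 - e^{-r f}` vanish on a common half-line `(-∞, c₀]` and are at most `1`, so their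
integrals against `e^{-x} dx` are bounded uniformly in `r`. -/
lemma exists_integrable_testDefect (f : C_c(RBar, ℝ≥0)) :
    ∃ c : ℝ, ∀ r : ℝ≥0, Integrable (testDefect f r) gumbelIntensity ∧
      ∫ x, testDefect f r x ∂gumbelIntensity ≤ c := by
  obtain ⟨c₀, hc₀⟩ := exists_realTest_eq_zero f
  have hfin : gumbelIntensity (Set.Ioi c₀) ≠ ∞ := by
    rw [gumbelIntensity_Ioi]; exact ENNReal.ofReal_ne_top
  have hI : Integrable ((Set.Ioi c₀).indicator (1 : ℝ → ℝ)) gumbelIntensity :=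
    (integrable_indicator_iff measurableSet_Ioi).2 (integrableOn_const hfin)
  have hle : ∀ r x, testDefect f r x ≤ (Set.Ioi c₀).indicator (1 : ℝ → ℝ) x := by
    intro r x
    by_cases hx : x ∈ Set.Ioi c₀
    · rw [Set.indicator_of_mem hx]
      exact testDefect_le_one f r x
    · rw [Set.indicator_of_notMem hx, testDefect_apply, hc₀ x (not_lt.1 hx)]
      simp
  have hint : ∀ r, Integrable (testDefect f r) gumbelIntensity := fun r =>
    hI.mono' (testDefect f r).continuous.measurable.aestronglyMeasurable
      (Eventually.of_forall fun x => by
        rw [Real.norm_eq_abs, abs_of_nonneg (testDefect_nonneg f r x)]; exact hle r x)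
  exact ⟨∫ x, (Set.Ioi c₀).indicator (1 : ℝ → ℝ) x ∂gumbelIntensity, fun r =>
    ⟨hint r, integral_mono (hint r) hI (hle r)⟩⟩

/-- The law of the cluster sizes is such that `v E[1 - e^{-sA}] = ∑_l m^{-l} E[1 - e^{-s Z_l}]`, which
identifies the exponents of the two Laplace functionals. -/
lemma IsBranchingRandomWalk.mul_lintegral_clusterDefect (hB : IsBranchingRandomWalk p ν N X P)
    (hm : 1 < m) (f : C_c(RBar, ℝ≥0)) :
    ENNReal.ofReal (clusterConst P N m) *
      ∫⁻ x, clusterDefect P N m (f (toRBar x)) ∂gumbelIntensity =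
        ENNReal.ofReal (limitExponent P N m f) := by
  have hm0 : 0 < m := zero_lt_one.trans hm
  have hv := clusterConst_pos (P := P) (N := N) hm
  obtain ⟨c, hc⟩ := exists_integrable_testDefect f
  set g : ℕ → ℝ := fun j => ∫ x, testDefect f j x ∂gumbelIntensity with hg
  have hg0 : ∀ j, 0 ≤ g j := fun j => integral_nonneg fun x => testDefect_nonneg f _ x
  have hgc : ∀ j, g j ≤ c := fun j => (hc j).2
  have hgint : ∀ l, Integrable (fun ω => g (gwSize N l ω)) P := fun l =>
    Integrable.of_bound ((measurable_of_countable g).comp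
      (hB.measurable_gwSize l)).aestronglyMeasurable c (Eventually.of_forall fun ω => by
        rw [Real.norm_eq_abs, abs_of_nonneg (hg0 _)]; exact hgc _)
  have hjm : ∀ j : ℕ, Measurable fun s : ℝ≥0∞ => 1 - expNeg (j * s) := fun j =>
    measurable_const.sub (measurable_expNeg.comp (measurable_const.mul measurable_id))
  have hφm : Measurable fun x : ℝ => (f (toRBar x) : ℝ≥0∞) :=
    (measurable_testFun f).comp measurable_toRBar
  have hweight : ∀ j, ENNReal.ofReal (clusterConst P N m) * ENNReal.ofReal (clusterWeight P N m j) =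
      ∑' l : ℕ, ENNReal.ofReal ((m ^ l)⁻¹) * P {ω | gwSize N l ω = j} := by
    intro j
    have hs : Summable fun l : ℕ => (m ^ l)⁻¹ * P.real {ω | gwSize N l ω = j} :=
      summable_inv_pow_mul hm (fun _ => measureReal_nonneg) fun _ => measureReal_le_one
    rw [← ENNReal.ofReal_mul hv.le, clusterWeight, ← mul_assoc, mul_one_div_cancel hv.ne', one_mul,
      ENNReal.ofReal_tsum_of_nonneg (fun l => mul_nonneg (by positivity) measureReal_nonneg) hs]
    refine tsum_congr fun l => ?_
    rw [ENNReal.ofReal_mul (by positivity), ofReal_measureReal]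
  have hdefect : ∀ s, ENNReal.ofReal (clusterConst P N m) * clusterDefect P N m s =
      ∑' l : ℕ, ENNReal.ofReal ((m ^ l)⁻¹) * ∫⁻ ω, (1 - expNeg (gwSize N l ω * s)) ∂P := by
    intro s
    have hl : ∀ l, ∫⁻ ω, (1 - expNeg (gwSize N l ω * s)) ∂P =
        ∑' j : ℕ, (1 - expNeg (j * s)) * P {ω | gwSize N l ω = j} := by
      intro l
      have e : ∫⁻ ω, (1 - expNeg (gwSize N l ω * s)) ∂P =
          ∫⁻ j : ℕ, (1 - expNeg (j * s)) ∂(P.map (gwSize N l)) :=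
        (lintegral_map (f := fun j : ℕ => 1 - expNeg (j * s)) (measurable_of_countable _)
          (hB.measurable_gwSize l)).symm
      rw [e, lintegral_countable']
      refine tsum_congr fun j => ?_
      rw [Measure.map_apply (hB.measurable_gwSize l) (measurableSet_singleton j)]
      rfl
    simp_rw [hl, clusterDefect, ← ENNReal.tsum_mul_left]
    rw [ENNReal.tsum_comm]
    refine tsum_congr fun j => ?_
    calc _ = (1 - expNeg (j * s)) * (ENNReal.ofReal (clusterConst P N m) *
          ENNReal.ofReal (clusterWeight P N m j)) := by ring
      _ = _ := by
        rw [hweight, ← ENNReal.tsum_mul_left]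
        exact tsum_congr fun l => by ring
  have hjoint : ∀ l, Measurable fun z : ℝ × Ω => 1 - expNeg (gwSize N l z.2 * f (toRBar z.1)) :=
    fun l => measurable_const.sub (measurable_expNeg.comp
      (((hB.measurable_coe_gwSize l).comp measurable_snd).mul (hφm.comp measurable_fst)))
  have hsec : ∀ l, Measurable fun x : ℝ =>
      ∫⁻ ω, (1 - expNeg (gwSize N l ω * f (toRBar x))) ∂P := fun l =>
    (hjoint l).lintegral_prod_right'
  have hsf : SFinite gumbelIntensity := by unfold gumbelIntensity; infer_instance
  have hcd : Measurable fun x : ℝ => clusterDefect P N m (f (toRBar x)) :=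
    measurable_clusterDefect.comp hφm
  rw [← lintegral_const_mul _ hcd]
  simp_rw [hdefect]
  have hterm : ∀ l, ∫⁻ x, ENNReal.ofReal ((m ^ l)⁻¹) *
      ∫⁻ ω, (1 - expNeg (gwSize N l ω * f (toRBar x))) ∂P ∂gumbelIntensity =
        ENNReal.ofReal ((m ^ l)⁻¹ * ∫ ω, g (gwSize N l ω) ∂P) := by
    intro l
    rw [lintegral_const_mul _ (hsec l), lintegral_lintegral_swap (hjoint l).aemeasurable,
      ENNReal.ofReal_mul (by positivity), ofReal_integral_eq_lintegral_ofReal (hgint l)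
        (Eventually.of_forall fun ω => hg0 _)]
    congr 1
    refine lintegral_congr fun ω => ?_
    rw [hg]
    simp only
    rw [ofReal_integral_eq_lintegral_ofReal (hc _).1
      (Eventually.of_forall fun x => testDefect_nonneg f _ x)]
    exact lintegral_congr fun x => (ofReal_testDefect f _ x).symm
  rw [lintegral_tsum fun l => ((hsec l).const_mul _).aemeasurable]
  simp_rw [hterm]
  rw [limitExponent, ENNReal.ofReal_tsum_of_nonneg]
  · exact fun l => mul_nonneg (by positivity) (integral_nonneg fun ω => hg0 _)
  · refine summable_inv_pow_mul hm (c := c) (fun l => integral_nonneg fun ω => hg0 _) fun l => ?_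
    have := integral_mono (hgint l) (integrable_const c) fun ω => hgc (gwSize N l ω)
    rwa [integral_const, probReal_univ, one_smul] at this

/-- The Laplace functional of the limit, expressed through the branching random walk: only the law of
`W` matters. -/
lemma IsBranchingRandomWalk.integral_exp_neg_testInt_clusterCox
    (hB : IsBranchingRandomWalk p ν N X P) (hp : OffspringAssumption p) {ℓ : ℕ → Ω' → ℝ}
    {A : ℕ → Ω' → ℕ} {W : Ω' → ℝ} (hlim : IsLimitData P N (offspringMean p) P' ℓ A W)
    (f : C_c(RBar, ℝ≥0)) :
    ∫ ω, Real.exp (-testInt f (toRadonM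
        (clusterCox (clusterConst P N (offspringMean p)) ℓ A W ω))) ∂P' =
      ∫ ω, Real.exp (-(gwLimit N (offspringMean p) ω *
        limitExponent P N (offspringMean p) f)) ∂P := by
  set m := offspringMean p with hm
  have hm1 : 1 < m := hp.one_lt_mean
  have hv := clusterConst_pos (P := P) (N := N) hm1
  set S := limitExponent P N m f with hS
  have hS0 : 0 ≤ S := tsum_nonneg fun l => mul_nonneg
    (inv_nonneg.2 (pow_nonneg (zero_lt_one.trans hm1).le _))
    (integral_nonneg fun ω => integral_nonneg fun x => testDefect_nonneg f _ x)
  have hW0 : ∀ᵐ ω ∂P', 0 ≤ W ω := hlim.law_shift.symm.ae_snd measurableSet_Ici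
    (hB.ae_gwLimit_nonneg hp)
  have hexp : Measurable fun w : ℝ => Real.exp (-(w * S)) := by fun_prop
  have hid := (hlim.law_shift.comp hexp).integral_eq
  simp only [Function.comp_def] at hid
  rw [← hid]
  have hmeas : Measurable fun ω => toRadonM (clusterCox (clusterConst P N m) ℓ A W ω) :=
    measurable_toRadonM (measurable_clusterCox hlim.measurable_atom hlim.measurable_size
      hlim.measurable_shift)
  have hm1' : Measurable fun ω => Real.exp (-testInt f (toRadonM
      (clusterCox (clusterConst P N m) ℓ A W ω))) :=
    Real.measurable_exp.comp ((continuous_testInt f).measurable.comp hmeas).neg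
  have hm2 : Measurable fun ω => Real.exp (-(W ω * S)) := hexp.comp hlim.measurable_shift
  rw [integral_eq_lintegral_of_nonneg_ae (Eventually.of_forall fun ω => (Real.exp_pos _).le)
    hm1'.aestronglyMeasurable, integral_eq_lintegral_of_nonneg_ae
    (Eventually.of_forall fun ω => (Real.exp_pos _).le) hm2.aestronglyMeasurable]
  congr 1
  calc ∫⁻ ω, ENNReal.ofReal (Real.exp (-testInt f (toRadonM
        (clusterCox (clusterConst P N m) ℓ A W ω)))) ∂P'
      = ∫⁻ ω, expNeg (∫⁻ x, f x ∂(clusterCox (clusterConst P N m) ℓ A W ω)) ∂P' := by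
        refine lintegral_congr_ae ?_
        filter_upwards [hlim.ae_isFiniteMeasureOnCompacts (v := clusterConst P N m)] with ω hω
        exact ofReal_exp_neg_testInt f hω
    _ = _ := hlim.lintegral_expNeg_clusterCox hv f
    _ = ∫⁻ ω, ENNReal.ofReal (Real.exp (-(W ω * S))) ∂P' := by
        refine lintegral_congr_ae ?_
        filter_upwards [hW0] with ω hω
        rw [mul_comm (clusterConst P N m), ENNReal.ofReal_mul hω, mul_assoc,
          hB.mul_lintegral_clusterDefect hm1 f, ← ENNReal.ofReal_mul hω,
          expNeg_ofReal (mul_nonneg hω hS0)]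

end Limit

end BRW

theorem theorem2p1 {Ω Ω' : Type*} [MeasurableSpace Ω] [MeasurableSpace Ω']
    (P : Measure Ω) [IsProbabilityMeasure P] (P' : Measure Ω') [IsProbabilityMeasure P']
    (p : Measure ℕ) (ν : Measure ℝ) (N : BRW.Label → Ω → ℕ) (X : BRW.NonRoot → Ω → ℝ)
    (hBRW : BRW.IsBranchingRandomWalk p ν N X P)
    (hp : BRW.OffspringAssumption p)
    (a L : ℝ → ℝ) (hν : BRW.SuplogAssumption ν a L)
    (ℓ : ℕ → Ω' → ℝ) (A : ℕ → Ω' → ℕ) (W : Ω' → ℝ)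
    (hlim : BRW.IsLimitData P N (BRW.offspringMean p) P' ℓ A W) :
    TendstoInDistribution
      (fun (n : ℕ) (ω : Ω) => BRW.toRadonM
        (BRW.rescaledProcess N X (BRW.scaling ν L (BRW.offspringMean p) n)
          (BRW.centring ν (BRW.offspringMean p) n) n ω))
      atTop
      (fun ω : Ω' => BRW.toRadonM
        (BRW.clusterCox (BRW.clusterConst P N (BRW.offspringMean p)) ℓ A W ω))
      (fun _ : ℕ => P) P' := by
  refine BRW.tendstoInDistribution_of_laplace
    (fun n => BRW.measurable_toRadonM (hBRW.measurable_rescaledProcess _ _ n))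
    (BRW.measurable_toRadonM (BRW.measurable_clusterCox hlim.measurable_atom
      hlim.measurable_size hlim.measurable_shift)) fun f => ?_
  rw [hBRW.integral_exp_neg_testInt_clusterCox hp hlim f]
  exact hBRW.tendsto_integral_exp_neg_testInt hp hν f
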